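/- **Conventions.** All representations are on complex vector spaces. A locally profinite group is a Hausdorff topological group in which every neighbourhood of the identity contains a compact open subgroup; it is assumed to be $\sigma$-compact. A representation $(\pi,V)$ of such a group $G$ is *smooth* if the stabilizer of every vector is open; a smooth representation is *admissible* if $V^K$ is finite-dimensional for every compact open subgroup $K$. $\mathrm{Irr}(G)$ is the set of isomorphism classes of irreducible smooth representations of $G$, and for smooth $\pi$ put $\mathcal R_G(\pi)=\{\sigma\in\mathrm{Irr}(G)\mid \mathrm{Hom}_G(\pi,\sigma)\neq 0\}$ and $m_G(\pi,\sigma)=\dim_{\mathbb C}\mathrm{Hom}_G(\pi,\sigma)$. A smooth representation $\pi$ of a product $G_1\times G_2$ is a *theta representation* if $m_{G_1\times G_2}(\pi,\Pi)\le 1$ for all $\Pi\in\mathrm{Irr}(G_1\times G_2)$ and both projections $p_i:\mathcal R_{G_1\times G_2}(\pi)\to\mathcal R_{G_i}(\pi)$, $\pi_1\otimes\pi_2\mapsto\pi_i$ ($\pi_i\in\mathrm{Irr}(G_i)$, $i=1,2$), are injective. If $H$ is a closed subgroup of $G$ and $(\rho,V)$ is a smooth representation of $H$, then $\mathrm{cInd}_H^G\rho$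 is the space of functions $f:G\to V$ such that $f(hg)=\rho(h)f(g)$ for $h\in H$, $g\in G$, $f$ is right invariant under some compact open subgroup of $G$, and $f$ is compactly supported modulo $H$; $G$ acts by right translation. **Theorem.** Let $G_1,G_2$ be $\sigma$-compact locally profinite groups and $H_i\subseteq G_i$ closed normal subgroups ($i=1,2$), let $\gamma:G_1/H_1\to G_2/H_2$ be an isomorphism of topological groups, and suppose that $G_1/H_1$ is compact. Suppose that all irreducible smooth representations of $G_1$, $G_2$, $G_1\times G_2$, $H_1$ and $H_2$ are admissible. Let $\Gamma=\{(g_1,g_2)\in G_1\times G_2\mid \gamma(g_1H_1)=g_2H_2\}$, so that $\Gamma/(H_1\times H_2)$ is the graph of $\gamma$, and let $\rho$ be a smooth representation of $\Gamma$ whose restriction to $H_1\times H_2$ is a theta representation of $H_1\times H_2$. Then $\pi=\mathrm{cInd}_\Gamma^{G_1\times G_2}\rho$ is a theta representation of $G_1\times G_2$. -/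

import Mathlib

open scoped TensorProduct

universe u u₁ u₂ v w

noncomputable section

namespace LocalTheta

/-- A locally profinite group: a Hausdorff topological group in which every neighbourhood of the
identity contains a compact open subgroup. -/
class LocallyProfinite (G : Type*) [Group G] [TopologicalSpace G] : Prop
    extends IsTopologicalGroup G, T2Space G where
  exists_compact_open_subgroup : ∀ U ∈ nhds (1 : G),
    ∃ K : Subgroup G, IsOpen (K : Set G) ∧ IsCompact (K : Set G) ∧ (K : Set G) ⊆ U

instance {G₁ G₂ : Type*} [Group G₁] [TopologicalSpace G₁] [Group G₂] [TopologicalSpace G₂]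
    [LocallyProfinite G₁] [LocallyProfinite G₂] : LocallyProfinite (G₁ × G₂) where
  exists_compact_open_subgroup := by
    intro U hU
    rw [Prod.one_eq_mk, nhds_prod_eq, Filter.mem_prod_iff] at hU
    obtain ⟨U₁, h₁, U₂, h₂, h⟩ := hU
    obtain ⟨K₁, o₁, c₁, s₁⟩ := LocallyProfinite.exists_compact_open_subgroup U₁ h₁
    obtain ⟨K₂, o₂, c₂, s₂⟩ := LocallyProfinite.exists_compact_open_subgroup U₂ h₂
    refine ⟨K₁.prod K₂, ?_, ?_, ?_⟩
    · rw [Subgroup.coe_prod]; exact o₁.prod o₂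
    · rw [Subgroup.coe_prod]; exact c₁.prod c₂
    · rw [Subgroup.coe_prod]; exact (Set.prod_mono s₁ s₂).trans h

section Basic

variable {G : Type u} [Group G] [TopologicalSpace G]

/-- A representation is smooth if the stabilizer of every vector is open. -/
def IsSmooth {V : Type v} [AddCommGroup V] [Module ℂ V] (π : Representation ℂ G V) : Prop :=
  ∀ x : V, IsOpen {g : G | π g x = x}

/-- A smooth representation is admissible if the vectors fixed by any compact open subgroup form
a finite-dimensional space. -/
def IsAdmissible {V : Type v} [AddCommGroup V] [Module ℂ V] (π : Representation ℂ G V) : Prop :=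
  IsSmooth π ∧ ∀ K : Subgroup G, IsOpen (K : Set G) → IsCompact (K : Set G) →
    Module.Finite ℂ (Representation.invariants (π.comp K.subtype))

/-- `π` represents an element of `Irr(G)`: it is smooth and (algebraically) irreducible. -/
def IsIrr {V : Type v} [AddCommGroup V] [Module ℂ V] (π : Representation ℂ G V) : Prop :=
  IsSmooth π ∧ π.IsIrreducible

variable (G) in
/-- Every irreducible smooth representation of `G` is admissible.  (If `G` is `σ`-compact, an
irreducible smooth representation has countable dimension, so the universe is immaterial.) -/
def AllIrrAdmissible : Prop :=
  ∀ (W : Type w) [AddCommGroup W] [Module ℂ W] (σ : Representation ℂ G W),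
    IsIrr σ → IsAdmissible σ

/-- `Π` represents an element of `R_G(π)`: it is an irreducible smooth representation with
`Hom_G(π, Π) ≠ 0`. -/
def IsIrrQuotient {V : Type v} [AddCommGroup V] [Module ℂ V] (π : Representation ℂ G V)
    {W : Type w} [AddCommGroup W] [Module ℂ W] (P : Representation ℂ G W) : Prop :=
  IsIrr P ∧ ∃ f : Representation.IntertwiningMap π P, f ≠ 0

end Basic

section Theta

variable {G₁ : Type u₁} {G₂ : Type u₂} [Group G₁] [Group G₂]

/-- The external tensor product `π₁ ⊗ π₂`, a representation of `G₁ × G₂`. -/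
def extTensor {V₁ V₂ : Type*} [AddCommGroup V₁] [Module ℂ V₁] [AddCommGroup V₂] [Module ℂ V₂]
    (π₁ : Representation ℂ G₁ V₁) (π₂ : Representation ℂ G₂ V₂) :
    Representation ℂ (G₁ × G₂) (V₁ ⊗[ℂ] V₂) :=
  Representation.tprod (π₁.comp (MonoidHom.fst G₁ G₂)) (π₂.comp (MonoidHom.snd G₁ G₂))

variable [TopologicalSpace G₁] [TopologicalSpace G₂]

/-- A smooth representation `π` of `G₁ × G₂` is a theta representation if it is multiplicity-free
and both projections `p_i : R_{G₁ × G₂}(π) → R_{G_i}(π)`, `π₁ ⊗ π₂ ↦ π_i`, are injective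
(on isomorphism classes). -/
structure IsThetaRep {V : Type v} [AddCommGroup V] [Module ℂ V]
    (π : Representation ℂ (G₁ × G₂) V) : Prop where
  smooth : IsSmooth π
  multiplicity_le_one : ∀ (W : Type w) [AddCommGroup W] [Module ℂ W]
    (P : Representation ℂ (G₁ × G₂) W), IsIrr P →
      Module.rank ℂ (Representation.IntertwiningMap π P) ≤ 1
  fst_injective : ∀ (V₁ V₂ V₁' V₂' : Type w)
    [AddCommGroup V₁] [Module ℂ V₁] [AddCommGroup V₂] [Module ℂ V₂]
    [AddCommGroup V₁'] [Module ℂ V₁'] [AddCommGroup V₂'] [Module ℂ V₂']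
    (π₁ : Representation ℂ G₁ V₁) (π₂ : Representation ℂ G₂ V₂)
    (π₁' : Representation ℂ G₁ V₁') (π₂' : Representation ℂ G₂ V₂'),
    IsIrr π₁ → IsIrr π₂ → IsIrr π₁' → IsIrr π₂' →
    IsIrrQuotient π (extTensor π₁ π₂) → IsIrrQuotient π (extTensor π₁' π₂') →
    Nonempty (Representation.Equiv π₁ π₁') →
    Nonempty (Representation.Equiv (extTensor π₁ π₂) (extTensor π₁' π₂'))
  snd_injective : ∀ (V₁ V₂ V₁' V₂' : Type w)
    [AddCommGroup V₁] [Module ℂ V₁] [AddCommGroup V₂] [Module ℂ V₂]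
    [AddCommGroup V₁'] [Module ℂ V₁'] [AddCommGroup V₂'] [Module ℂ V₂']
    (π₁ : Representation ℂ G₁ V₁) (π₂ : Representation ℂ G₂ V₂)
    (π₁' : Representation ℂ G₁ V₁') (π₂' : Representation ℂ G₂ V₂'),
    IsIrr π₁ → IsIrr π₂ → IsIrr π₁' → IsIrr π₂' →
    IsIrrQuotient π (extTensor π₁ π₂) → IsIrrQuotient π (extTensor π₁' π₂') →
    Nonempty (Representation.Equiv π₂ π₂') →
    Nonempty (Representation.Equiv (extTensor π₁ π₂) (extTensor π₁' π₂'))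

end Theta

section Induction

variable {G : Type u} [Group G] [TopologicalSpace G] [LocallyProfinite G]
variable {H : Subgroup G} {V : Type v} [AddCommGroup V] [Module ℂ V]

/-- The space of `cInd_H^G ρ`: functions `f : G → V` with `f (h g) = ρ(h) f(g)` that are right
invariant under some compact open subgroup and compactly supported modulo `H`, that is, supported
in `H C` for a compact set `C`. -/
def cIndSpace (ρ : Representation ℂ H V) : Submodule ℂ (G → V) where
  carrier := {f | (∀ (h : H) (g : G), f (h * g) = ρ h (f g)) ∧
    (∃ K : Subgroup G, IsOpen (K : Set G) ∧ IsCompact (K : Set G) ∧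
      ∀ g : G, ∀ k ∈ K, f (g * k) = f g) ∧
    (∃ C : Set G, IsCompact C ∧ ∀ g : G, f g ≠ 0 → ∃ h : H, ∃ c ∈ C, g = h * c)}
  zero_mem' := by
    obtain ⟨K, hK, hK', -⟩ :=
      LocallyProfinite.exists_compact_open_subgroup (Set.univ : Set G) Filter.univ_mem
    exact ⟨fun h g => by simp, ⟨K, hK, hK', fun _ _ _ => rfl⟩, ∅, isCompact_empty,
      fun g hg => absurd rfl hg⟩
  add_mem' := by
    rintro f₁ f₂ ⟨a₁, ⟨K₁, o₁, c₁, i₁⟩, C₁, d₁, s₁⟩ ⟨a₂, ⟨K₂, o₂, c₂, i₂⟩, C₂, d₂, s₂⟩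
    refine ⟨fun h g => by simp [a₁, a₂], ⟨K₁ ⊓ K₂, ?_, ?_, ?_⟩, C₁ ∪ C₂, d₁.union d₂, ?_⟩
    · rw [Subgroup.coe_inf]; exact o₁.inter o₂
    · rw [Subgroup.coe_inf]; exact c₁.inter c₂
    · intro g k hk
      simp [i₁ g k hk.1, i₂ g k hk.2]
    · intro g hg
      by_cases h₁ : f₁ g = 0
      · have h₂ : f₂ g ≠ 0 := fun h₂ => hg (by simp [h₁, h₂])
        obtain ⟨h, c, hc, e⟩ := s₂ g h₂
        exact ⟨h, c, Or.inr hc, e⟩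
      · obtain ⟨h, c, hc, e⟩ := s₁ g h₁
        exact ⟨h, c, Or.inl hc, e⟩
  smul_mem' := by
    rintro z f ⟨a, ⟨K, o, c, i⟩, C, d, s⟩
    refine ⟨fun h g => by simp [a], ⟨K, o, c, fun g k hk => by simp [i g k hk]⟩, C, d, ?_⟩
    intro g hg
    exact s g fun h => hg (by simp [h])

lemma translate_mem_cIndSpace (ρ : Representation ℂ H V) (x : G) {f : G → V}
    (hf : f ∈ cIndSpace ρ) : (fun g => f (g * x)) ∈ cIndSpace ρ := by
  obtain ⟨a, ⟨K, o, c, i⟩, C, d, s⟩ := hf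
  refine ⟨fun h g => by simp [mul_assoc, a], ⟨K.comap (MulAut.conj x⁻¹).toMonoidHom, ?_, ?_, ?_⟩,
    (fun y => y * x⁻¹) '' C, d.image (by fun_prop), ?_⟩
  · have hcont : Continuous fun y : G => x⁻¹ * y * x⁻¹⁻¹ := by fun_prop
    exact o.preimage hcont
  · have : ((K.comap (MulAut.conj x⁻¹).toMonoidHom : Subgroup G) : Set G)
        = (fun y => x * y * x⁻¹) '' (K : Set G) := by
      ext y
      constructor
      · intro hy
        exact ⟨x⁻¹ * y * x, by simpa using hy, by group⟩
      · rintro ⟨k, hk, rfl⟩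
        have e : x⁻¹ * (x * k * x⁻¹) * x = k := by group
        simpa [e] using hk
    rw [this]
    exact c.image (by fun_prop)
  · intro g k hk
    have hk' : x⁻¹ * k * x ∈ K := by simpa using hk
    have e : g * k * x = g * x * (x⁻¹ * k * x) := by group
    simp only [e]
    exact i _ _ hk'
  · intro g hg
    obtain ⟨h, y, hy, e⟩ := s (g * x) hg
    exact ⟨h, y * x⁻¹, ⟨y, hy, rfl⟩, by rw [← mul_assoc, ← e]; group⟩

/-- Compact induction `cInd_H^G ρ` (unnormalized), with `G` acting by right translation. -/
def cInd (ρ : Representation ℂ H V) : Representation ℂ G (cIndSpace ρ) where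
  toFun x :=
    { toFun := fun f => ⟨fun g => f.1 (g * x), translate_mem_cIndSpace ρ x f.2⟩
      map_add' := fun _ _ => rfl
      map_smul' := fun _ _ => rfl }
  map_one' := by
    ext f g
    simp
  map_mul' x y := by
    ext f g
    simp [mul_assoc]

end Induction

section Graph

variable {G₁ : Type u₁} {G₂ : Type u₂} [Group G₁] [TopologicalSpace G₁] [Group G₂] [TopologicalSpace G₂]
variable {H₁ : Subgroup G₁} {H₂ : Subgroup G₂} [H₁.Normal] [H₂.Normal]

/-- The subgroup `Γ` of `G₁ × G₂` containing `H₁ × H₂` such that `Γ / (H₁ × H₂)` is the graph of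
`γ : G₁ / H₁ ≃ G₂ / H₂`. -/
def graphSubgroup (γ : (G₁ ⧸ H₁) ≃ₜ* (G₂ ⧸ H₂)) : Subgroup (G₁ × G₂) where
  carrier := {g | γ (g.1 : G₁ ⧸ H₁) = (g.2 : G₂ ⧸ H₂)}
  one_mem' := by simp
  mul_mem' := by
    intro a b ha hb
    simp only [Set.mem_ofPred_eq] at ha hb
    simp [ha, hb]
  inv_mem' := by
    intro a ha
    simp only [Set.mem_ofPred_eq] at ha
    simp [ha]

/-- The inclusion `H₁ × H₂ → Γ`. -/
def prodToGraph (γ : (G₁ ⧸ H₁) ≃ₜ* (G₂ ⧸ H₂)) : H₁ × H₂ →* graphSubgroup γ where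
  toFun h := ⟨(h.1, h.2), by
    change γ ((h.1 : G₁) : G₁ ⧸ H₁) = ((h.2 : G₂) : G₂ ⧸ H₂)
    rw [(QuotientGroup.eq_one_iff (h.1 : G₁)).2 h.1.2, (QuotientGroup.eq_one_iff (h.2 : G₂)).2 h.2.2,
      map_one]⟩
  map_one' := rfl
  map_mul' _ _ := rfl

end Graph

end LocalTheta

end

/-!
# Theta representations and compact induction from a graph

Write `M = cInd ρ`, `G = G₁ × G₂` and `N = H₁ × H₂`. As a representation of the normal subgroup
`N`, `M` is a space of sections over `Γ \ G` whose fibre at `g` is `ρ` twisted by conjugation with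
`g` (`fiberRep`). Multiplying sections by the indicator functions of open and closed subsets of `Γ
\ G` commutes with `N`, so an `N`-map from `M` to an irreducible `τ` can be studied locally: it
vanishes as soon as it is locally zero (`eq_zero_of_locallyZero`), and it is locally zero wherever
the fibre has no map to `τ` (`locallyZero_of_equivariantHom_eq_bot`).

Suppose that `π₁ ⊗ π₂` and `π₁ ⊗ π₂'` are irreducible quotients of `M`, with quotient maps of
different kernels. Then the two maps are jointly surjective, so that `π₁ ⊗ (π₂ ⊕ π₂')` is a
quotient of `M`. Let `m(τ, π)` denote the dimension of the space of `H`-maps from `π` to `τ`.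
Since `G₁ / H₁` is compact, `π₁` has an irreducible `H₁`-quotient `τ₁` and `m(τ₁, π₁)` is finite.
By localization, `τ₁` has a partner `τ₂`, an `H₂`-quotient of `π₂`, such that `τ₁ ⊗ τ₂` is a
quotient of `ρ`; by the theta property of `ρ` over `N` this partner is unique, hence is also a
quotient of `π₂'`.

The heart of the proof is the inequality `m(τ₂, Y) ≤ m(τ₁, π₁)`, valid whenever `π₁ ⊗ Y` is a
quotient of `M` (`finrank_snd_le_finrank_fst`), and its mirror image. Each pair `a : π₁ → τ₁`, `b
: Y → τ₂` gives an `N`-map `Φ a b : M → τ₁ ⊗ τ₂`. Evaluate `l ∘ Φ a b`, for a smooth functional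
`l`, at a single section `ψ` supported near `Γ`. The multiplicity one property of `ρ` makes the
fibre at `1` one-dimensional modulo what `l` ignores. The fibres near `1` with a map to `τ₁ ⊗ τ₂`
are translates of it by elements `(s, 1)` such that `τ₁` is isomorphic to its twist by `s`, again
by the theta property, and for small `s` translation by such an element does not change `l ∘ Φ a
b` (`exists_subgroup_functional_invariant`). So if `l (Φ a b ψ) = 0`, then all the pieces of `ψ`
are killed too, and if this happens for all `a`, then `Φ a b = 0` for all `a`
(`finrank_le_finrank_of_bilinear`). Thus `b ↦ (a ↦ l (Φ a b ψ))` embeds the space of maps `Y → τ₂`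
into the dual of the space of maps `π₁ → τ₁`.

Taking `Y = π₂ ⊕ π₂'`, one gets `m(τ₂, π₂) + m(τ₂, π₂') ≤ m(τ₁, π₁) ≤ m(τ₂, π₂)`, a contradiction.
So every irreducible quotient of `M` with first factor `π₁` comes from one and the same quotient
map (`exists_factor_of_fst`), and symmetrically for the second factor. With Schur's lemma and the
factorization of irreducible representations of `G` as external tensor products
(`exists_extTensor_equiv`), this is the theta property of `M`.
-/

noncomputable section

namespace LocalTheta

/-! ### Irreducible representations -/

section Irreducible

variable {G : Type*} [Group G] {V : Type*} [AddCommGroup V] [Module ℂ V]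

theorem isIrreducible_iff {π : Representation ℂ G V} :
    π.IsIrreducible ↔ Nontrivial V ∧
      ∀ S : Submodule ℂ V, (∀ g, ∀ x ∈ S, π g x ∈ S) → S = ⊥ ∨ S = ⊤ := by
  constructor
  · intro h
    have hb : (⊥ : Subrepresentation π) ≠ ⊤ := bot_ne_top
    refine ⟨?_, fun S hS => ?_⟩
    · by_contra hV
      rw [not_nontrivial_iff_subsingleton] at hV
      exact hb (Subrepresentation.toSubmodule_injective (Subsingleton.elim _ _))
    · rcases eq_bot_or_eq_top (⟨S, fun g x hx => hS g x hx⟩ : Subrepresentation π) with h | h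
      · exact Or.inl (congrArg Subrepresentation.toSubmodule h)
      · exact Or.inr (congrArg Subrepresentation.toSubmodule h)
  · rintro ⟨hV, h⟩
    refine { exists_pair_ne := ⟨⊥, ⊤, fun e => ?_⟩, eq_bot_or_eq_top := fun S => ?_ }
    · exact bot_ne_top (α := Submodule ℂ V) (congrArg Subrepresentation.toSubmodule e)
    · rcases h S.toSubmodule (fun g x hx => S.apply_mem_toSubmodule g hx) with h | h
      · exact Or.inl (Subrepresentation.toSubmodule_injective h)
      · exact Or.inr (Subrepresentation.toSubmodule_injective h)

theorem nontrivial_of_isIrreducible {π : Representation ℂ G V} (h : π.IsIrreducible) :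
    Nontrivial V :=
  (isIrreducible_iff.1 h).1

theorem span_orbit_eq_top {π : Representation ℂ G V} (h : π.IsIrreducible) {x : V} (hx : x ≠ 0) :
    Submodule.span ℂ (Set.range fun g => π g x) = ⊤ := by
  refine ((isIrreducible_iff.1 h).2 _ fun g y hy => ?_).resolve_left fun e => hx ?_
  · induction hy using Submodule.span_induction with
    | mem y hy =>
      obtain ⟨k, rfl⟩ := hy
      exact Submodule.subset_span ⟨g * k, by simp⟩
    | zero => simp
    | add a b _ _ ha hb => rw [map_add]; exact add_mem ha hb
    | smul c a _ ha => rw [map_smul]; exact Submodule.smul_mem _ c ha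
  · have : x ∈ Submodule.span ℂ (Set.range fun g => π g x) :=
      Submodule.subset_span ⟨1, by simp⟩
    simpa [e] using this

/-- In an irreducible representation a non-zero functional does not vanish on the whole orbit of
a non-zero vector. -/
theorem exists_functional_orbit_ne_zero {π : Representation ℂ G V} (h : π.IsIrreducible)
    {l : V →ₗ[ℂ] ℂ} (hl : l ≠ 0) {x : V} (hx : x ≠ 0) : ∃ g, l (π g x) ≠ 0 := by
  by_contra! H
  refine hl (LinearMap.ext fun y => ?_)
  have hy : y ∈ Submodule.span ℂ (Set.range fun g => π g x) := by
    rw [span_orbit_eq_top h hx]; trivial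
  induction hy using Submodule.span_induction with
  | mem y hy => obtain ⟨g, rfl⟩ := hy; simpa using H g
  | zero => simp
  | add a b _ _ ha hb => simp [ha, hb]
  | smul c a _ ha => simp [ha]

variable {W : Type*} [AddCommGroup W] [Module ℂ W]

theorem surjective_of_ne_zero {π : Representation ℂ G V} {σ : Representation ℂ G W}
    (h : σ.IsIrreducible) {T : V →ₗ[ℂ] W} (hT : ∀ g x, T (π g x) = σ g (T x)) (h0 : T ≠ 0) :
    Function.Surjective T := by
  rw [← LinearMap.range_eq_top]
  refine ((isIrreducible_iff.1 h).2 _ ?_).resolve_left fun e => h0 (LinearMap.range_eq_bot.1 e)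
  rintro g _ ⟨x, rfl⟩
  exact ⟨π g x, hT g x⟩

theorem injective_of_ne_zero {π : Representation ℂ G V} {σ : Representation ℂ G W}
    (h : π.IsIrreducible) {T : V →ₗ[ℂ] W} (hT : ∀ g x, T (π g x) = σ g (T x)) (h0 : T ≠ 0) :
    Function.Injective T := by
  rw [← LinearMap.ker_eq_bot]
  refine ((isIrreducible_iff.1 h).2 _ ?_).resolve_right fun e => h0 (LinearMap.ker_eq_top.1 e)
  intro g x hx
  rw [LinearMap.mem_ker] at hx ⊢
  rw [hT, hx, map_zero]

theorem nonempty_equiv_of_bijective {π : Representation ℂ G V} {σ : Representation ℂ G W}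
    {T : V →ₗ[ℂ] W} (hT : ∀ g x, T (π g x) = σ g (T x)) (hb : Function.Bijective T) :
    Nonempty (Representation.Equiv π σ) :=
  ⟨.mk (LinearEquiv.ofBijective T hb) fun g => LinearMap.ext fun x => hT g x⟩

theorem isIrreducible_of_bijective {π : Representation ℂ G V} {σ : Representation ℂ G W}
    {T : V →ₗ[ℂ] W} (hT : ∀ g x, T (π g x) = σ g (T x)) (hb : Function.Bijective T)
    (h : π.IsIrreducible) : σ.IsIrreducible := by
  rw [isIrreducible_iff] at h ⊢
  obtain ⟨hV, h⟩ := h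
  refine ⟨hb.1.nontrivial, fun S hS => ?_⟩
  rcases h (S.comap T) (fun g x hx => by
    rw [Submodule.mem_comap] at hx ⊢; rw [hT]; exact hS g _ hx) with e | e
  · left
    rw [← Submodule.map_comap_eq_of_surjective hb.2 S, e, Submodule.map_bot]
  · right
    rw [← Submodule.map_comap_eq_of_surjective hb.2 S, e, Submodule.map_top,
      LinearMap.range_eq_top.2 hb.2]

/-- Twisting by a surjective homomorphism preserves irreducibility. -/
theorem isIrreducible_comp {H : Type*} [Group H] {π : Representation ℂ G V}
    (h : π.IsIrreducible) {c : H →* G} (hc : Function.Surjective c) :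
    Representation.IsIrreducible (π.comp c) := by
  rw [isIrreducible_iff] at h ⊢
  refine ⟨h.1, fun S hS => h.2 S fun g x hx => ?_⟩
  obtain ⟨k, rfl⟩ := hc g
  exact hS k x hx

/-- The conclusion of Schur's lemma: every endomorphism of the representation is a scalar. -/
def HasScalarEnd (π : Representation ℂ G V) : Prop :=
  ∀ T : V →ₗ[ℂ] V, (∀ g x, T (π g x) = π g (T x)) → ∃ c : ℂ, ∀ x, T x = c • x

/-- Jacobson density for an irreducible representation satisfying Schur's lemma: the group algebra
moves a linearly independent family to any prescribed family. -/
theorem exists_asAlgebraHom_eq {π : Representation ℂ G V} (h : π.IsIrreducible)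
    (hs : HasScalarEnd π) {ι : Type*} [Finite ι] {u : ι → V} (hu : LinearIndependent ℂ u)
    (y : ι → V) : ∃ α : MonoidAlgebra ℂ G, ∀ i, π.asAlgebraHom α (u i) = y i := by
  classical
  cases nonempty_fintype ι
  have hsimple := (Representation.irreducible_iff_isSimpleModule_asModule π).1 h
  obtain ⟨f, hf⟩ : ∃ f : V →ₗ[ℂ] V, ∀ i, f (u i) = y i := by
    obtain ⟨f, hf⟩ := LinearMap.exists_extend ((Module.Basis.span hu).constr ℂ y)
    refine ⟨f, fun i => ?_⟩
    have h1 := LinearMap.congr_fun hf (Module.Basis.span hu i)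
    rw [Module.Basis.constr_basis] at h1
    simpa [Module.Basis.span_apply] using h1
  -- By Schur's lemma a `ℂ`-linear map commutes with all endomorphisms of the module.
  let F : Module.End (Module.End (MonoidAlgebra ℂ G) π.asModule) π.asModule :=
    { toFun := fun x => π.asModuleEquiv.symm (f (π.asModuleEquiv x))
      map_add' := fun x x' => by simp
      map_smul' := fun T x => by
        obtain ⟨c, hc⟩ := hs
          (π.asModuleEquiv.toLinearMap ∘ₗ (T.restrictScalars ℂ) ∘ₗ
            π.asModuleEquiv.symm.toLinearMap) (fun g x => by
              have := T.map_smul (MonoidAlgebra.of ℂ G g) (π.asModuleEquiv.symm x)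
              simp only [LinearMap.comp_apply, LinearEquiv.coe_coe,
                LinearMap.restrictScalars_apply]
              rw [Representation.asModuleEquiv_symm_map_rho, this,
                Representation.asModuleEquiv_map_smul, Representation.asAlgebraHom_of])
        have hT : ∀ z, T z = π.asModuleEquiv.symm (c • π.asModuleEquiv z) := fun z => by
          have := hc (π.asModuleEquiv z)
          simp only [LinearMap.comp_apply, LinearEquiv.coe_coe,
            LinearMap.restrictScalars_apply, LinearEquiv.symm_apply_apply] at this
          rw [← this, LinearEquiv.symm_apply_apply]
        simp only [RingHom.id_apply, Module.End.smul_def]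
        rw [hT, hT, LinearEquiv.apply_symm_apply, LinearEquiv.apply_symm_apply, map_smul] }
  obtain ⟨α, hα⟩ := jacobson_density F (Finset.univ.image fun i => π.asModuleEquiv.symm (u i))
  refine ⟨α, fun i => ?_⟩
  have h1 := hα (π.asModuleEquiv.symm (u i)) (by simp)
  have h2 := congrArg π.asModuleEquiv h1
  rw [Representation.asModuleEquiv_map_smul] at h2
  simpa [F, hf] using h2.symm

/-- A family of linear maps with trivial common kernel on a finite-dimensional space has a finite
subfamily with trivial common kernel. -/
theorem exists_finset_separating {ι E W : Type*} [AddCommGroup E] [Module ℂ E]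
    [Module.Finite ℂ E] [AddCommGroup W] [Module ℂ W] (l : ι → E →ₗ[ℂ] W)
    (h : ∀ x, (∀ i, l i x = 0) → x = 0) :
    ∃ s : Finset ι, ∀ x, (∀ i ∈ s, l i x = 0) → x = 0 := by
  classical
  have h1 : (⨅ i, LinearMap.ker (l i)) = ⊥ := by
    rw [eq_bot_iff]
    intro x hx
    simp only [Submodule.mem_iInf, LinearMap.mem_ker] at hx
    exact h x hx
  obtain ⟨s, hs⟩ := Finset.exists_inf_le (fun i => LinearMap.ker (l i))
  refine ⟨s, fun x hx => ?_⟩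
  have : x ∈ ⨅ i, LinearMap.ker (l i) := by
    rw [Submodule.mem_iInf]
    intro i
    refine hs i ?_
    simpa [Submodule.mem_finsetInf] using hx
  simpa [h1] using this

end Irreducible

/-! ### Averaging over a compact group -/

section Average

variable {K : Type*} [Group K] {V : Type*} [AddCommGroup V] [Module ℂ V]

/-- The average of `σ k` over representatives of the left cosets of a subgroup of finite index. -/
def cosetAverage (σ : Representation ℂ K V) (L : Subgroup K) [L.FiniteIndex] : V →ₗ[ℂ] V :=
  letI := Fintype.ofFinite (K ⧸ L)
  (Fintype.card (K ⧸ L) : ℂ)⁻¹ • ∑ q : K ⧸ L, σ q.out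

variable {σ : Representation ℂ K V} {L : Subgroup K}

theorem apply_out {x : V} (hx : ∀ k ∈ L, σ k x = x) (k : K) :
    σ (Quotient.out (k : K ⧸ L)) x = σ k x := by
  obtain ⟨l, hl⟩ := QuotientGroup.mk_out_eq_mul L k
  rw [hl, map_mul, Module.End.mul_apply, hx l l.2]

variable [L.FiniteIndex]

theorem apply_cosetAverage {x : V} (hx : ∀ k ∈ L, σ k x = x) (k : K) :
    σ k (cosetAverage σ L x) = cosetAverage σ L x := by
  simp only [cosetAverage, LinearMap.smul_apply, LinearMap.sum_apply, map_smul, map_sum]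
  congr 1
  let _ := Fintype.ofFinite (K ⧸ L)
  refine Fintype.sum_equiv (MulAction.toPerm k) _ _ fun q => ?_
  induction q using QuotientGroup.induction_on with
  | H a =>
    rw [apply_out hx, MulAction.toPerm_apply]
    change _ = σ (Quotient.out ((k * a : K) : K ⧸ L)) x
    rw [apply_out hx, map_mul, Module.End.mul_apply]

theorem cosetAverage_of_fixed {x : V} (hx : ∀ k, σ k x = x) : cosetAverage σ L x = x := by
  let _ := Fintype.ofFinite (K ⧸ L)
  have : (Fintype.card (K ⧸ L) : ℂ) ≠ 0 := by simp
  simp only [cosetAverage, LinearMap.smul_apply, LinearMap.sum_apply, hx, Finset.sum_const,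
    Finset.card_univ]
  rw [← Nat.cast_smul_eq_nsmul ℂ, smul_smul, inv_mul_cancel₀ this, one_smul]

theorem cosetAverage_apply [L.Normal] {x : V} (hx : ∀ k ∈ L, σ k x = x) (k : K) :
    cosetAverage σ L (σ k x) = cosetAverage σ L x := by
  have hx' : ∀ l ∈ L, σ l (σ k x) = σ k x := fun l hl => by
    have e : l * k = k * (k⁻¹ * l * k) := by group
    have h2 : k⁻¹ * l * k ∈ L := by simpa using Subgroup.Normal.conj_mem ‹L.Normal› l hl k⁻¹
    rw [← Module.End.mul_apply, ← map_mul, e, map_mul, Module.End.mul_apply, hx _ h2]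
  simp only [cosetAverage, LinearMap.smul_apply, LinearMap.sum_apply]
  congr 1
  let _ := Fintype.ofFinite (K ⧸ L)
  refine Fintype.sum_equiv (Equiv.mulRight (k : K ⧸ L)) _ _ fun q => ?_
  induction q using QuotientGroup.induction_on with
  | H a =>
    rw [apply_out hx']
    change _ = σ (Quotient.out ((a * k : K) : K ⧸ L)) x
    rw [apply_out hx, map_mul, Module.End.mul_apply]

/-- For a representation all of whose stabilizers have finite index (such as a smooth
representation of a compact group) there is a linear projector onto the invariants; on any finite
set of vectors it is a finite average. -/
theorem exists_average (σ : Representation ℂ K V)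
    (hσ : ∀ x, ∃ L : Subgroup K, L.FiniteIndex ∧ ∀ k ∈ L, σ k x = x) :
    ∃ e : V →ₗ[ℂ] V, (∀ k x, σ k (e x) = e x) ∧ (∀ x, (∀ k, σ k x = x) → e x = x) ∧
      (∀ k x, e (σ k x) = e x) ∧
      ∀ s : Finset V, ∃ t : Finset K, t.Nonempty ∧
        ∀ x ∈ s, e x = (t.card : ℂ)⁻¹ • ∑ k ∈ t, σ k x := by
  classical
  have hN : ∀ x, ∃ L : Subgroup K, L.FiniteIndex ∧ L.Normal ∧ ∀ k ∈ L, σ k x = x := fun x => by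
    obtain ⟨L, h1, h2⟩ := hσ x
    exact ⟨L.normalCore, inferInstance, inferInstance, fun k hk => h2 k (L.normalCore_le hk)⟩
  have hN' : ∀ s : Finset V, ∃ L : Subgroup K, L.FiniteIndex ∧ L.Normal ∧
      ∀ x ∈ s, ∀ k ∈ L, σ k x = x := fun s => by
    induction s using Finset.induction_on with
    | empty => exact ⟨⊤, inferInstance, inferInstance, by simp⟩
    | insert a s _ ih =>
      obtain ⟨L₁, h1, h2, h3⟩ := ih
      obtain ⟨L₂, h4, h5, h6⟩ := hN a
      refine ⟨L₁ ⊓ L₂, inferInstance, inferInstance, fun x hx k hk => ?_⟩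
      rcases Finset.mem_insert.1 hx with rfl | hx
      · exact h6 k hk.2
      · exact h3 x hx k hk.1
  -- The invariants are complemented by the span of the differences `σ k x - x`, since each element
  -- of this span is killed by the coset averages for all small enough normal subgroups `L`.
  let D : Submodule ℂ V := Submodule.span ℂ {y | ∃ k x, y = σ k x - x}
  have hD : ∀ y ∈ D, ∃ s : Finset V, ∀ L : Subgroup K, ∀ [L.FiniteIndex] [L.Normal],
      (∀ x ∈ s, ∀ k ∈ L, σ k x = x) → cosetAverage σ L y = 0 := fun y hy => by
    induction hy using Submodule.span_induction with
    | mem y hy =>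
      obtain ⟨k, x, rfl⟩ := hy
      refine ⟨{x}, fun L _ _ hL => ?_⟩
      rw [map_sub, cosetAverage_apply (hL x (by simp)), sub_self]
    | zero => exact ⟨∅, fun L _ _ _ => map_zero _⟩
    | add a b _ _ ha hb =>
      obtain ⟨s₁, h1⟩ := ha
      obtain ⟨s₂, h2⟩ := hb
      refine ⟨s₁ ∪ s₂, fun L _ _ hL => ?_⟩
      rw [map_add, h1 L fun x hx => hL x (Finset.mem_union_left _ hx),
        h2 L fun x hx => hL x (Finset.mem_union_right _ hx), add_zero]
    | smul c a _ ha =>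
      obtain ⟨s₁, h1⟩ := ha
      exact ⟨s₁, fun L _ _ hL => by rw [map_smul, h1 L hL, smul_zero]⟩
  have hmem : ∀ (L : Subgroup K) [L.FiniteIndex] (x : V), x - cosetAverage σ L x ∈ D :=
      fun L _ x => by
    let _ := Fintype.ofFinite (K ⧸ L)
    have hc : (Fintype.card (K ⧸ L) : ℂ) ≠ 0 := by simp
    have : x - cosetAverage σ L x
        = -((Fintype.card (K ⧸ L) : ℂ)⁻¹ • ∑ q : K ⧸ L, (σ q.out x - x)) := by
      rw [Finset.sum_sub_distrib, Finset.sum_const, Finset.card_univ, smul_sub,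
        ← Nat.cast_smul_eq_nsmul ℂ, smul_smul, inv_mul_cancel₀ hc, one_smul]
      simp only [cosetAverage, LinearMap.smul_apply, LinearMap.sum_apply]
      rw [neg_sub]
    rw [this]
    exact neg_mem (D.smul_mem _ (sum_mem fun q _ => Submodule.subset_span ⟨_, _, rfl⟩))
  have hI : ∀ (x : V), x ∈ Representation.invariants σ ↔ ∀ k, σ k x = x := fun x => Iff.rfl
  have hcompl : IsCompl (Representation.invariants σ) D := by
    constructor
    · rw [Submodule.disjoint_def]
      intro y hy hyD
      obtain ⟨s, hs⟩ := hD y hyD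
      obtain ⟨L, h1, h2, h3⟩ := hN' s
      rw [← hs L h3, cosetAverage_of_fixed ((hI y).1 hy)]
    · rw [codisjoint_iff, eq_top_iff]
      intro x _
      obtain ⟨L, h1, h2, h3⟩ := hN x
      exact Submodule.mem_sup.2 ⟨cosetAverage σ L x, fun k => apply_cosetAverage h3 k,
        x - cosetAverage σ L x, hmem L x, by abel⟩
  let e : V →ₗ[ℂ] V := (Representation.invariants σ).subtype ∘ₗ
    Submodule.projectionOnto _ _ hcompl
  have he : ∀ x, (∀ k, σ k x = x) → e x = x := fun x hx => by
    have := Submodule.projectionOnto_apply_left hcompl ⟨x, (hI x).2 hx⟩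
    simp only [e, LinearMap.comp_apply]
    rw [this]; rfl
  have heD : ∀ x ∈ D, e x = 0 := fun x hx => by
    have := Submodule.projectionOnto_apply_right hcompl ⟨x, hx⟩
    simp only [e, LinearMap.comp_apply]
    rw [this]; rfl
  refine ⟨e, fun k x => (Submodule.projectionOnto _ _ hcompl x).2 k, he, fun k x => ?_,
    fun s => ?_⟩
  · rw [← sub_eq_zero, ← map_sub]
    exact heD _ (Submodule.subset_span ⟨k, x, rfl⟩)
  obtain ⟨L, h1, h2, h3⟩ := hN' s
  let _ := Fintype.ofFinite (K ⧸ L)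
  have hinj : Function.Injective (Quotient.out : K ⧸ L → K) := Quotient.out_injective
  refine ⟨Finset.univ.image (Quotient.out : K ⧸ L → K), ⟨_, Finset.mem_image_of_mem _
    (Finset.mem_univ ((1 : K) : K ⧸ L))⟩, fun x hx => ?_⟩
  have e1 : e x = cosetAverage σ L x := by
    rw [← he _ (fun k => apply_cosetAverage (h3 x hx) k), ← sub_eq_zero, ← map_sub]
    exact heD _ (hmem L x)
  rw [e1, Finset.sum_image hinj.injOn, Finset.card_image_of_injective _ hinj, Finset.card_univ]
  simp only [cosetAverage, LinearMap.smul_apply, LinearMap.sum_apply]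
  rfl

end Average


/-! ### Smooth and admissible representations -/

section Smooth

variable {G : Type*} [Group G] {V : Type*} [AddCommGroup V] [Module ℂ V]

/-- The space `V^K` of vectors fixed by a subgroup `K` of `G`. -/
def fixedBy (π : Representation ℂ G V) (K : Subgroup G) : Submodule ℂ V where
  carrier := {x | ∀ k ∈ K, π k x = x}
  zero_mem' := fun k _ => map_zero _
  add_mem' := fun ha hb k hk => by rw [map_add, ha k hk, hb k hk]
  smul_mem' := fun c x hx k hk => by rw [map_smul, hx k hk]

variable [TopologicalSpace G]

theorem IsAdmissible.finite_fixedBy {π : Representation ℂ G V} (h : IsAdmissible π)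
    {K : Subgroup G} (ho : IsOpen (K : Set G)) (hc : IsCompact (K : Set G)) :
    Module.Finite ℂ (fixedBy π K) := by
  have e : fixedBy π K = Representation.invariants (π.comp K.subtype) :=
    le_antisymm (fun x hx k => hx k k.2) (fun x hx k hk => hx ⟨k, hk⟩)
  rw [e]
  exact h.2 K ho hc

theorem IsSmooth.comp {H : Type*} [Group H] [TopologicalSpace H] {π : Representation ℂ G V}
    (h : IsSmooth π) {c : H →* G} (hc : Continuous c) : IsSmooth (π.comp c) :=
  fun x => (h x).preimage hc

/-- The stabilizer of a vector. -/
def vectorStabilizer (π : Representation ℂ G V) (x : V) : Subgroup G where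
  carrier := {g | π g x = x}
  one_mem' := by simp
  mul_mem' := fun {a b} ha hb => by
    change π (a * b) x = x
    rw [map_mul, Module.End.mul_apply, show π b x = x from hb, show π a x = x from ha]
  inv_mem' := fun {a} ha => by
    change π a⁻¹ x = x
    rw [Representation.inv_apply_eq_iff]
    exact (show π a x = x from ha).symm

theorem isSmooth_of_forall_exists [IsTopologicalGroup G] {π : Representation ℂ G V}
    (h : ∀ x, ∃ K : Subgroup G, IsOpen (K : Set G) ∧ ∀ k ∈ K, π k x = x) : IsSmooth π := by
  intro x
  obtain ⟨K, ho, hK⟩ := h x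
  exact Subgroup.isOpen_mono (H₁ := K) (H₂ := vectorStabilizer π x) hK ho

/-- An open subgroup has finite index in a compact one. -/
theorem finiteIndex_subgroupOf [IsTopologicalGroup G] {U K : Subgroup G}
    (hU : IsOpen (U : Set G)) (hK : IsCompact (K : Set G)) : (U.subgroupOf K).FiniteIndex := by
  have : CompactSpace K := isCompact_iff_compactSpace.1 hK
  have ho : IsOpen ((U.subgroupOf K : Subgroup K) : Set K) := hU.preimage continuous_subtype_val
  have := (U.subgroupOf K).quotient_finite_of_isOpen ho
  exact Subgroup.finiteIndex_of_finite_quotient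

/-- The projector of a smooth representation onto the invariants of a compact subgroup. -/
theorem IsSmooth.exists_average [IsTopologicalGroup G] {π : Representation ℂ G V}
    (h : IsSmooth π) {K : Subgroup G} (hK : IsCompact (K : Set G)) :
    ∃ e : V →ₗ[ℂ] V, (∀ x, e x ∈ fixedBy π K) ∧ (∀ x ∈ fixedBy π K, e x = x) ∧
      (∀ k ∈ K, ∀ x, e (π k x) = e x) ∧ ∀ s : Finset V, ∃ t : Finset K, t.Nonempty ∧
        ∀ x ∈ s, e x = (t.card : ℂ)⁻¹ • ∑ k ∈ t, π k x := by
  obtain ⟨e, h1, h2, h4, h3⟩ := LocalTheta.exists_average (π.comp K.subtype) fun x =>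
    ⟨(vectorStabilizer π x).subgroupOf K, finiteIndex_subgroupOf (h x) hK, fun k hk => hk⟩
  exact ⟨e, fun x k hk => h1 ⟨k, hk⟩ x, fun x hx => h2 x fun k => hx k k.2,
    fun k hk x => h4 ⟨k, hk⟩ x, h3⟩

variable [LocallyProfinite G]

theorem IsSmooth.exists_fixing {π : Representation ℂ G V} (h : IsSmooth π) (s : Finset V)
    {U : Set G} (hU : U ∈ nhds (1 : G)) :
    ∃ K : Subgroup G, IsOpen (K : Set G) ∧ IsCompact (K : Set G) ∧ (K : Set G) ⊆ U ∧
      ∀ x ∈ s, ∀ k ∈ K, π k x = x := by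
  have h1 : (⋂ x ∈ s, {g : G | π g x = x}) ∈ nhds (1 : G) :=
    (Filter.biInter_finset_mem s).2 fun x _ => (h x).mem_nhds (by simp)
  obtain ⟨K, ho, hc, hK⟩ :=
    LocallyProfinite.exists_compact_open_subgroup _ (Filter.inter_mem hU h1)
  exact ⟨K, ho, hc, fun k hk => (hK hk).1, fun x hx k hk => by
    have := (hK hk).2
    simp only [Set.mem_iInter] at this
    exact this x hx⟩

/-- Schur's lemma for irreducible admissible representations. -/
theorem hasScalarEnd_of_isAdmissible {π : Representation ℂ G V} (h : π.IsIrreducible)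
    (ha : IsAdmissible π) : HasScalarEnd π := by
  intro T hT
  have := nontrivial_of_isIrreducible h
  obtain ⟨x, hx⟩ := exists_ne (0 : V)
  obtain ⟨K, ho, hc, -, hK⟩ := ha.1.exists_fixing {x} Filter.univ_mem
  have := ha.finite_fixedBy ho hc
  have hT' : ∀ y ∈ fixedBy π K, T y ∈ fixedBy π K := fun y hy k hk => by rw [← hT, hy k hk]
  have hx' : x ∈ fixedBy π K := fun k hk => hK x (by simp) k hk
  have : Nontrivial (fixedBy π K) := ⟨⟨x, hx'⟩, 0, fun e => hx (congrArg Subtype.val e)⟩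
  obtain ⟨c, hc⟩ := Module.End.exists_eigenvalue (T.restrict hT')
  obtain ⟨y, hy⟩ := hc.exists_hasEigenvector
  have hy1 : T y = c • (y : V) := congrArg Subtype.val hy.apply_eq_smul
  have hy2 : (y : V) ≠ 0 := fun e => hy.2 (Subtype.ext e)
  refine ⟨c, fun z => ?_⟩
  have hz : z ∈ Submodule.span ℂ (Set.range fun g => π g y) := by
    rw [span_orbit_eq_top h hy2]; trivial
  induction hz using Submodule.span_induction with
  | mem z hz => obtain ⟨g, rfl⟩ := hz; simp only [hT, hy1, map_smul]
  | zero => simp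
  | add a b _ _ ha hb => rw [map_add, ha, hb, smul_add]
  | smul d a _ ha => rw [map_smul, ha, smul_comm]

/-- A non-zero smooth representation has a non-zero smooth functional. -/
theorem IsSmooth.exists_functional {π : Representation ℂ G V} (h : IsSmooth π) [Nontrivial V] :
    ∃ K : Subgroup G, IsOpen (K : Set G) ∧ IsCompact (K : Set G) ∧ ∃ l : V →ₗ[ℂ] ℂ, l ≠ 0 ∧
      ∀ k ∈ K, ∀ x, l (π k x) = l x := by
  obtain ⟨x, hx⟩ := exists_ne (0 : V)
  obtain ⟨K, ho, hc, -, hK⟩ := h.exists_fixing {x} Filter.univ_mem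
  obtain ⟨e, h1, h2, h3, -⟩ := h.exists_average hc
  have hx' : e x = x := h2 x fun k hk => hK x (by simp) k hk
  obtain ⟨m, hm⟩ := Module.Projective.exists_dual_ne_zero ℂ hx
  refine ⟨K, ho, hc, m ∘ₗ e, fun h0 => hm ?_, fun k hk y => ?_⟩
  · simpa [hx'] using LinearMap.congr_fun h0 x
  · simp only [LinearMap.comp_apply, h3 k hk]

end Smooth

/-! ### Functionals and intertwining maps into admissible representations -/

section Functional

/-- If a functional is invariant under a normal subgroup of finite index and vanishes on the
invariants, then its composition with the coset average vanishes. -/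
theorem functional_cosetAverage_eq_zero {K : Type*} [Group K] {V : Type*} [AddCommGroup V]
    [Module ℂ V] {σ : Representation ℂ K V}
    (hσ : ∀ x, ∃ L : Subgroup K, L.FiniteIndex ∧ ∀ k ∈ L, σ k x = x)
    {L : Subgroup K} [L.FiniteIndex] [L.Normal] {m : V →ₗ[ℂ] ℂ}
    (hm : ∀ k ∈ L, ∀ x, m (σ k x) = m x) (h0 : ∀ x, (∀ k, σ k x = x) → m x = 0) (x : V) :
    m (cosetAverage σ L x) = 0 := by
  have hinv : ∀ (k : K) (x : V), m (cosetAverage σ L (σ k x)) = m (cosetAverage σ L x) := by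
    intro k x
    simp only [cosetAverage, LinearMap.smul_apply, LinearMap.sum_apply, map_smul, map_sum]
    congr 1
    let _ := Fintype.ofFinite (K ⧸ L)
    refine Fintype.sum_equiv (Equiv.mulRight (k : K ⧸ L)) _ _ fun q => ?_
    obtain ⟨l, hl⟩ := QuotientGroup.mk_out_eq_mul L (q.out * k)
    have e : (Equiv.mulRight (k : K ⧸ L)) q = ((q.out * k : K) : K ⧸ L) := by
      rw [Equiv.coe_mulRight, QuotientGroup.mk_mul, QuotientGroup.out_eq']
    have e2 : q.out * k * l = (q.out * k * l * (q.out * k)⁻¹) * (q.out * k) := by group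
    rw [e, hl, e2, map_mul, Module.End.mul_apply,
      hm _ (Subgroup.Normal.conj_mem ‹L.Normal› l l.2 (q.out * k)), map_mul, Module.End.mul_apply]
  obtain ⟨e, h1, h2, -, h3⟩ := exists_average σ hσ
  obtain ⟨t, ht, h4⟩ := h3 {x}
  have hc : (t.card : ℂ) ≠ 0 := by simpa using ht.ne_empty
  have h5 : m (cosetAverage σ L (e x)) = m (cosetAverage σ L x) := by
    rw [h4 x (by simp)]
    simp only [map_smul, map_sum, hinv, Finset.sum_const]
    rw [← Nat.cast_smul_eq_nsmul ℂ, smul_smul, inv_mul_cancel₀ hc, one_smul]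
  rw [← h5, cosetAverage_of_fixed fun k => h1 k x, h0 _ fun k => h1 k x]

variable {N : Type*} [Group N] [TopologicalSpace N] [LocallyProfinite N]
  {X : Type*} [AddCommGroup X] [Module ℂ X] {Y : Type*} [AddCommGroup Y] [Module ℂ Y]

/-- If `l` is a smooth functional, then so is `l ∘ α` for `α` in the group algebra. -/
theorem exists_open_invariant_functional {τ : Representation ℂ N X} {K : Subgroup N}
    (ho : IsOpen (K : Set N)) {l : X →ₗ[ℂ] ℂ} (hl : ∀ k ∈ K, ∀ x, l (τ k x) = l x)
    (α : MonoidAlgebra ℂ N) :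
    ∃ U : Subgroup N, IsOpen (U : Set N) ∧
      ∀ k ∈ U, ∀ x, l (τ.asAlgebraHom α (τ k x)) = l (τ.asAlgebraHom α x) := by
  induction α using MonoidAlgebra.induction_linear with
  | zero => exact ⟨K, ho, by simp⟩
  | add a b ha hb =>
    obtain ⟨U₁, h1, h2⟩ := ha
    obtain ⟨U₂, h3, h4⟩ := hb
    refine ⟨U₁ ⊓ U₂, by rw [Subgroup.coe_inf]; exact h1.inter h3, fun k hk x => ?_⟩
    simp only [map_add, LinearMap.add_apply, h2 k hk.1, h4 k hk.2]
  | single n c =>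
    refine ⟨K.comap (MulAut.conj n).toMonoidHom, ?_, fun k hk x => ?_⟩
    · have : Continuous fun y : N => n * y * n⁻¹ := by fun_prop
      exact ho.preimage this
    · have hk' : n * k * n⁻¹ ∈ K := by simpa using hk
      have e : τ n (τ k x) = τ (n * k * n⁻¹) (τ n x) := by
        simp only [← Module.End.mul_apply, ← map_mul]
        congr 2; group
      simp only [Representation.asAlgebraHom_single, LinearMap.smul_apply, map_smul, e,
        hl _ hk']

/-- Let `l` be a non-zero smooth functional on an irreducible admissible representation `τ`.
Then every functional on a smooth representation `σ` that is killed by all elements of the group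
algebra killing `l` is the composition of `l` with an intertwining map `σ → τ`.  This is the
reflexivity of `τ` with respect to the smooth dual. -/
theorem exists_intertwiner_of_functional {τ : Representation ℂ N X} (hτ : τ.IsIrreducible)
    (ha : IsAdmissible τ) {K : Subgroup N} (ho : IsOpen (K : Set N))
    {l : X →ₗ[ℂ] ℂ} (hl : ∀ k ∈ K, ∀ x, l (τ k x) = l x) (hl0 : l ≠ 0)
    {σ : Representation ℂ N Y} (hσ : IsSmooth σ) {m : Y →ₗ[ℂ] ℂ}
    (hm : ∀ α : MonoidAlgebra ℂ N, (∀ x, l (τ.asAlgebraHom α x) = 0) →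
      ∀ y, m (σ.asAlgebraHom α y) = 0) :
    ∃ T : Y →ₗ[ℂ] X, (∀ n y, T (σ n y) = τ n (T y)) ∧ ∀ y, l (T y) = m y := by
  classical
  have hex : ∀ y, ∃ x, ∀ α, l (τ.asAlgebraHom α x) = m (σ.asAlgebraHom α y) := by
    intro y
    obtain ⟨K₀, ho₀, hc₀, -, hK₀⟩ := hσ.exists_fixing {y} Filter.univ_mem
    have hfin := ha.finite_fixedBy ho₀ hc₀
    let Φ : MonoidAlgebra ℂ N →ₗ[ℂ] Module.Dual ℂ (fixedBy τ K₀) :=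
      { toFun := fun α => l ∘ₗ τ.asAlgebraHom α ∘ₗ (fixedBy τ K₀).subtype
        map_add' := fun a b => by ext; simp
        map_smul' := fun a b => by ext; simp }
    let Ψ : Module.Dual ℂ (MonoidAlgebra ℂ N) :=
      { toFun := fun α => m (σ.asAlgebraHom α y)
        map_add' := fun a b => by simp
        map_smul' := fun a b => by simp }
    -- `Ψ α` depends only on `Φ α`; as the dual of `τ^{K₀}` is reflexive, `Ψ` is then evaluation at
    -- a vector of `τ^{K₀}`.
    have hker : Ψ ∈ (LinearMap.ker Φ).dualAnnihilator := by
      rw [Submodule.mem_dualAnnihilator]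
      intro α hα
      have hα' : ∀ x ∈ fixedBy τ K₀, l (τ.asAlgebraHom α x) = 0 := fun x hx =>
        LinearMap.congr_fun (LinearMap.mem_ker.1 hα) ⟨x, hx⟩
      obtain ⟨U, hU, hU'⟩ := exists_open_invariant_functional ho hl α
      let L : Subgroup K₀ := (U.subgroupOf K₀).normalCore
      have := finiteIndex_subgroupOf hU hc₀
      let _ := Fintype.ofFinite (K₀ ⧸ L)
      -- Right multiplication of `α` by an average over `K₀` changes neither side of the equation.
      let κ : MonoidAlgebra ℂ N :=
        (Fintype.card (K₀ ⧸ L) : ℂ)⁻¹ • ∑ q : K₀ ⧸ L, MonoidAlgebra.single (q.out : N) 1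
      have h1 : ∀ x, τ.asAlgebraHom κ x = cosetAverage (τ.comp K₀.subtype) L x := fun x => by
        simp only [κ, map_smul, map_sum, cosetAverage, Representation.asAlgebraHom_single_one]
        rfl
      have h2 : σ.asAlgebraHom κ y = y := by
        have : σ.asAlgebraHom κ y = cosetAverage (σ.comp K₀.subtype) L y := by
          simp only [κ, map_smul, map_sum, cosetAverage, Representation.asAlgebraHom_single_one]
          rfl
        rw [this]
        exact cosetAverage_of_fixed fun k => hK₀ y (by simp) k k.2
      have h3 : ∀ x, l (τ.asAlgebraHom (α * κ) x) = 0 := fun x => by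
        rw [map_mul, Module.End.mul_apply, h1]
        refine functional_cosetAverage_eq_zero (σ := τ.comp K₀.subtype)
          (m := l ∘ₗ τ.asAlgebraHom α)
          (fun x => ⟨(vectorStabilizer τ x).subgroupOf K₀, finiteIndex_subgroupOf (ha.1 x) hc₀,
            fun k hk => hk⟩) (fun k hk x => ?_) (fun x hx => hα' x fun k hk => hx ⟨k, hk⟩) x
        exact hU' k (Subgroup.normalCore_le (U.subgroupOf K₀) hk) x
      have h4 := hm _ h3 y
      rwa [map_mul, Module.End.mul_apply, h2] at h4
    rw [← LinearMap.range_dualMap_eq_dualAnnihilator_ker] at hker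
    obtain ⟨ξ, hξ⟩ := hker
    refine ⟨((Module.evalEquiv ℂ (fixedBy τ K₀)).symm ξ : fixedBy τ K₀), fun α => ?_⟩
    have h5 : Φ α ((Module.evalEquiv ℂ (fixedBy τ K₀)).symm ξ) = ξ (Φ α) :=
      Module.apply_evalEquiv_symm_apply ℂ _ _ _
    exact h5.trans (LinearMap.congr_fun hξ α)
  have huniq : ∀ x x', (∀ α, l (τ.asAlgebraHom α x) = l (τ.asAlgebraHom α x')) → x = x' := by
    intro x x' h
    by_contra hne
    obtain ⟨g, hg⟩ := exists_functional_orbit_ne_zero hτ hl0 (sub_ne_zero.2 hne)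
    apply hg
    have := h (MonoidAlgebra.single g 1)
    rw [Representation.asAlgebraHom_single_one] at this
    rw [map_sub, map_sub, this, sub_self]
  choose T hT using hex
  have hadd : ∀ y y', T (y + y') = T y + T y' := fun y y' => huniq _ _ fun α => by
    simp only [map_add, hT]
  have hsmul : ∀ (c : ℂ) y, T (c • y) = c • T y := fun c y => huniq _ _ fun α => by
    simp only [map_smul, hT]
  refine ⟨⟨⟨T, hadd⟩, hsmul⟩, fun n y => huniq _ _ fun α => ?_,
    fun y => ?_⟩
  · have := hT y (α * MonoidAlgebra.single n 1)
    simp only [map_mul, Module.End.mul_apply, Representation.asAlgebraHom_single_one] at this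
    simp only [LinearMap.coe_mk, AddHom.coe_mk, hT, this]
  · have := hT y 1
    simpa using this

end Functional


/-! ### External tensor products -/

section Tensor

theorem locallyProfinite_of_isClosed {G : Type*} [Group G] [TopologicalSpace G]
    [LocallyProfinite G] {H : Subgroup G} (hH : IsClosed (H : Set G)) : LocallyProfinite H where
  exists_compact_open_subgroup U hU := by
    obtain ⟨U', hU', hsub⟩ := (mem_nhds_subtype _ _ _).1 hU
    obtain ⟨K, ho, hc, hK⟩ := LocallyProfinite.exists_compact_open_subgroup U' hU'
    exact ⟨K.subgroupOf H, ho.preimage continuous_subtype_val,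
      (hH.isClosedEmbedding_subtypeVal).isCompact_preimage hc, fun k hk => hsub (hK hk)⟩

variable {G₁ : Type*} {G₂ : Type*} [Group G₁] [Group G₂]
  {V₁ : Type*} {V₂ : Type*} [AddCommGroup V₁] [Module ℂ V₁] [AddCommGroup V₂] [Module ℂ V₂]
  {π₁ : Representation ℂ G₁ V₁} {π₂ : Representation ℂ G₂ V₂}

theorem extTensor_apply (g : G₁ × G₂) :
    extTensor π₁ π₂ g = TensorProduct.map (π₁ g.1) (π₂ g.2) := rfl

theorem extTensor_tmul (g : G₁ × G₂) (x : V₁) (y : V₂) :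
    extTensor π₁ π₂ g (x ⊗ₜ y) = π₁ g.1 x ⊗ₜ π₂ g.2 y := rfl

theorem tmul_ne_zero {x : V₁} {y : V₂} (hx : x ≠ 0) (hy : y ≠ 0) : x ⊗ₜ[ℂ] y ≠ 0 := by
  obtain ⟨l, hl⟩ := Module.Projective.exists_dual_ne_zero ℂ hx
  obtain ⟨m, hm⟩ := Module.Projective.exists_dual_ne_zero ℂ hy
  intro h
  have := congrArg (TensorProduct.lid ℂ ℂ ∘ TensorProduct.map l m) h
  simp [hl, hm] at this

/-- Functionals on the second factor separate the vectors of a tensor product. -/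
theorem exists_lTensor_ne_zero {z : V₁ ⊗[ℂ] V₂} (hz : z ≠ 0) :
    ∃ l : V₂ →ₗ[ℂ] ℂ, TensorProduct.rid ℂ V₁ (l.lTensor V₁ z) ≠ 0 := by
  classical
  let b := Module.Basis.ofVectorSpace ℂ V₂
  have h1 : TensorProduct.equivFinsuppOfBasisRight (M := V₁) b z ≠ 0 := by simpa using hz
  obtain ⟨i, hi⟩ := Finsupp.ne_iff.1 h1
  refine ⟨b.coord i, ?_⟩
  rwa [TensorProduct.equivFinsuppOfBasisRight_apply] at hi

/-- A non-zero subspace of `V₁ ⊗ V₂` that is stable under `G₁` contains `V₁ ⊗ y` for some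
`y ≠ 0`. -/
theorem exists_tmul_mem (h₁ : π₁.IsIrreducible) (hs : HasScalarEnd π₁)
    {S : Submodule ℂ (V₁ ⊗[ℂ] V₂)} (hS : ∀ g, ∀ z ∈ S, (π₁ g).rTensor V₂ z ∈ S) (h0 : S ≠ ⊥) :
    ∃ y : V₂, y ≠ 0 ∧ ∀ x : V₁, x ⊗ₜ[ℂ] y ∈ S := by
  classical
  obtain ⟨z, hzS, hz⟩ := S.ne_bot_iff.1 h0
  let b := Module.Basis.ofVectorSpace ℂ V₁
  let c := TensorProduct.equivFinsuppOfBasisLeft (N := V₂) b z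
  have hc : z = c.sum fun i y => b i ⊗ₜ[ℂ] y := by
    have := (TensorProduct.equivFinsuppOfBasisLeft (N := V₂) b).symm_apply_apply z
    rw [TensorProduct.equivFinsuppOfBasisLeft_symm_apply] at this
    exact this.symm
  have hc0 : c ≠ 0 := by simpa [c] using hz
  obtain ⟨i, hi⟩ := Finsupp.ne_iff.1 hc0
  have hα : ∀ (α : MonoidAlgebra ℂ G₁), ∀ z ∈ S, (π₁.asAlgebraHom α).rTensor V₂ z ∈ S := by
    intro α
    induction α using MonoidAlgebra.induction_linear with
    | zero => intro z _; simp
    | add a b ha hb =>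
      intro z hz
      rw [map_add, LinearMap.rTensor_add, LinearMap.add_apply]
      exact add_mem (ha z hz) (hb z hz)
    | single g r =>
      intro z hz
      rw [Representation.asAlgebraHom_single, LinearMap.rTensor_smul, LinearMap.smul_apply]
      exact S.smul_mem r (hS g z hz)
  refine ⟨c i, hi, fun x => ?_⟩
  obtain ⟨α, hα'⟩ := exists_asAlgebraHom_eq h₁ hs (ι := c.support) (u := fun j => b j)
    (b.linearIndependent.comp _ Subtype.val_injective) (fun j => if (j : _) = i then x else 0)
  have := hα α z hzS
  have e : (π₁.asAlgebraHom α).rTensor V₂ z = x ⊗ₜ c i := by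
    rw [hc, Finsupp.sum, map_sum]
    rw [Finset.sum_eq_single_of_mem i (by simpa using hi)]
    · rw [LinearMap.rTensor_tmul, hα' ⟨i, by simpa using hi⟩, if_pos rfl]
    · intro j hj hji
      rw [LinearMap.rTensor_tmul, hα' ⟨j, hj⟩, if_neg hji, TensorProduct.zero_tmul]
  rwa [e] at this

theorem rTensor_mem {S : Submodule ℂ (V₁ ⊗[ℂ] V₂)}
    (hS : ∀ g, ∀ z ∈ S, extTensor π₁ π₂ g z ∈ S) (g : G₁) (z : V₁ ⊗[ℂ] V₂) (hz : z ∈ S) :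
    (π₁ g).rTensor V₂ z ∈ S := by
  have := hS (g, 1) z hz
  rwa [extTensor_apply, map_one] at this

theorem isIrreducible_extTensor (h₁ : π₁.IsIrreducible) (hs : HasScalarEnd π₁)
    (h₂ : π₂.IsIrreducible) : (extTensor π₁ π₂).IsIrreducible := by
  have := nontrivial_of_isIrreducible h₁
  have := nontrivial_of_isIrreducible h₂
  obtain ⟨x, hx⟩ := exists_ne (0 : V₁)
  obtain ⟨y, hy⟩ := exists_ne (0 : V₂)
  refine isIrreducible_iff.2 ⟨⟨x ⊗ₜ y, 0, tmul_ne_zero hx hy⟩, fun S hS => ?_⟩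
  rw [or_iff_not_imp_left]
  intro h0
  obtain ⟨y, hy, hyS⟩ := exists_tmul_mem h₁ hs (rTensor_mem hS) h0
  rw [eq_top_iff, ← TensorProduct.span_tmul_eq_top, Submodule.span_le]
  rintro _ ⟨x, y', rfl⟩
  have hy' : y' ∈ Submodule.span ℂ (Set.range fun g => π₂ g y) := by
    rw [span_orbit_eq_top h₂ hy]; trivial
  change x ⊗ₜ y' ∈ S
  induction hy' using Submodule.span_induction with
  | mem y' h =>
    obtain ⟨g, rfl⟩ := h
    have := hS (1, g) _ (hyS x)
    rwa [extTensor_tmul, map_one] at this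
  | zero => simp
  | add a b _ _ ha hb => rw [TensorProduct.tmul_add]; exact add_mem ha hb
  | smul c a _ ha => rw [TensorProduct.tmul_smul]; exact S.smul_mem c ha

theorem isIrreducible_snd_of_extTensor (h : (extTensor π₁ π₂).IsIrreducible) :
    π₂.IsIrreducible := by
  have hV := nontrivial_of_isIrreducible h
  have hV₁ : Nontrivial V₁ := by
    by_contra hV₁
    rw [not_nontrivial_iff_subsingleton] at hV₁
    exact not_subsingleton (V₁ ⊗[ℂ] V₂) inferInstance
  have hV₂ : Nontrivial V₂ := by
    by_contra hV₂
    rw [not_nontrivial_iff_subsingleton] at hV₂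
    exact not_subsingleton (V₁ ⊗[ℂ] V₂) inferInstance
  obtain ⟨x, hx⟩ := exists_ne (0 : V₁)
  obtain ⟨l, hl⟩ := Module.Projective.exists_dual_ne_zero ℂ hx
  refine isIrreducible_iff.2 ⟨hV₂, fun S hS => ?_⟩
  rcases (isIrreducible_iff.1 h).2 (LinearMap.range (S.subtype.lTensor V₁)) (by
    rintro g _ ⟨z, rfl⟩
    induction z using TensorProduct.induction_on with
    | zero => simp
    | add a b ha hb => rw [map_add, map_add]; exact add_mem ha hb
    | tmul a b =>
      exact ⟨π₁ g.1 a ⊗ₜ ⟨π₂ g.2 b, hS g.2 b b.2⟩, rfl⟩) with h1 | h1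
  · left
    rw [eq_bot_iff]
    intro y hy
    by_contra hy0
    refine tmul_ne_zero hx hy0 ?_
    have : x ⊗ₜ[ℂ] y ∈ LinearMap.range (S.subtype.lTensor V₁) := ⟨x ⊗ₜ ⟨y, hy⟩, rfl⟩
    rwa [h1, Submodule.mem_bot] at this
  · right
    rw [eq_top_iff]
    intro y _
    have : x ⊗ₜ[ℂ] y ∈ LinearMap.range (S.subtype.lTensor V₁) := by rw [h1]; trivial
    obtain ⟨z, hz⟩ := this
    have h2 := congrArg (fun t => TensorProduct.lid ℂ _ (TensorProduct.map l S.mkQ t)) hz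
    have h3 : ∀ z, TensorProduct.map l S.mkQ (S.subtype.lTensor V₁ z) = 0 := by
      intro z
      induction z using TensorProduct.induction_on with
      | zero => simp
      | add a b ha hb => rw [map_add, map_add, ha, hb, add_zero]
      | tmul a b =>
        rw [LinearMap.lTensor_tmul, TensorProduct.map_tmul, Submodule.mkQ_apply,
          (Submodule.Quotient.mk_eq_zero S).2 (by exact b.2), TensorProduct.tmul_zero]
    simp only [h3, map_zero, TensorProduct.map_tmul, TensorProduct.lid_tmul] at h2
    have h4 := (smul_eq_zero.1 h2.symm).resolve_left hl
    rwa [Submodule.mkQ_apply, Submodule.Quotient.mk_eq_zero] at h4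

variable {V₁' : Type*} {V₂' : Type*} [AddCommGroup V₁'] [Module ℂ V₁'] [AddCommGroup V₂']
  [Module ℂ V₂'] {π₁' : Representation ℂ G₁ V₁'} {π₂' : Representation ℂ G₂ V₂'}

/-- The first factor of an irreducible external tensor product is determined by its restriction
to `G₁`. -/
theorem nonempty_equiv_of_rTensor (h₁ : π₁.IsIrreducible) (h₁' : π₁'.IsIrreducible)
    [Nontrivial V₂] {T : V₁ ⊗[ℂ] V₂ →ₗ[ℂ] V₁' ⊗[ℂ] V₂'} (hT : Function.Injective T)
    (hg : ∀ g z, T ((π₁ g).rTensor V₂ z) = (π₁' g).rTensor V₂' (T z)) :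
    Nonempty (Representation.Equiv π₁ π₁') := by
  have := nontrivial_of_isIrreducible h₁
  obtain ⟨x, hx⟩ := exists_ne (0 : V₁)
  obtain ⟨y, hy⟩ := exists_ne (0 : V₂)
  have h0 : T (x ⊗ₜ y) ≠ 0 := fun h => tmul_ne_zero hx hy (hT (by rw [h, map_zero]))
  obtain ⟨l, hl⟩ := exists_lTensor_ne_zero h0
  let F : V₁ →ₗ[ℂ] V₁' := (TensorProduct.rid ℂ V₁').toLinearMap ∘ₗ l.lTensor V₁' ∘ₗ T ∘ₗ
    (TensorProduct.mk ℂ V₁ V₂).flip y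
  have hcomm : ∀ (g : G₁) (z : V₁' ⊗[ℂ] V₂'),
      TensorProduct.rid ℂ V₁' (l.lTensor V₁' ((π₁' g).rTensor V₂' z))
        = π₁' g (TensorProduct.rid ℂ V₁' (l.lTensor V₁' z)) := by
    intro g z
    induction z using TensorProduct.induction_on with
    | zero => simp
    | add a b ha hb => simp only [map_add, ha, hb]
    | tmul a b => simp
  have hF : ∀ g x, F (π₁ g x) = π₁' g (F x) := by
    intro g x
    have := hcomm g (T (x ⊗ₜ y))
    rw [← hg] at this
    exact this
  have hF0 : F ≠ 0 := fun h => hl (LinearMap.congr_fun h x)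
  exact nonempty_equiv_of_bijective hF
    ⟨injective_of_ne_zero h₁ hF hF0, surjective_of_ne_zero h₁' hF hF0⟩

theorem nonempty_equiv_fst (h₁ : π₁.IsIrreducible) (h₁' : π₁'.IsIrreducible)
    [Nontrivial V₂] (e : Nonempty (Representation.Equiv (extTensor π₁ π₂) (extTensor π₁' π₂'))) :
    Nonempty (Representation.Equiv π₁ π₁') := by
  obtain ⟨e⟩ := e
  refine nonempty_equiv_of_rTensor h₁ h₁' (T := e.toLinearEquiv.toLinearMap)
    e.toLinearEquiv.injective fun g z => ?_
  have := Representation.IntertwiningMap.isIntertwining _ _ e.toIntertwiningMap (g, 1) z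
  rw [extTensor_apply, extTensor_apply, map_one, map_one] at this
  exact this

theorem nonempty_equiv_snd (h₂ : π₂.IsIrreducible) (h₂' : π₂'.IsIrreducible)
    [Nontrivial V₁] (e : Nonempty (Representation.Equiv (extTensor π₁ π₂) (extTensor π₁' π₂'))) :
    Nonempty (Representation.Equiv π₂ π₂') := by
  obtain ⟨e⟩ := e
  refine nonempty_equiv_of_rTensor h₂ h₂' (T := (TensorProduct.comm ℂ V₁' V₂').toLinearMap ∘ₗ
    e.toLinearEquiv.toLinearMap ∘ₗ (TensorProduct.comm ℂ V₂ V₁).toLinearMap)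
    (by simpa using e.toLinearEquiv.injective) fun g z => ?_
  have := Representation.IntertwiningMap.isIntertwining _ _ e.toIntertwiningMap (1, g)
    (TensorProduct.comm ℂ V₂ V₁ z)
  rw [extTensor_apply, extTensor_apply, map_one, map_one] at this
  simp only [LinearMap.comp_apply, LinearEquiv.coe_coe]
  have c1 : ∀ z, TensorProduct.comm ℂ V₂ V₁ ((π₂ g).rTensor V₁ z)
      = (π₂ g).lTensor V₁ (TensorProduct.comm ℂ V₂ V₁ z) := fun z => by
    induction z using TensorProduct.induction_on with
    | zero => simp
    | add a b ha hb => simp only [map_add, ha, hb]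
    | tmul a b => rfl
  have c2 : ∀ z, TensorProduct.comm ℂ V₁' V₂' ((π₂' g).lTensor V₁' z)
      = (π₂' g).rTensor V₁' (TensorProduct.comm ℂ V₁' V₂' z) := fun z => by
    induction z using TensorProduct.induction_on with
    | zero => simp
    | add a b ha hb => simp only [map_add, ha, hb]
    | tmul a b => rfl
  rw [c1, ← c2]
  congr 1

theorem nonempty_equiv_extTensor (e₁ : Nonempty (Representation.Equiv π₁ π₁'))
    (e₂ : Nonempty (Representation.Equiv π₂ π₂')) :
    Nonempty (Representation.Equiv (extTensor π₁ π₂) (extTensor π₁' π₂')) := by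
  obtain ⟨e₁⟩ := e₁
  obtain ⟨e₂⟩ := e₂
  refine ⟨.mk (TensorProduct.congr e₁.toLinearEquiv e₂.toLinearEquiv) fun g => ?_⟩
  refine TensorProduct.ext' fun x y => ?_
  have h1 := Representation.IntertwiningMap.isIntertwining _ _ e₁.toIntertwiningMap g.1 x
  have h2 := Representation.IntertwiningMap.isIntertwining _ _ e₂.toIntertwiningMap g.2 y
  exact congrArg₂ (· ⊗ₜ[ℂ] ·) h1 h2

end Tensor

section TensorSmooth

variable {G₁ : Type*} {G₂ : Type*} [Group G₁] [Group G₂] [TopologicalSpace G₁]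
  [TopologicalSpace G₂]

theorem isOpen_prod {K₁ : Subgroup G₁} {K₂ : Subgroup G₂} (h₁ : IsOpen (K₁ : Set G₁))
    (h₂ : IsOpen (K₂ : Set G₂)) : IsOpen ((K₁.prod K₂ : Subgroup (G₁ × G₂)) : Set (G₁ × G₂)) := by
  rw [Subgroup.coe_prod]; exact h₁.prod h₂

theorem isCompact_prod {K₁ : Subgroup G₁} {K₂ : Subgroup G₂} (h₁ : IsCompact (K₁ : Set G₁))
    (h₂ : IsCompact (K₂ : Set G₂)) :
    IsCompact ((K₁.prod K₂ : Subgroup (G₁ × G₂)) : Set (G₁ × G₂)) := by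
  rw [Subgroup.coe_prod]; exact h₁.prod h₂

variable [LocallyProfinite G₁] [LocallyProfinite G₂]
  {V₁ : Type*} {V₂ : Type*} [AddCommGroup V₁] [Module ℂ V₁] [AddCommGroup V₂] [Module ℂ V₂]
  {π₁ : Representation ℂ G₁ V₁} {π₂ : Representation ℂ G₂ V₂}

theorem exists_prod_subgroup {U : Set (G₁ × G₂)} (hU : U ∈ nhds (1 : G₁ × G₂)) :
    ∃ (K₁ : Subgroup G₁) (K₂ : Subgroup G₂), IsOpen (K₁ : Set G₁) ∧ IsCompact (K₁ : Set G₁) ∧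
      IsOpen (K₂ : Set G₂) ∧ IsCompact (K₂ : Set G₂) ∧
      ((K₁.prod K₂ : Subgroup (G₁ × G₂)) : Set (G₁ × G₂)) ⊆ U := by
  rw [Prod.one_eq_mk, nhds_prod_eq, Filter.mem_prod_iff] at hU
  obtain ⟨U₁, h₁, U₂, h₂, h⟩ := hU
  obtain ⟨K₁, o₁, c₁, s₁⟩ := LocallyProfinite.exists_compact_open_subgroup U₁ h₁
  obtain ⟨K₂, o₂, c₂, s₂⟩ := LocallyProfinite.exists_compact_open_subgroup U₂ h₂
  exact ⟨K₁, K₂, o₁, c₁, o₂, c₂, by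
    rw [Subgroup.coe_prod]; exact (Set.prod_mono s₁ s₂).trans h⟩

theorem isSmooth_extTensor (h₁ : IsSmooth π₁) (h₂ : IsSmooth π₂) :
    IsSmooth (extTensor π₁ π₂) := by
  refine isSmooth_of_forall_exists fun z => ?_
  induction z using TensorProduct.induction_on with
  | zero => exact ⟨⊤, isOpen_univ, by simp⟩
  | add a b ha hb =>
    obtain ⟨K, o, h⟩ := ha
    obtain ⟨K', o', h'⟩ := hb
    refine ⟨K ⊓ K', by rw [Subgroup.coe_inf]; exact o.inter o', fun k hk => ?_⟩
    rw [map_add, h k hk.1, h' k hk.2]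
  | tmul x y =>
    refine ⟨(vectorStabilizer π₁ x).prod (vectorStabilizer π₂ y), isOpen_prod (h₁ x) (h₂ y),
      fun k hk => ?_⟩
    rw [extTensor_tmul, show π₁ k.1 x = x from hk.1, show π₂ k.2 y = y from hk.2]

theorem isAdmissible_extTensor (h₁ : IsAdmissible π₁) (h₂ : IsAdmissible π₂) :
    IsAdmissible (extTensor π₁ π₂) := by
  refine ⟨isSmooth_extTensor h₁.1 h₂.1, fun K ho hc => ?_⟩
  obtain ⟨K₁, K₂, o₁, c₁, o₂, c₂, hK⟩ := exists_prod_subgroup (ho.mem_nhds K.one_mem)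
  obtain ⟨e₁, he₁, -, -, ha₁⟩ := h₁.1.exists_average c₁
  obtain ⟨e₂, he₂, -, -, ha₂⟩ := h₂.1.exists_average c₂
  have := h₁.finite_fixedBy o₁ c₁
  have := h₂.finite_fixedBy o₂ c₂
  let ι := TensorProduct.map (fixedBy π₁ K₁).subtype (fixedBy π₂ K₂).subtype
  have hfin : Module.Finite ℂ (LinearMap.range ι) := inferInstance
  have hle : Representation.invariants ((extTensor π₁ π₂).comp K.subtype) ≤ LinearMap.range ι := by
    intro z hz
    have hz' : ∀ k ∈ K, extTensor π₁ π₂ k z = z := fun k hk => hz ⟨k, hk⟩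
    obtain ⟨s, hs⟩ := TensorProduct.exists_finset z
    classical
    have f₁ : e₁.rTensor V₂ z = z := by
      obtain ⟨t, ht, hst⟩ := ha₁ (s.image Prod.fst)
      have hcard : (t.card : ℂ) ≠ 0 := by simpa using ht.ne_empty
      have : e₁.rTensor V₂ z = (t.card : ℂ)⁻¹ • ∑ k ∈ t, extTensor π₁ π₂ (((k : K₁) : G₁), 1) z := by
        rw [hs]
        simp only [map_sum, LinearMap.rTensor_tmul, extTensor_tmul, map_one,
          Module.End.one_apply]
        rw [Finset.sum_comm, Finset.smul_sum]
        refine Finset.sum_congr rfl fun i hi => ?_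
        rw [hst _ (Finset.mem_image_of_mem _ hi), ← TensorProduct.smul_tmul',
          TensorProduct.sum_tmul]
      rw [this, Finset.sum_congr rfl fun (k : K₁) _ => hz' _ (hK ⟨k.2, K₂.one_mem⟩),
        Finset.sum_const, ← Nat.cast_smul_eq_nsmul ℂ, smul_smul, inv_mul_cancel₀ hcard, one_smul]
    have f₂ : e₂.lTensor V₁ z = z := by
      obtain ⟨t, ht, hst⟩ := ha₂ (s.image Prod.snd)
      have hcard : (t.card : ℂ) ≠ 0 := by simpa using ht.ne_empty
      have : e₂.lTensor V₁ z = (t.card : ℂ)⁻¹ • ∑ k ∈ t, extTensor π₁ π₂ (1, ((k : K₂) : G₂)) z := by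
        rw [hs]
        simp only [map_sum, LinearMap.lTensor_tmul, extTensor_tmul, map_one,
          Module.End.one_apply]
        rw [Finset.sum_comm, Finset.smul_sum]
        refine Finset.sum_congr rfl fun i hi => ?_
        rw [hst _ (Finset.mem_image_of_mem _ hi), TensorProduct.tmul_smul,
          TensorProduct.tmul_sum]
      rw [this, Finset.sum_congr rfl fun (k : K₂) _ => hz' _ (hK ⟨K₁.one_mem, k.2⟩),
        Finset.sum_const, ← Nat.cast_smul_eq_nsmul ℂ, smul_smul, inv_mul_cancel₀ hcard, one_smul]
    refine ⟨TensorProduct.map (e₁.codRestrict _ he₁) (e₂.codRestrict _ he₂) z, ?_⟩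
    have : ∀ z, ι (TensorProduct.map (e₁.codRestrict _ he₁) (e₂.codRestrict _ he₂) z)
        = e₁.rTensor V₂ (e₂.lTensor V₁ z) := by
      intro z
      induction z using TensorProduct.induction_on with
      | zero => simp
      | add a b ha hb => simp only [map_add, ha, hb]
      | tmul a b => rfl
    rw [this, f₂, f₁]
  exact Submodule.finiteDimensional_of_le hle

end TensorSmooth


/-! ### Irreducible representations of a product -/

section Factor

variable {G₁ : Type u₁} {G₂ : Type u₂} [Group G₁] [Group G₂]
  {W : Type w} [AddCommGroup W] [Module ℂ W] {P : Representation ℂ (G₁ × G₂) W}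

theorem fst_snd_comm (g₁ : G₁) (g₂ : G₂) (x : W) :
    P (g₁, 1) (P (1, g₂) x) = P (1, g₂) (P (g₁, 1) x) := by
  rw [← Module.End.mul_apply, ← Module.End.mul_apply, ← map_mul, ← map_mul]
  simp

theorem apply_prod (g : G₁ × G₂) (x : W) : P g x = P (g.1, 1) (P (1, g.2) x) := by
  rw [← Module.End.mul_apply, ← map_mul]
  simp

variable [TopologicalSpace G₁] [TopologicalSpace G₂] [LocallyProfinite G₁] [LocallyProfinite G₂]

/-- An irreducible admissible representation of `G₁ × G₂` has an irreducible
`G₁`-subrepresentation, namely one generated by its vectors fixed by `K₁ × K₂`, with the space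
of such vectors of minimal positive dimension. -/
theorem exists_irreducible_fst (h : P.IsIrreducible) (ha : IsAdmissible P) :
    ∃ Y : Submodule ℂ W, Y ≠ ⊥ ∧ (∀ g, ∀ y ∈ Y, P (g, 1) y ∈ Y) ∧
      ∀ S ≤ Y, (∀ g, ∀ y ∈ S, P (g, 1) y ∈ S) → S = ⊥ ∨ S = Y := by
  have := nontrivial_of_isIrreducible h
  obtain ⟨x, hx⟩ := exists_ne (0 : W)
  obtain ⟨K₁, K₂, o₁, c₁, o₂, c₂, hK⟩ := exists_prod_subgroup
    ((ha.1 x).mem_nhds (by simp : (1 : G₁ × G₂) ∈ {g | P g x = x}))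
  have hfin := ha.finite_fixedBy (isOpen_prod o₁ o₂) (isCompact_prod c₁ c₂)
  set E := fixedBy P (K₁.prod K₂) with hE
  have hxE : x ∈ E := fun k hk => hK hk
  let P₁ : Representation ℂ G₁ W := P.comp (MonoidHom.inl G₁ G₂)
  have hP₁ : IsSmooth P₁ := ha.1.comp (by fun_prop : Continuous fun g : G₁ => (g, (1 : G₂)))
  obtain ⟨e, he1, he2, -, he3⟩ := hP₁.exists_average c₁
  -- The `G₁`-stable subspaces that consist of vectors fixed by `K₂`.
  let good : Submodule ℂ W → Prop := fun Y =>
    (∀ g, ∀ y ∈ Y, P (g, 1) y ∈ Y) ∧ (∀ k ∈ K₂, ∀ y ∈ Y, P (1, k) y = y)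
  -- A good subspace without vectors fixed by `K₁` vanishes.
  have hbot : ∀ S, good S → S ⊓ E = ⊥ → S = ⊥ := by
    intro S hS h0
    have heS : ∀ y ∈ S, e y = 0 := by
      intro y hy
      have h1 : e y ∈ S := by
        obtain ⟨t, ht, hst⟩ := he3 {y}
        rw [hst y (by simp)]
        exact S.smul_mem _ (sum_mem fun k _ => hS.1 _ y hy)
      have h2 : e y ∈ E := fun k hk => by
        rw [apply_prod, hS.2 _ hk.2 _ h1]
        exact he1 y k.1 hk.1
      have : e y ∈ S ⊓ E := ⟨h1, h2⟩
      rwa [h0, Submodule.mem_bot] at this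
    -- The span of the `G₂`-translates of `S` is stable under `G₁ × G₂` and killed by the projector
    -- `e`, so that it does not contain `x`.
    let S' : Submodule ℂ W := Submodule.span ℂ {z | ∃ g₂, ∃ y ∈ S, z = P (1, g₂) y}
    have hS'e : ∀ z ∈ S', e z = 0 := by
      intro z hz
      induction hz using Submodule.span_induction with
      | mem z hz =>
        classical
        obtain ⟨g₂, y, hy, rfl⟩ := hz
        obtain ⟨t, ht, hst⟩ := he3 {y, P (1, g₂) y}
        have h1 := hst y (by simp)
        rw [heS y hy] at h1
        rw [hst (P (1, g₂) y) (by simp)]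
        have h2 : ∀ k : K₁, P₁ k (P (1, g₂) y) = P (1, g₂) (P₁ k y) := fun k =>
          fst_snd_comm _ _ _
        simp only [h2]
        rw [← map_sum, ← map_smul, ← h1, map_zero]
      | zero => simp
      | add a b _ _ ha hb => rw [map_add, ha, hb, add_zero]
      | smul c a _ ha => rw [map_smul, ha, smul_zero]
    rcases (isIrreducible_iff.1 h).2 S' (by
      intro g z hz
      induction hz using Submodule.span_induction with
      | mem z hz =>
        obtain ⟨g₂, y, hy, rfl⟩ := hz
        refine Submodule.subset_span ⟨g.2 * g₂, P (g.1, 1) y, hS.1 _ y hy, ?_⟩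
        rw [← Module.End.mul_apply, ← Module.End.mul_apply, ← map_mul, ← map_mul]
        simp [Prod.mul_def]
      | zero => simp
      | add a b _ _ ha hb => rw [map_add]; exact add_mem ha hb
      | smul c a _ ha => rw [map_smul]; exact S'.smul_mem c ha) with h1 | h1
    · rw [eq_bot_iff, ← h1]
      exact fun y hy => Submodule.subset_span ⟨1, y, hy, by
        rw [show ((1 : G₁), (1 : G₂)) = 1 from rfl, map_one]; rfl⟩
    · have h2 : e x = 0 := hS'e x (by rw [h1]; trivial)
      rw [he2 x (fun k hk => hxE (k, 1) ⟨hk, K₂.one_mem⟩)] at h2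
      exact absurd h2 hx
  let X : Submodule ℂ W := fixedBy (P.comp (MonoidHom.inr G₁ G₂)) K₂
  have hX : good X := by
    refine ⟨fun g y hy k hk => ?_, fun k hk y hy => hy k hk⟩
    change P (1, k) (P (g, 1) y) = P (g, 1) y
    rw [← fst_snd_comm]
    exact congrArg _ (hy k hk)
  have hXE : X ⊓ E ≠ ⊥ := fun h0 => hx (by
    have : x ∈ X ⊓ E := ⟨fun k hk => hxE (1, k) ⟨K₁.one_mem, hk⟩, hxE⟩
    rwa [h0, Submodule.mem_bot] at this)
  -- Among the good subspaces that meet `E`, take one for which the intersection has the least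
  -- dimension, and generate a `G₁`-subspace by the intersection.
  let Q : ℕ → Prop := fun n => ∃ Y, good Y ∧ Y ⊓ E ≠ ⊥ ∧ Module.finrank ℂ ↥(Y ⊓ E) = n
  classical
  have hQ : ∃ n, Q n := ⟨_, X, hX, hXE, rfl⟩
  obtain ⟨Y, hY, hYE, hn⟩ := Nat.find_spec hQ
  let D : Submodule ℂ W := Submodule.span ℂ {z | ∃ g, ∃ y ∈ Y ⊓ E, z = P (g, 1) y}
  have hDY : D ≤ Y := by
    rw [Submodule.span_le]
    rintro _ ⟨g, y, hy, rfl⟩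
    exact hY.1 g y hy.1
  have hED : Y ⊓ E ≤ D := fun y hy => Submodule.subset_span ⟨1, y, hy, by
    rw [show ((1 : G₁), (1 : G₂)) = 1 from rfl, map_one]; rfl⟩
  refine ⟨D, fun h0 => hYE (le_bot_iff.1 (h0 ▸ hED)), ?_, fun S hSD hS => ?_⟩
  · intro g z hz
    induction hz using Submodule.span_induction with
    | mem z hz =>
      obtain ⟨g', y, hy, rfl⟩ := hz
      refine Submodule.subset_span ⟨g * g', y, hy, ?_⟩
      rw [← Module.End.mul_apply, ← map_mul]
      simp
    | zero => simp
    | add a b _ _ ha hb => rw [map_add]; exact add_mem ha hb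
    | smul c a _ ha => rw [map_smul]; exact D.smul_mem c ha
  · have hgS : good S := ⟨hS, fun k hk y hy => hY.2 k hk y (hDY (hSD hy))⟩
    rw [or_iff_not_imp_left]
    intro hS0
    have hSE : S ⊓ E ≠ ⊥ := fun h0 => hS0 (hbot S hgS h0)
    have hmin := Nat.find_min' hQ (⟨S, hgS, hSE, rfl⟩ : Q _)
    rw [← hn] at hmin
    have hfin' : Module.Finite ℂ ↥(Y ⊓ E) := Submodule.finiteDimensional_of_le inf_le_right
    have heq : S ⊓ E = Y ⊓ E := Submodule.eq_of_le_of_finrank_le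
      (inf_le_inf_right _ (hSD.trans hDY)) hmin
    refine le_antisymm hSD ?_
    rw [Submodule.span_le]
    rintro _ ⟨g, y, hy, rfl⟩
    exact hS g y (heq ▸ hy : y ∈ S ⊓ E).1

/-- An irreducible admissible representation of `G₁ × G₂` is an external tensor product of
irreducible smooth representations. -/
theorem exists_extTensor_equiv (hG₁ : AllIrrAdmissible.{u₁, w} G₁) (h : P.IsIrreducible)
    (ha : IsAdmissible P) :
    ∃ (V₁ V₂ : Type w) (_ : AddCommGroup V₁) (_ : Module ℂ V₁) (_ : AddCommGroup V₂)
      (_ : Module ℂ V₂) (π₁ : Representation ℂ G₁ V₁) (π₂ : Representation ℂ G₂ V₂),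
      IsIrr π₁ ∧ IsIrr π₂ ∧ Nonempty (Representation.Equiv (extTensor π₁ π₂) P) := by
  obtain ⟨Y, hY0, hYs, hYi⟩ := exists_irreducible_fst h ha
  let π₁ : Representation ℂ G₁ Y := Subrepresentation.toRepresentation
    (ρ := P.comp (MonoidHom.inl G₁ G₂)) ⟨Y, fun g y hy => hYs g y hy⟩
  have hπ₁ : ∀ g (y : Y), ((π₁ g y : Y) : W) = P (g, 1) y := fun g y => rfl
  have hirr : π₁.IsIrreducible := by
    refine isIrreducible_iff.2 ⟨Submodule.nontrivial_iff_ne_bot.2 hY0, fun S hS => ?_⟩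
    rcases hYi (S.map Y.subtype) (Submodule.map_subtype_le _ _) (by
      rintro g _ ⟨y, hy, rfl⟩
      exact ⟨π₁ g y, hS g y hy, rfl⟩) with h1 | h1
    · left
      rw [eq_bot_iff]
      intro y hy
      have : (y : W) ∈ S.map Y.subtype := ⟨y, hy, rfl⟩
      rw [h1, Submodule.mem_bot] at this
      exact Subtype.ext this
    · right
      rw [eq_top_iff]
      intro y _
      have : (y : W) ∈ S.map Y.subtype := by rw [h1]; exact y.2
      obtain ⟨y', hy', e⟩ := this
      rwa [← Subtype.ext e]
  have hsm : IsSmooth π₁ := fun y => by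
    have h1 : IsSmooth (P.comp (MonoidHom.inl G₁ G₂)) :=
      ha.1.comp (by fun_prop : Continuous fun g : G₁ => (g, (1 : G₂)))
    convert h1 (y : W) using 1
    ext g
    exact Subtype.ext_iff
  have hsc : HasScalarEnd π₁ := hasScalarEnd_of_isAdmissible hirr (hG₁ Y π₁ ⟨hsm, hirr⟩)
  -- The second factor is the multiplicity space `Hom_{G₁}(Y, P)`.
  let M : Submodule ℂ (Y →ₗ[ℂ] W) :=
    { carrier := {f | ∀ g y, f (π₁ g y) = P (g, 1) (f y)}
      zero_mem' := fun g y => by simp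
      add_mem' := fun hf hf' g y => by simp [hf g y, hf' g y]
      smul_mem' := fun c f hf g y => by simp [hf g y] }
  let π₂ : Representation ℂ G₂ M :=
    { toFun := fun g => LinearMap.restrict (p := M) (q := M)
        (LinearMap.compRight ℂ (M := Y) (P (1, g))) (fun f hf g' y => by
          change P (1, g) (f (π₁ g' y)) = P (g', 1) (P (1, g) (f y))
          rw [fst_snd_comm, hf g' y])
      map_one' := by
        refine LinearMap.ext fun f => Subtype.ext (LinearMap.ext fun y => ?_)
        change P (1, 1) (f.1 y) = f.1 y
        rw [show ((1 : G₁), (1 : G₂)) = 1 from rfl, map_one]; rfl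
      map_mul' := fun a b => by
        refine LinearMap.ext fun f => Subtype.ext (LinearMap.ext fun y => ?_)
        change P (1, a * b) (f.1 y) = P (1, a) (P (1, b) (f.1 y))
        rw [← Module.End.mul_apply, ← map_mul]
        simp }
  have hπ₂ : ∀ g (f : M) y, (π₂ g f).1 y = P (1, g) (f.1 y) := fun g f y => rfl
  let ev : Y ⊗[ℂ] M →ₗ[ℂ] W := TensorProduct.lift (LinearMap.flip M.subtype)
  have hev : ∀ y f, ev (y ⊗ₜ f) = f.1 y := fun y f => rfl
  have hevg : ∀ g z, ev (extTensor π₁ π₂ g z) = P g (ev z) := by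
    intro g z
    induction z using TensorProduct.induction_on with
    | zero => simp
    | add a b ha hb => simp only [map_add, ha, hb]
    | tmul y f =>
      rw [extTensor_tmul, hev, hev, hπ₂, f.2, ← fst_snd_comm, ← apply_prod]
  have hnt : Nontrivial Y := Submodule.nontrivial_iff_ne_bot.2 hY0
  have hsurj : Function.Surjective ev := by
    refine surjective_of_ne_zero h hevg fun h0 => ?_
    obtain ⟨y, hy⟩ := exists_ne (0 : Y)
    refine hy (Subtype.ext ?_)
    exact LinearMap.congr_fun h0 (y ⊗ₜ ⟨Y.subtype, fun g y => rfl⟩)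
  have hinj : Function.Injective ev := by
    rw [← LinearMap.ker_eq_bot]
    by_contra h0
    obtain ⟨f, hf, hf'⟩ := exists_tmul_mem hirr hsc (rTensor_mem (π₁ := π₁) (π₂ := π₂)
      (fun g z hz => by
        rw [LinearMap.mem_ker] at hz ⊢
        rw [hevg, hz, map_zero])) h0
    refine hf (Subtype.ext (LinearMap.ext fun y => ?_))
    exact LinearMap.mem_ker.1 (hf' y)
  have hT := nonempty_equiv_of_bijective hevg ⟨hinj, hsurj⟩
  have hirr' : (extTensor π₁ π₂).IsIrreducible := by
    obtain ⟨e⟩ := hT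
    exact isIrreducible_of_bijective (T := e.symm.toLinearEquiv.toLinearMap)
      (fun g x => Representation.IntertwiningMap.isIntertwining _ _ e.symm.toIntertwiningMap g x)
      e.symm.toLinearEquiv.bijective h
  refine ⟨Y, M, inferInstance, inferInstance, inferInstance, inferInstance, π₁, π₂, ⟨hsm, hirr⟩,
    ⟨fun f => ?_, isIrreducible_snd_of_extTensor hirr'⟩, hT⟩
  obtain ⟨y, hy⟩ := exists_ne (0 : Y)
  have h1 : IsSmooth (P.comp (MonoidHom.inr G₁ G₂)) :=
    ha.1.comp (by fun_prop : Continuous fun g : G₂ => ((1 : G₁), g))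
  convert h1 (f.1 y) using 1
  ext g
  change π₂ g f = f ↔ P (1, g) (f.1 y) = f.1 y
  rw [← hπ₂]
  refine ⟨fun h => by rw [h], fun h => Subtype.ext (LinearMap.ext fun y' => ?_)⟩
  have hy' : y' ∈ Submodule.span ℂ (Set.range fun g => π₁ g y) := by
    rw [span_orbit_eq_top hirr hy]; trivial
  induction hy' using Submodule.span_induction with
  | mem z hz =>
    obtain ⟨a, rfl⟩ := hz
    have h2 := (π₂ g f).2 a y
    have h3 := f.2 a y
    exact h2.trans ((congrArg _ h).trans h3.symm)
  | zero => simp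
  | add a b _ _ ha hb => rw [map_add, map_add, ha, hb]
  | smul c a _ ha => rw [map_smul, map_smul, ha]

end Factor


/-! ### Restriction to a cocompact normal subgroup -/

section Restrict

/-- The space `Hom_G(σ, τ)` as a subspace of the space of linear maps. -/
def equivariantHom {G : Type*} [Group G] {V X : Type*} [AddCommGroup V] [Module ℂ V]
    [AddCommGroup X] [Module ℂ X] (σ : Representation ℂ G V) (τ : Representation ℂ G X) :
    Submodule ℂ (V →ₗ[ℂ] X) where
  carrier := {f | ∀ g x, f (σ g x) = τ g (f x)}
  zero_mem' := fun g x => by simp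
  add_mem' := fun hf hf' g x => by simp [hf g x, hf' g x]
  smul_mem' := fun c f hf g x => by simp [hf g x]

theorem conjNormal_coe {G : Type*} [Group G] {H : Subgroup G} [H.Normal] (g : G) (h : H) :
    ((MulAut.conjNormal g h : H) : G) = g * h * g⁻¹ :=
  MulAut.conjNormal_apply g h

variable {G : Type*} [Group G] [TopologicalSpace G] [LocallyProfinite G] {H : Subgroup G}
  [H.Normal] {V : Type w} [AddCommGroup V] [Module ℂ V] {π : Representation ℂ G V}

/-- The restriction of an irreducible smooth representation to a normal subgroup with compact
quotient is finitely generated. -/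
theorem exists_finset_generating (hc : CompactSpace (G ⧸ H)) (h : IsIrr π) :
    ∃ s : Finset V, Submodule.span ℂ {y | ∃ h : H, ∃ x ∈ s, y = π h x} = ⊤ := by
  classical
  have := nontrivial_of_isIrreducible h.2
  obtain ⟨x, hx⟩ := exists_ne (0 : V)
  obtain ⟨K, ho, -, -, hK⟩ := h.1.exists_fixing {x} Filter.univ_mem
  let O : G → Set (G ⧸ H) := fun g => (QuotientGroup.mk : G → G ⧸ H) '' ((fun k => g * k) '' K)
  have hO : ∀ g, IsOpen (O g) := fun g =>
    QuotientGroup.isOpenMap_coe _ ((Homeomorph.mulLeft g).isOpenMap _ ho)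
  obtain ⟨t, ht⟩ := isCompact_univ.elim_finite_subcover O hO (fun q _ => by
    induction q using QuotientGroup.induction_on with
    | H g => exact Set.mem_iUnion.2 ⟨g, g, ⟨1, K.one_mem, mul_one g⟩, rfl⟩)
  refine ⟨t.image fun g => π g x, ?_⟩
  rw [eq_top_iff, ← span_orbit_eq_top h.2 hx, Submodule.span_le]
  rintro _ ⟨g, rfl⟩
  have hg := ht (Set.mem_univ (g : G ⧸ H))
  simp only [Set.mem_iUnion] at hg
  obtain ⟨a, ha, _, ⟨k, hk, rfl⟩, e⟩ := hg
  have hh : (a * k)⁻¹ * g ∈ H := QuotientGroup.eq.1 e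
  have hh' : (a * k) * ((a * k)⁻¹ * g) * (a * k)⁻¹ ∈ H :=
    Subgroup.Normal.conj_mem ‹H.Normal› _ hh _
  refine Submodule.subset_span ⟨⟨_, hh'⟩, π a x, Finset.mem_image_of_mem _ ha, ?_⟩
  have e2 : g = (a * k) * ((a * k)⁻¹ * g) * (a * k)⁻¹ * a * k := by group
  change π g x = π _ (π a x)
  conv_lhs => rw [e2, map_mul, Module.End.mul_apply, hK x (by simp) k hk, map_mul,
    Module.End.mul_apply]

/-- The restriction of an irreducible smooth representation to a normal subgroup with compact
quotient has an irreducible smooth quotient. -/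
theorem exists_irreducible_quotient (hc : CompactSpace (G ⧸ H)) (h : IsIrr π) :
    ∃ (X : Type w) (_ : AddCommGroup X) (_ : Module ℂ X) (τ : Representation ℂ H X),
      IsIrr τ ∧ ∃ q ∈ equivariantHom (π.comp H.subtype) τ, q ≠ 0 := by
  obtain ⟨s, hs⟩ := exists_finset_generating hc h
  have := nontrivial_of_isIrreducible h.2
  set σ : Representation ℂ H V := π.comp H.subtype with hσ
  have hfin : Module.Finite (MonoidAlgebra ℂ H) σ.asModule := by
    classical
    refine ⟨⟨s.image σ.asModuleEquiv.symm, ?_⟩⟩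
    set N := Submodule.span (MonoidAlgebra ℂ H)
      ((s.image σ.asModuleEquiv.symm : Finset σ.asModule) : Set σ.asModule) with hN
    have h1 : (Subrepresentation.ofSubmodule' N).toSubmodule = ⊤ := by
      rw [eq_top_iff, ← hs, Submodule.span_le]
      rintro _ ⟨k, x, hx, rfl⟩
      refine (Subrepresentation.ofSubmodule' N).apply_mem_toSubmodule k ?_
      change σ.asModuleEquiv.symm x ∈ N
      exact Submodule.subset_span (Finset.mem_coe.2 (Finset.mem_image_of_mem _ hx))
    rw [eq_top_iff]
    intro y _
    have : σ.asModuleEquiv y ∈ (Subrepresentation.ofSubmodule' N).toSubmodule := by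
      rw [h1]; trivial
    exact this
  -- A finitely generated non-zero module has a maximal proper submodule.
  have hcoat : IsCoatomic (Subrepresentation σ) :=
    (OrderIso.isCoatomic_iff Subrepresentation.subrepresentationSubmoduleOrderIso).2 inferInstance
  have hnt : Nontrivial (Subrepresentation σ) := by
    refine ⟨⊥, ⊤, fun e => ?_⟩
    exact bot_ne_top (α := Submodule ℂ V) (congrArg Subrepresentation.toSubmodule e)
  obtain ⟨M, hM⟩ := IsCoatomic.exists_coatom (α := Subrepresentation σ)
  let S := M.toSubmodule
  have hS : ∀ g, S ≤ S.comap (σ g) := fun g x hx => M.apply_mem_toSubmodule g hx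
  let τ : Representation ℂ H (V ⧸ S) := σ.quotient S hS
  have hq : ∀ g x, S.mkQ (σ g x) = τ g (S.mkQ x) := fun g x => rfl
  have hSt : S ≠ ⊤ := fun e => hM.1 (Subrepresentation.toSubmodule_injective e)
  refine ⟨V ⧸ S, inferInstance, inferInstance, τ, ⟨?_, ?_⟩, S.mkQ, hq, fun h0 => hSt ?_⟩
  · refine isSmooth_of_forall_exists fun y => ?_
    obtain ⟨x, rfl⟩ := S.mkQ_surjective y
    refine ⟨vectorStabilizer σ x, (h.1.comp continuous_subtype_val : IsSmooth σ) x, ?_⟩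
    intro k hk
    rw [← hq, show σ k x = x from hk]
  · refine isIrreducible_iff.2 ⟨Submodule.Quotient.nontrivial_iff.2 hSt, fun T hT => ?_⟩
    let M' : Subrepresentation σ := ⟨T.comap S.mkQ, fun g x hx => by
      rw [Submodule.mem_comap] at hx ⊢
      rw [hq]
      exact hT g _ hx⟩
    have hle : M ≤ M' := fun x hx => by
      change S.mkQ x ∈ T
      rw [Submodule.mkQ_apply, (Submodule.Quotient.mk_eq_zero S).2 hx]
      exact T.zero_mem
    rcases hM.le_iff.1 hle with e | e
    · right
      rw [← Submodule.map_comap_eq_of_surjective S.mkQ_surjective T,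
        show T.comap S.mkQ = ⊤ from congrArg Subrepresentation.toSubmodule e, Submodule.map_top,
        Submodule.range_mkQ]
    · left
      rw [← Submodule.map_comap_eq_of_surjective S.mkQ_surjective T,
        show T.comap S.mkQ = S from congrArg Subrepresentation.toSubmodule e, eq_bot_iff]
      rintro _ ⟨x, hx, rfl⟩
      exact (Submodule.Quotient.mk_eq_zero S).2 hx
  · rw [eq_top_iff]
    intro x _
    exact (Submodule.Quotient.mk_eq_zero S).1 (LinearMap.congr_fun h0 x)

variable {X : Type*} [AddCommGroup X] [Module ℂ X] {τ : Representation ℂ H X}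

/-- A homomorphism is determined by its values at finitely many generators, which are fixed by a
compact open subgroup. -/
theorem finite_equivariantHom (hH : IsClosed (H : Set G)) (hc : CompactSpace (G ⧸ H))
    (h : IsIrr π) (ha : IsAdmissible τ) :
    Module.Finite ℂ (equivariantHom (π.comp H.subtype) τ) := by
  obtain ⟨s, hs⟩ := exists_finset_generating hc h
  have := locallyProfinite_of_isClosed hH
  obtain ⟨K, ho, hK, -, hfix⟩ := IsSmooth.exists_fixing
    (h.1.comp continuous_subtype_val : IsSmooth (π.comp H.subtype)) s Filter.univ_mem
  have := ha.finite_fixedBy ho hK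
  let F : equivariantHom (π.comp H.subtype) τ →ₗ[ℂ] (s → fixedBy τ K) :=
    { toFun := fun a x => ⟨a.1 x, fun k hk => by rw [← a.2, hfix x x.2 k hk]⟩
      map_add' := fun a b => rfl
      map_smul' := fun c a => rfl }
  refine Module.Finite.of_injective F fun a b hab => Subtype.ext (LinearMap.ext fun y => ?_)
  have hy : y ∈ Submodule.span ℂ {y | ∃ h : H, ∃ x ∈ s, y = π h x} := by rw [hs]; trivial
  induction hy using Submodule.span_induction with
  | mem y hy =>
    obtain ⟨k, x, hx, rfl⟩ := hy
    have h1 : a.1 x = b.1 x := congrArg Subtype.val (congrFun hab ⟨x, hx⟩)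
    exact (a.2 k x).trans ((congrArg _ h1).trans (b.2 k x).symm)
  | zero => simp
  | add a b _ _ ha hb => rw [map_add, map_add, ha, hb]
  | smul c a _ ha => rw [map_smul, map_smul, ha]

/-- Let `l` be a smooth functional on an irreducible admissible representation `τ` of `H`.  For `k`
close to `1` in `G` that stabilizes the isomorphism class of `τ`, an intertwining operator between
`τ` and its twist by `k` multiplies `l` by a scalar.  Hence, if `Hom_H(π, τ)` is
finite-dimensional, the functionals `l ∘ a` with `a ∈ Hom_H(π, τ)` are invariant under all
such `k`. -/
theorem exists_subgroup_functional_invariant (hH : IsClosed (H : Set G)) (hπ : IsSmooth π)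
    (hτ : τ.IsIrreducible) (ha : IsAdmissible τ)
    (hfin : Module.Finite ℂ (equivariantHom (π.comp H.subtype) τ))
    {L : Subgroup H} (hL : IsOpen (L : Set H)) {l : X →ₗ[ℂ] ℂ}
    (hl : ∀ k ∈ L, ∀ x, l (τ k x) = l x) (hl0 : l ≠ 0) {O : Set G} (hO : O ∈ nhds (1 : G)) :
    ∃ K : Subgroup G, IsOpen (K : Set G) ∧ IsCompact (K : Set G) ∧ (K : Set G) ⊆ O ∧
      ∀ k ∈ K,
        Nonempty (Representation.Equiv τ (τ.comp (MulAut.conjNormal (H := H) k).toMonoidHom)) →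
        ∀ a ∈ equivariantHom (π.comp H.subtype) τ, ∀ y, l (a (π k y)) = l (a y) := by
  classical
  have := locallyProfinite_of_isClosed hH
  have := nontrivial_of_isIrreducible hτ
  obtain ⟨x₁, hx₁⟩ := exists_ne (0 : X)
  -- a compact open subgroup `K` of `G` such that `l` and `x₁` are fixed by `K ∩ H`
  have hnhds : (L : Set H) ∩ {h | τ h x₁ = x₁} ∈ nhds (1 : H) :=
    (hL.inter (ha.1 x₁)).mem_nhds ⟨L.one_mem, by simp⟩
  obtain ⟨O', hO', hsub⟩ := (mem_nhds_subtype _ _ _).1 hnhds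
  obtain ⟨K, hKo, hKc, hKO⟩ := LocallyProfinite.exists_compact_open_subgroup O' hO'
  let KH : Subgroup H := K.subgroupOf H
  have hKHo : IsOpen (KH : Set H) := hKo.preimage continuous_subtype_val
  have hKHc : IsCompact (KH : Set H) := hH.isClosedEmbedding_subtypeVal.isCompact_preimage hKc
  have hKH : ∀ k ∈ KH, k ∈ L ∧ τ k x₁ = x₁ := fun k hk => hsub (hKO hk)
  have hUfin := ha.finite_fixedBy hKHo hKHc
  let U := fixedBy τ KH
  have hx₁U : x₁ ∈ U := fun k hk => (hKH k hk).2
  have : Nontrivial U := ⟨⟨x₁, hx₁U⟩, 0, fun e => hx₁ (congrArg Subtype.val e)⟩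
  obtain ⟨e, he1, he2, he3, he4⟩ := ha.1.exists_average hKHc
  have hle : ∀ x, l (e x) = l x := by
    intro x
    obtain ⟨t, ht, hst⟩ := he4 {x}
    have hcard : (t.card : ℂ) ≠ 0 := by simpa using ht.ne_empty
    rw [hst x (by simp), map_smul, map_sum,
      Finset.sum_congr rfl fun (k : KH) _ => hl k (hKH k k.2).1 x, Finset.sum_const,
      ← Nat.cast_smul_eq_nsmul ℂ, smul_smul, inv_mul_cancel₀ hcard, one_smul]
  -- finitely many elements of `H` span the image of the Hecke algebra in `End U`
  let E : H → Module.End ℂ U := fun h => (e ∘ₗ τ h ∘ₗ U.subtype).codRestrict U fun x => he1 _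
  obtain ⟨F, hFsub, hF⟩ := Submodule.fg_span_iff_fg_span_finset_subset (Set.range E) |>.1
    (IsNoetherian.noetherian (Submodule.span ℂ (Set.range E)))
  obtain ⟨F', hF'⟩ : ∃ F' : Finset H, ∀ f ∈ F, ∃ h ∈ F', E h = f := by
    choose! c hc using fun f (hf : f ∈ F) => hFsub hf
    exact ⟨F.image c, fun f hf => ⟨c f, Finset.mem_image_of_mem _ hf, hc f hf⟩⟩
  -- finitely many vectors detect the functionals `l ∘ a`
  obtain ⟨FV, hFV⟩ := exists_finset_separating
    (fun (y : V) => (l ∘ₗ LinearMap.applyₗ y ∘ₗ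
      (equivariantHom (π.comp H.subtype) τ).subtype)) (fun a h0 => by
    by_contra hne
    have : ∃ y, a.1 y ≠ 0 := by
      by_contra! h1
      exact hne (Subtype.ext (LinearMap.ext h1))
    obtain ⟨y, hy⟩ := this
    obtain ⟨g, hg⟩ := exists_functional_orbit_ne_zero hτ hl0 hy
    apply hg
    rw [← a.2 g y]
    exact h0 _)
  have hnear : O ∩ K ∩ ⋂ h ∈ F', {k : G | (h : G)⁻¹ * (k * h * k⁻¹) ∈ K} ∈ nhds (1 : G) := by
    refine Filter.inter_mem (Filter.inter_mem hO (hKo.mem_nhds K.one_mem))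
      ((Filter.biInter_finset_mem F').2 fun h _ => ?_)
    have hcont : Continuous fun k : G => (h : G)⁻¹ * (k * h * k⁻¹) := by fun_prop
    exact (hKo.preimage hcont).mem_nhds (by simp [K.one_mem])
  obtain ⟨K₁, hK₁o, hK₁c, hK₁, hK₁fix⟩ := hπ.exists_fixing FV hnear
  refine ⟨K₁, hK₁o, hK₁c, fun k hk => (hK₁ hk).1.1, ?_⟩
  rintro k hk ⟨φ⟩ a haA
  have hkK : k ∈ K := (hK₁ hk).1.2
  have hkF : ∀ h ∈ F', (h : G)⁻¹ * (k * h * k⁻¹) ∈ K := fun h hh => by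
    have := (hK₁ hk).2
    simp only [Set.mem_iInter] at this
    exact this h hh
  let T : X →ₗ[ℂ] X := φ.toLinearEquiv.toLinearMap
  have hT : ∀ h x, T (τ h x) = τ (MulAut.conjNormal k h) (T x) := fun h x =>
    Representation.IntertwiningMap.isIntertwining _ _ φ.toIntertwiningMap h x
  have hTinj : Function.Injective T := φ.toLinearEquiv.injective
  have hconj : ∀ κ ∈ KH, (MulAut.conjNormal k κ : H) ∈ KH := fun κ hκ => by
    rw [Subgroup.mem_subgroupOf] at hκ ⊢
    rw [conjNormal_coe]
    exact K.mul_mem (K.mul_mem hkK hκ) (K.inv_mem hkK)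
  have hconj' : ∀ κ ∈ KH, ((MulAut.conjNormal k).symm κ : H) ∈ KH := fun κ hκ => by
    rw [Subgroup.mem_subgroupOf] at hκ ⊢
    rw [MulAut.conjNormal_symm_apply]
    exact K.mul_mem (K.mul_mem (K.inv_mem hkK) hκ) hkK
  have hTU : ∀ x ∈ U, T x ∈ U := fun x hx κ hκ => by
    have := hT ((MulAut.conjNormal k).symm κ) x
    rw [MulEquiv.apply_symm_apply, hx _ (hconj' κ hκ)] at this
    exact this.symm
  have hTe : ∀ x, T (e x) = e (T x) := fun x => by
    obtain ⟨t, ht, hst⟩ := he4 {x}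
    have hcard : (t.card : ℂ) ≠ 0 := by simpa using ht.ne_empty
    rw [← he2 _ (hTU _ (he1 x)), hst x (by simp)]
    simp only [map_smul, map_sum, hT]
    rw [Finset.sum_congr rfl fun (κ : KH) _ => he3 _ (hconj κ κ.2) (T x), Finset.sum_const,
      ← Nat.cast_smul_eq_nsmul ℂ, smul_smul, inv_mul_cancel₀ hcard, one_smul]
  let TU : Module.End ℂ U := T.restrict hTU
  have hcommF : ∀ h ∈ F', TU * E h = E h * TU := fun h hh => by
    refine LinearMap.ext fun x => Subtype.ext ?_
    change T (e (τ h x)) = e (τ h (T x))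
    have e1 : (MulAut.conjNormal k h : H) = h * (h⁻¹ * MulAut.conjNormal k h) := by group
    rw [hTe, hT, e1, map_mul, Module.End.mul_apply, hTU x x.2]
    rw [Subgroup.mem_subgroupOf]
    simpa [conjNormal_coe] using hkF h hh
  have hcomm : ∀ h, TU * E h = E h * TU := fun h => by
    have hmem : E h ∈ Submodule.span ℂ (F : Set (Module.End ℂ U)) := by
      rw [← hF]; exact Submodule.subset_span ⟨h, rfl⟩
    generalize E h = f at hmem ⊢
    induction hmem using Submodule.span_induction with
    | mem f hf => obtain ⟨h', hh', rfl⟩ := hF' f hf; exact hcommF h' hh'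
    | zero => simp
    | add a b _ _ ha hb => rw [mul_add, add_mul, ha, hb]
    | smul c a _ ha => rw [mul_smul_comm, smul_mul_assoc, ha]
  -- The operator `TU` commutes with the Hecke algebra, so `T` is scalar on `U` as in Schur's lemma.
  obtain ⟨c, hc⟩ := Module.End.exists_eigenvalue TU
  obtain ⟨y, hy⟩ := hc.exists_hasEigenvector
  have hy1 : TU y = c • y := hy.apply_eq_smul
  have hy2 : (y : X) ≠ 0 := fun e => hy.2 (Subtype.ext e)
  have hscal : ∀ x, T (e x) = c • e x := fun x => by
    have hx : x ∈ Submodule.span ℂ (Set.range fun g => τ g y) := by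
      rw [span_orbit_eq_top hτ hy2]; trivial
    induction hx using Submodule.span_induction with
    | mem x hx =>
      obtain ⟨g, rfl⟩ := hx
      have h1 := LinearMap.congr_fun (hcomm g) y
      rw [Module.End.mul_apply, Module.End.mul_apply, hy1, map_smul] at h1
      exact congrArg Subtype.val h1
    | zero => simp
    | add a b _ _ ha hb => simp only [map_add, ha, hb, smul_add]
    | smul d a _ ha => simp only [map_smul, ha]; rw [smul_comm]
  have hlT : ∀ x, l (T x) = c * l x := fun x => by
    rw [← hle (T x), ← hTe, hscal, map_smul, hle, smul_eq_mul]
  let S : X →ₗ[ℂ] X := φ.toLinearEquiv.symm.toLinearMap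
  have hTS : ∀ x, T (S x) = x := fun x => φ.toLinearEquiv.apply_symm_apply x
  -- Now `a' = T⁻¹ ∘ a ∘ π k` also lies in `Hom_H(π, τ)`, and `l ∘ (a - c a')` vanishes on `FV`,
  -- whence `a = c a'`.
  let a' : V →ₗ[ℂ] X := S ∘ₗ a ∘ₗ π k
  have ha' : a' ∈ equivariantHom (π.comp H.subtype) τ := fun h x => by
    apply hTinj
    change T (S (a (π k (π h x)))) = T (τ h (S (a (π k x))))
    rw [hTS, hT, hTS, ← haA]
    change _ = a (π (MulAut.conjNormal k h : H) (π k x))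
    simp only [← Module.End.mul_apply, ← map_mul]
    rw [conjNormal_coe]
    simp
  have hla : ∀ y, l (a (π k y)) = c * l (a' y) := fun y => by
    rw [← hlT]
    change _ = l (T (S _))
    rw [hTS]; rfl
  have heq : (⟨a, haA⟩ - c • ⟨a', ha'⟩ : equivariantHom (π.comp H.subtype) τ) = 0 := by
    refine hFV _ fun y hy => ?_
    change l (a y - c • a' y) = 0
    rw [map_sub, map_smul, smul_eq_mul, ← hla, hK₁fix y hy k hk, sub_self]
  intro y
  have h1 : a y - c • a' y = 0 := LinearMap.congr_fun (congrArg Subtype.val heq) y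
  rw [hla, sub_eq_zero.1 h1, map_smul, smul_eq_mul]

end Restrict


/-! ### Localization of compactly induced representations -/

section Cells

variable {G : Type*} [Group G] {Γ : Subgroup G}

/-- The double coset `Γ g K`. -/
def dcoset (Γ : Subgroup G) (g : G) (K : Subgroup G) : Set G :=
  {y | ∃ h ∈ Γ, ∃ k ∈ K, y = h * g * k}

theorem mem_dcoset_self (g : G) (K : Subgroup G) : g ∈ dcoset Γ g K :=
  ⟨1, Γ.one_mem, 1, K.one_mem, by simp⟩

theorem mul_mul_mem_dcoset {g y : G} {K : Subgroup G} {h k : G} (hh : h ∈ Γ) (hk : k ∈ K) :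
    h * y * k ∈ dcoset Γ g K ↔ y ∈ dcoset Γ g K := by
  constructor
  · rintro ⟨h', hh', k', hk', e⟩
    refine ⟨h⁻¹ * h', Γ.mul_mem (Γ.inv_mem hh) hh', k' * k⁻¹, K.mul_mem hk' (K.inv_mem hk), ?_⟩
    have : y = h⁻¹ * (h * y * k) * k⁻¹ := by group
    rw [this, e]; group
  · rintro ⟨h', hh', k', hk', rfl⟩
    exact ⟨h * h', Γ.mul_mem hh hh', k' * k, K.mul_mem hk' hk, by group⟩

theorem dcoset_eq_of_mem {g y : G} {K : Subgroup G} (h : y ∈ dcoset Γ g K) :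
    dcoset Γ y K = dcoset Γ g K := by
  obtain ⟨a, ha, k, hk, rfl⟩ := h
  ext z
  constructor
  · rintro ⟨b, hb, l, hl, rfl⟩
    exact ⟨b * a, Γ.mul_mem hb ha, k * l, K.mul_mem hk hl, by group⟩
  · rintro ⟨b, hb, l, hl, rfl⟩
    exact ⟨b * a⁻¹, Γ.mul_mem hb (Γ.inv_mem ha), k⁻¹ * l, K.mul_mem (K.inv_mem hk) hl, by group⟩

variable [TopologicalSpace G]

/-- A subset of `G` that is left invariant under `Γ` and right invariant under an open subgroup,
that is, a (clopen, uniformly so) subset of `Γ \ G`. -/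
def IsCell (Γ : Subgroup G) (W : Set G) : Prop :=
  (∀ h ∈ Γ, ∀ x, h * x ∈ W ↔ x ∈ W) ∧
    ∃ K : Subgroup G, IsOpen (K : Set G) ∧ ∀ k ∈ K, ∀ x, x * k ∈ W ↔ x ∈ W

theorem IsCell.inter {W W' : Set G} (h : IsCell Γ W) (h' : IsCell Γ W') : IsCell Γ (W ∩ W') := by
  obtain ⟨h1, K, o, h2⟩ := h
  obtain ⟨h1', K', o', h2'⟩ := h'
  refine ⟨fun g hg x => and_congr (h1 g hg x) (h1' g hg x), K ⊓ K', ?_,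
    fun k hk x => and_congr (h2 k hk.1 x) (h2' k hk.2 x)⟩
  rw [Subgroup.coe_inf]; exact o.inter o'

theorem IsCell.compl {W : Set G} (h : IsCell Γ W) : IsCell Γ Wᶜ := by
  obtain ⟨h1, K, o, h2⟩ := h
  exact ⟨fun g hg x => not_congr (h1 g hg x), K, o, fun k hk x => not_congr (h2 k hk x)⟩

theorem isCell_univ : IsCell Γ (Set.univ : Set G) :=
  ⟨fun _ _ _ => Iff.rfl, ⊤, isOpen_univ, fun _ _ _ => Iff.rfl⟩

theorem IsCell.biInter {ι : Type*} (t : Finset ι) {W : ι → Set G} (h : ∀ i ∈ t, IsCell Γ (W i)) :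
    IsCell Γ (⋂ i ∈ t, W i) := by
  classical
  induction t using Finset.induction_on with
  | empty => simpa using isCell_univ
  | insert a s _ ih =>
    rw [Finset.set_biInter_insert]
    exact (h a (Finset.mem_insert_self _ _)).inter
      (ih fun i hi => h i (Finset.mem_insert_of_mem hi))

theorem isCell_dcoset (g : G) {K : Subgroup G} (hK : IsOpen (K : Set G)) :
    IsCell Γ (dcoset Γ g K) :=
  ⟨fun h hh x => by simpa using mul_mul_mem_dcoset (g := g) (y := x) hh K.one_mem, K, hK,
    fun k hk x => by simpa using mul_mul_mem_dcoset (g := g) (y := x) Γ.one_mem hk⟩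

variable [LocallyProfinite G]

theorem IsCell.translate {W : Set G} (h : IsCell Γ W) (s : G) : IsCell Γ {y | y * s ∈ W} := by
  obtain ⟨h1, K, o, h2⟩ := h
  refine ⟨fun g hg x => ?_, K.comap (MulAut.conj s⁻¹).toMonoidHom, ?_, fun k hk x => ?_⟩
  · simpa only [mul_assoc, Set.mem_ofPred_eq] using h1 g hg (x * s)
  · have hcont : Continuous fun y : G => s⁻¹ * y * s⁻¹⁻¹ := by fun_prop
    exact o.preimage hcont
  · have hk' : s⁻¹ * k * s ∈ K := by simpa using hk
    have e : x * k * s = x * s * (s⁻¹ * k * s) := by group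
    change x * k * s ∈ W ↔ x * s ∈ W
    rw [e]
    exact h2 _ hk' _

theorem IsCell.isOpen {W : Set G} (h : IsCell Γ W) : IsOpen W := by
  obtain ⟨-, K, o, h2⟩ := h
  rw [isOpen_iff_mem_nhds]
  intro x hx
  have : (fun k => x * k) '' (K : Set G) ∈ nhds x :=
    ((Homeomorph.mulLeft x).isOpenMap _ o).mem_nhds ⟨1, K.one_mem, mul_one x⟩
  refine Filter.mem_of_superset this ?_
  rintro _ ⟨k, hk, rfl⟩
  exact (h2 k hk x).2 hx

variable {V : Type*} [AddCommGroup V] [Module ℂ V] {ρ : Representation ℂ Γ V}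

open Classical in
/-- Multiplication of the functions in `cInd ρ` by the indicator function of a cell (and the zero
map if `W` is not a cell). -/
def cut (ρ : Representation ℂ Γ V) (W : Set G) : cIndSpace ρ →ₗ[ℂ] cIndSpace ρ :=
  if hW : IsCell Γ W then
    { toFun := fun f => ⟨fun y => if y ∈ W then f.1 y else 0, by
        obtain ⟨f, a, ⟨K, o, c, i⟩, C, d, s⟩ := f
        obtain ⟨h1, K', o', h2⟩ := hW
        refine ⟨fun h g => ?_, ⟨K ⊓ K', ?_, ?_, fun g k hk => ?_⟩, C, d, fun g hg => ?_⟩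
        · simp only [h1 h h.2, a]
          split_ifs <;> simp
        · rw [Subgroup.coe_inf]; exact o.inter o'
        · rw [Subgroup.coe_inf]
          exact c.inter_right (K'.isClosed_of_isOpen o')
        · simp only [h2 k hk.2, i g k hk.1]
        · refine s g fun h0 => hg ?_
          simp only [h0, ite_self]⟩
      map_add' := fun f f' => by
        ext y
        simp only [Submodule.coe_add, Pi.add_apply]
        split_ifs <;> simp
      map_smul' := fun z f => by
        ext y
        simp only [Submodule.coe_smul, Pi.smul_apply, RingHom.id_apply]
        split_ifs <;> simp }
  else 0

open Classical in
theorem cut_apply {W : Set G} (hW : IsCell Γ W) (f : cIndSpace ρ) (y : G) :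
    (cut ρ W f).1 y = if y ∈ W then f.1 y else 0 := by
  rw [cut, dif_pos hW]; rfl

theorem cut_univ (f : cIndSpace ρ) : cut ρ Set.univ f = f := by
  ext y
  rw [cut_apply isCell_univ, if_pos (Set.mem_univ y)]

theorem cut_congr {W : Set G} (hW : IsCell Γ W) {f f' : cIndSpace ρ}
    (h : ∀ y ∈ W, f.1 y = f'.1 y) : cut ρ W f = cut ρ W f' := by
  ext y
  rw [cut_apply hW, cut_apply hW]
  split_ifs with hy
  · exact h y hy
  · rfl

theorem cut_inter_add_cut_inter_compl {W W' : Set G} (hW : IsCell Γ W) (hW' : IsCell Γ W')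
    (f : cIndSpace ρ) : cut ρ (W ∩ W') f + cut ρ (W ∩ W'ᶜ) f = cut ρ W f := by
  ext y
  rw [Submodule.coe_add, Pi.add_apply, cut_apply (hW.inter hW'), cut_apply (hW.inter hW'.compl),
    cut_apply hW]
  by_cases h1 : y ∈ W <;> by_cases h2 : y ∈ W' <;> simp [h1, h2]

theorem cut_translate {W : Set G} (hW : IsCell Γ W) (s : G) (f : cIndSpace ρ) :
    cut ρ W (cInd ρ s⁻¹ f) = cInd ρ s⁻¹ (cut ρ {y | y * s ∈ W} f) := by
  classical
  ext y
  rw [cut_apply hW]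
  change _ = (cut ρ {y | y * s ∈ W} f).1 (y * s⁻¹)
  rw [cut_apply (hW.translate s)]
  have e : y * s⁻¹ ∈ {y | y * s ∈ W} ↔ y ∈ W := by
    rw [Set.mem_ofPred_eq, inv_mul_cancel_right]
  simp only [e]
  rfl

theorem apply_left (f : cIndSpace ρ) (h : Γ) (y : G) : f.1 (h * y) = ρ h (f.1 y) := f.2.1 h y

/-- There are functions in `cInd ρ` with support `Γ g K` and a prescribed value at `g`. -/
theorem exists_bump {g : G} {K : Subgroup G} (hKo : IsOpen (K : Set G))
    (hKc : IsCompact (K : Set G)) {x : V} (hx : ∀ h : Γ, g⁻¹ * h * g ∈ K → ρ h x = x) :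
    ∃ f : cIndSpace ρ, f.1 g = x ∧ (∀ y, ∀ k ∈ K, f.1 (y * k) = f.1 y) ∧
      ∀ y, f.1 y ≠ 0 → y ∈ dcoset Γ g K := by
  classical
  let F : G → V := fun y => if h : y ∈ dcoset Γ g K then ρ ⟨h.choose, h.choose_spec.1⟩ x else 0
  have hF : ∀ (h : Γ), ∀ k ∈ K, F (h * g * k) = ρ h x := by
    intro h k hk
    have hy : (h * g * k : G) ∈ dcoset Γ g K := ⟨h, h.2, k, hk, rfl⟩
    have e : F (h * g * k) = ρ ⟨hy.choose, hy.choose_spec.1⟩ x := dif_pos hy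
    obtain ⟨l, hl, e2⟩ := hy.choose_spec.2
    set h' : Γ := ⟨hy.choose, hy.choose_spec.1⟩ with hh'
    have e3 : (h * g * k : G) = h' * g * l := e2
    rw [e]
    have e4 : ρ (h'⁻¹ * h) x = x := by
      refine hx _ ?_
      have : g⁻¹ * ((h'⁻¹ * h : Γ) : G) * g = l * k⁻¹ := by
        have h5 : (h : G) = h' * g * l * k⁻¹ * g⁻¹ := by rw [← e3]; group
        rw [Subgroup.coe_mul, Subgroup.coe_inv, h5]; group
      rw [this]
      exact K.mul_mem hl (K.inv_mem hk)
    have e5 : h = h' * (h'⁻¹ * h) := by group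
    rw [e5, map_mul, Module.End.mul_apply, e4]
  have hF0 : ∀ y, y ∉ dcoset Γ g K → F y = 0 := fun y hy => dif_neg hy
  have hFK : ∀ y, ∀ k ∈ K, F (y * k) = F y := by
    intro y k hk
    by_cases hy : y ∈ dcoset Γ g K
    · obtain ⟨h, hh, l, hl, rfl⟩ := hy
      rw [mul_assoc, hF ⟨h, hh⟩ _ (K.mul_mem hl hk), hF ⟨h, hh⟩ _ hl]
    · rw [hF0 y hy, hF0]
      intro h'
      exact hy ((by simpa using mul_mul_mem_dcoset (g := g) (y := y) Γ.one_mem hk :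
        y * k ∈ dcoset Γ g K ↔ _).1 h')
  have hFΓ : ∀ (h : Γ) y, F (h * y) = ρ h (F y) := by
    intro h y
    by_cases hy : y ∈ dcoset Γ g K
    · obtain ⟨h', hh', l, hl, rfl⟩ := hy
      have e : (h : G) * (h' * g * l) = ((h * ⟨h', hh'⟩ : Γ) : G) * g * l := by
        rw [Subgroup.coe_mul]; group
      rw [e, hF _ _ hl, hF ⟨h', hh'⟩ _ hl, map_mul, Module.End.mul_apply]
    · rw [hF0 y hy, hF0, map_zero]
      intro h'
      exact hy ((by simpa using mul_mul_mem_dcoset (g := g) (y := y) h.2 K.one_mem :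
        (h : G) * y ∈ dcoset Γ g K ↔ _).1 h')
  have hsupp : ∀ y, F y ≠ 0 → y ∈ dcoset Γ g K := fun y hy => by
    by_contra h
    exact hy (hF0 y h)
  refine ⟨⟨F, hFΓ, ⟨K, hKo, hKc, hFK⟩, (fun k => g * k) '' K, hKc.image (by fun_prop),
    fun y hy => ?_⟩, ?_, hFK, hsupp⟩
  · obtain ⟨h, hh, k, hk, rfl⟩ := hsupp y hy
    exact ⟨⟨h, hh⟩, g * k, ⟨k, hk, rfl⟩, mul_assoc _ _ _⟩
  · simpa using hF 1 1 K.one_mem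

theorem exists_apply_eq (hρ : IsSmooth ρ) (g : G) (x : V) : ∃ f : cIndSpace ρ, f.1 g = x := by
  obtain ⟨O, hO, hO'⟩ := isOpen_induced_iff.1 (hρ x)
  have hO1 : (fun k => g * k * g⁻¹) ⁻¹' O ∈ nhds (1 : G) := by
    have hcont : Continuous fun k => g * k * g⁻¹ := by fun_prop
    refine (hO.preimage hcont).mem_nhds ?_
    have : (1 : Γ) ∈ {h : Γ | ρ h x = x} := by simp
    rw [← hO'] at this
    simpa using this
  obtain ⟨K, ho, hc, hK⟩ := LocallyProfinite.exists_compact_open_subgroup _ hO1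
  obtain ⟨f, hf, -⟩ := exists_bump (ρ := ρ) (g := g) ho hc (x := x) (fun h hh => by
    have h1 := hK hh
    have h2 : (h : G) ∈ O := by
      have e : g * (g⁻¹ * h * g) * g⁻¹ = h := by group
      rw [Set.mem_preimage, e] at h1
      exact h1
    have h3 : h ∈ (Subtype.val ⁻¹' O : Set Γ) := h2
    rw [hO'] at h3
    exact h3)
  exact ⟨f, hf⟩

variable {Z : Type*} [AddCommGroup Z] [Module ℂ Z]

/-- The linear map `F` on `cInd ρ` vanishes on all restrictions of `f` to small cells at `g`. -/
def LocallyZero (F : cIndSpace ρ →ₗ[ℂ] Z) (f : cIndSpace ρ) (g : G) : Prop :=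
  ∃ W, IsCell Γ W ∧ g ∈ W ∧ ∀ W', IsCell Γ W' → W' ⊆ W → F (cut ρ W' f) = 0

theorem LocallyZero.add {F : cIndSpace ρ →ₗ[ℂ] Z} {f f' : cIndSpace ρ} {g : G}
    (h : LocallyZero F f g) (h' : LocallyZero F f' g) : LocallyZero F (f + f') g := by
  obtain ⟨W, h1, h2, h3⟩ := h
  obtain ⟨W', h1', h2', h3'⟩ := h'
  refine ⟨W ∩ W', h1.inter h1', ⟨h2, h2'⟩, fun U hU hUW => ?_⟩
  rw [map_add, map_add, h3 U hU (hUW.trans Set.inter_subset_left),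
    h3' U hU (hUW.trans Set.inter_subset_right), add_zero]

theorem LocallyZero.smul {F : cIndSpace ρ →ₗ[ℂ] Z} {f : cIndSpace ρ} {g : G}
    (h : LocallyZero F f g) (c : ℂ) : LocallyZero F (c • f) g := by
  obtain ⟨W, h1, h2, h3⟩ := h
  exact ⟨W, h1, h2, fun U hU hUW => by rw [map_smul, map_smul, h3 U hU hUW, smul_zero]⟩

theorem LocallyZero.congr {F : cIndSpace ρ →ₗ[ℂ] Z} {f f' : cIndSpace ρ} {g : G}
    (h : LocallyZero F f g) (e : f'.1 g = f.1 g) : LocallyZero F f' g := by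
  obtain ⟨W, h1, h2, h3⟩ := h
  obtain ⟨K, o, -, i⟩ := f.2.2.1
  obtain ⟨K', o', -, i'⟩ := f'.2.2.1
  have ho : IsOpen ((K ⊓ K' : Subgroup G) : Set G) := by
    rw [Subgroup.coe_inf]; exact o.inter o'
  refine ⟨W ∩ dcoset Γ g (K ⊓ K'), h1.inter (isCell_dcoset g ho), ⟨h2, mem_dcoset_self _ _⟩,
    fun U hU hUW => ?_⟩
  rw [cut_congr hU (f' := f), h3 U hU (hUW.trans Set.inter_subset_left)]
  intro y hy
  obtain ⟨h, hh, k, hk, rfl⟩ := (hUW hy).2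
  rw [i _ _ hk.1, i' _ _ hk.2]
  exact (apply_left f' ⟨h, hh⟩ g).trans
    ((congrArg _ e).trans (apply_left f ⟨h, hh⟩ g).symm)

/-- A linear map on `cInd ρ` that is locally zero at `f` everywhere vanishes at `f`: the support of
`f` is compact modulo `Γ`. -/
theorem eq_zero_of_locallyZero {F : cIndSpace ρ →ₗ[ℂ] Z} {f : cIndSpace ρ}
    (h : ∀ g, LocallyZero F f g) : F f = 0 := by
  classical
  choose W hW hgW hF using h
  obtain ⟨C, hC, hs⟩ := f.2.2.2
  obtain ⟨t, ht⟩ := hC.elim_finite_subcover W (fun g => (hW g).isOpen)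
    (fun g _ => Set.mem_iUnion.2 ⟨g, hgW g⟩)
  have key : ∀ (t : Finset G) (U : Set G), IsCell Γ U →
      (∀ y ∈ U, f.1 y ≠ 0 → ∃ g ∈ t, y ∈ W g) → F (cut ρ U f) = 0 := by
    intro t
    induction t using Finset.induction_on with
    | empty =>
      intro U hU h
      have : cut ρ U f = 0 := by
        ext y
        rw [cut_apply hU]
        split_ifs with hy
        · by_contra h0
          obtain ⟨g, hg, -⟩ := h y hy h0
          simp at hg
        · rfl
      rw [this, map_zero]
    | insert a s _ ih =>
      intro U hU h
      rw [← cut_inter_add_cut_inter_compl hU (hW a), map_add,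
        hF a _ (hU.inter (hW a)) Set.inter_subset_right, zero_add]
      refine ih _ (hU.inter (hW a).compl) fun y hy h0 => ?_
      obtain ⟨g, hg, hyg⟩ := h y hy.1 h0
      rcases Finset.mem_insert.1 hg with rfl | hg
      · exact absurd hyg hy.2
      · exact ⟨g, hg, hyg⟩
  rw [← cut_univ f]
  refine key t _ isCell_univ fun y _ h0 => ?_
  obtain ⟨h, c, hc, rfl⟩ := hs y h0
  obtain ⟨g, hg⟩ := Set.mem_iUnion.1 (ht hc)
  obtain ⟨hg, hcg⟩ := Set.mem_iUnion.1 hg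
  exact ⟨g, hg, ((hW g).1 h h.2 c).2 hcg⟩

theorem isSmooth_cInd : IsSmooth (cInd ρ) := by
  refine isSmooth_of_forall_exists fun f => ?_
  obtain ⟨K, o, -, i⟩ := f.2.2.1
  exact ⟨K, o, fun k hk => Subtype.ext (funext fun y => i y k hk)⟩

end Cells


/-! ### Homomorphisms from a compactly induced representation over a normal subgroup -/

section Fibers

variable {G : Type*} [Group G] {Γ : Subgroup G}
  {V : Type*} [AddCommGroup V] [Module ℂ V] {ρ : Representation ℂ Γ V}
  {N : Type*} [Group N] {ι : N →* Γ} {c : G →* MulAut N}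
  {X : Type*} [AddCommGroup X] [Module ℂ X] {τ : Representation ℂ N X}
  {Z : Type*} [AddCommGroup Z] [Module ℂ Z]

/-- The representation of `N` on the fibre of `cInd ρ` at `g`: the restriction of `ρ`, twisted by
the conjugation action `c g` of `g` on `N`. -/
def fiberRep (ρ : Representation ℂ Γ V) (ι : N →* Γ) (c : G →* MulAut N) (g : G) :
    Representation ℂ N V :=
  ρ.comp (ι.comp (c g).toMonoidHom)

theorem fiberRep_apply (g : G) (n : N) : fiberRep ρ ι c g n = ρ (ι (c g n)) := rfl

theorem equivariantHom_fiberRep_mul (hc : ∀ g n, (ι (c g n) : G) = g * ι n * g⁻¹) (h : Γ) (g : G)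
    (h0 : equivariantHom (fiberRep ρ ι c (h * g)) τ ≠ ⊥) :
    equivariantHom (fiberRep ρ ι c g) τ ≠ ⊥ := by
  obtain ⟨T, hT, hT0⟩ := Submodule.exists_mem_ne_zero_of_ne_bot h0
  refine fun hbot => hT0 ?_
  have hmem : T ∘ₗ ρ h ∈ equivariantHom (fiberRep ρ ι c g) τ := fun n x => by
    have e : h * ι (c g n) = ι (c (h * g) n) * h := by
      apply Subtype.ext
      rw [Subgroup.coe_mul, Subgroup.coe_mul, hc, hc]
      group
    rw [LinearMap.comp_apply, LinearMap.comp_apply, fiberRep_apply, ← Module.End.mul_apply,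
      ← map_mul, e, map_mul, Module.End.mul_apply]
    exact hT n _
  rw [hbot, Submodule.mem_bot] at hmem
  refine LinearMap.ext fun x => ?_
  have := LinearMap.congr_fun hmem (ρ h⁻¹ x)
  rwa [LinearMap.comp_apply, Representation.self_inv_apply] at this

theorem map_asAlgebraHom {Y : Type*} [AddCommGroup Y] [Module ℂ Y] {σ : Representation ℂ N Y}
    {F : Y →ₗ[ℂ] X} (hF : F ∈ equivariantHom σ τ) (α : MonoidAlgebra ℂ N) (y : Y) :
    F (σ.asAlgebraHom α y) = τ.asAlgebraHom α (F y) := by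
  induction α using MonoidAlgebra.induction_linear with
  | zero => simp
  | add a b ha hb => simp only [map_add, LinearMap.add_apply, ha, hb]
  | single n z =>
    simp only [Representation.asAlgebraHom_single, LinearMap.smul_apply, map_smul, hF n y]

/-- The subspace of `σ` spanned by the images of the elements of the group algebra that kill the
functional `l` on `τ`. -/
def annSpan (τ : Representation ℂ N X) (l : X →ₗ[ℂ] ℂ) {Y : Type*} [AddCommGroup Y] [Module ℂ Y]
    (σ : Representation ℂ N Y) : Submodule ℂ Y :=
  Submodule.span ℂ {y | ∃ α : MonoidAlgebra ℂ N, (∀ x, l (τ.asAlgebraHom α x) = 0) ∧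
    ∃ y', y = σ.asAlgebraHom α y'}

variable [TopologicalSpace G] [LocallyProfinite G]

/-- The restriction of `cInd ρ` to `N`. -/
def cIndRestrict (ρ : Representation ℂ Γ V) (ι : N →* Γ) : Representation ℂ N (cIndSpace ρ) :=
  (cInd ρ).comp (Γ.subtype.comp ι)

theorem cIndRestrict_apply (hc : ∀ g n, (ι (c g n) : G) = g * ι n * g⁻¹) (n : N)
    (f : cIndSpace ρ) (g : G) :
    (cIndRestrict ρ ι n f).1 g = fiberRep ρ ι c g n (f.1 g) := by
  have e : g * (ι n : G) = (ι (c g n) : G) * g := by rw [hc]; group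
  change f.1 (g * ι n) = _
  rw [e, apply_left]
  rfl

theorem cIndRestrict_asAlgebraHom_apply (hc : ∀ g n, (ι (c g n) : G) = g * ι n * g⁻¹)
    (α : MonoidAlgebra ℂ N) (f : cIndSpace ρ) (g : G) :
    ((cIndRestrict ρ ι).asAlgebraHom α f).1 g = (fiberRep ρ ι c g).asAlgebraHom α (f.1 g) := by
  induction α using MonoidAlgebra.induction_linear with
  | zero => simp
  | add a b ha hb => simp only [map_add, LinearMap.add_apply, Submodule.coe_add, Pi.add_apply,
      ha, hb]
  | single n z =>
    simp only [Representation.asAlgebraHom_single, LinearMap.smul_apply, Submodule.coe_smul,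
      Pi.smul_apply, cIndRestrict_apply hc]

theorem cut_cIndRestrict (hc : ∀ g n, (ι (c g n) : G) = g * ι n * g⁻¹) {W : Set G}
    (hW : IsCell Γ W) (n : N) (f : cIndSpace ρ) :
    cut ρ W (cIndRestrict ρ ι n f) = cIndRestrict ρ ι n (cut ρ W f) := by
  ext y
  rw [cut_apply hW, cIndRestrict_apply hc, cIndRestrict_apply hc, cut_apply hW]
  split_ifs <;> simp

theorem cut_asAlgebraHom (hc : ∀ g n, (ι (c g n) : G) = g * ι n * g⁻¹) {W : Set G}
    (hW : IsCell Γ W) (α : MonoidAlgebra ℂ N) (f : cIndSpace ρ) :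
    cut ρ W ((cIndRestrict ρ ι).asAlgebraHom α f)
      = (cIndRestrict ρ ι).asAlgebraHom α (cut ρ W f) := by
  induction α using MonoidAlgebra.induction_linear with
  | zero => simp
  | add a b ha hb => simp only [map_add, LinearMap.add_apply, ha, hb]
  | single n z =>
    simp only [Representation.asAlgebraHom_single, LinearMap.smul_apply, map_smul,
      cut_cIndRestrict hc hW]

/-- A functional `l ∘ F` is locally zero at `f` at the point `g` if the value `f g` lies in the
span of the images of the annihilator of `l` on the fibre. -/
theorem locallyZero_of_mem_annSpan (hρ : IsSmooth ρ)
    (hc : ∀ g n, (ι (c g n) : G) = g * ι n * g⁻¹) {l : X →ₗ[ℂ] ℂ}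
    {F : cIndSpace ρ →ₗ[ℂ] X}
    (hF : F ∈ equivariantHom (cIndRestrict ρ ι) τ) {f : cIndSpace ρ} {g : G}
    (hf : f.1 g ∈ annSpan τ l (fiberRep ρ ι c g)) : LocallyZero (l ∘ₗ F) f g := by
  have key : ∀ y ∈ annSpan τ l (fiberRep ρ ι c g), ∃ f₀ : cIndSpace ρ, f₀.1 g = y ∧
      LocallyZero (l ∘ₗ F) f₀ g := by
    intro y hy
    induction hy using Submodule.span_induction with
    | mem y hy =>
      obtain ⟨α, hα, x, rfl⟩ := hy
      obtain ⟨f₁, rfl⟩ := exists_apply_eq hρ g x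
      refine ⟨(cIndRestrict ρ ι).asAlgebraHom α f₁, cIndRestrict_asAlgebraHom_apply hc _ _ _,
        Set.univ, isCell_univ, trivial, fun W hW _ => ?_⟩
      rw [cut_asAlgebraHom hc hW, LinearMap.comp_apply, map_asAlgebraHom hF]
      exact hα _
    | zero => exact ⟨0, rfl, Set.univ, isCell_univ, trivial, fun W hW _ => by simp⟩
    | add a b _ _ ha hb =>
      obtain ⟨f₁, e₁, h₁⟩ := ha
      obtain ⟨f₂, e₂, h₂⟩ := hb
      exact ⟨f₁ + f₂, by rw [Submodule.coe_add, Pi.add_apply, e₁, e₂], h₁.add h₂⟩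
    | smul z a _ ha =>
      obtain ⟨f₁, e₁, h₁⟩ := ha
      exact ⟨z • f₁, by rw [Submodule.coe_smul, Pi.smul_apply, e₁], h₁.smul z⟩
  obtain ⟨f₀, e, h⟩ := key _ hf
  exact h.congr e.symm

variable [TopologicalSpace N]

theorem isSmooth_fiberRep (hρ : IsSmooth ρ) (hι : Continuous ι)
    (hc : ∀ g n, (ι (c g n) : G) = g * ι n * g⁻¹) (g : G) : IsSmooth (fiberRep ρ ι c g) := by
  refine hρ.comp (c := ι.comp (c g).toMonoidHom) ?_
  rw [continuous_induced_rng]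
  have : (Subtype.val ∘ ⇑(ι.comp (c g).toMonoidHom) : N → G) = fun n => g * (ι n : G) * g⁻¹ :=
    funext fun n => hc g n
  rw [this]
  fun_prop

theorem isSmooth_cIndRestrict (hι : Continuous ι) : IsSmooth (cIndRestrict ρ ι) :=
  isSmooth_cInd.comp (c := Γ.subtype.comp ι) (continuous_subtype_val.comp hι)

variable [LocallyProfinite N] {L : Subgroup N} (hLo : IsOpen (L : Set N)) {l : X →ₗ[ℂ] ℂ}
  (hl : ∀ k ∈ L, ∀ x, l (τ k x) = l x) (hl0 : l ≠ 0)

include hLo hl hl0 in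
/-- A vector outside `annSpan τ l σ` is not killed by all intertwining maps `σ → τ`. -/
theorem exists_equivariantHom_of_notMem (hτ : τ.IsIrreducible) (ha : IsAdmissible τ)
    {Y : Type*} [AddCommGroup Y] [Module ℂ Y] {σ : Representation ℂ N Y} (hσ : IsSmooth σ)
    {y : Y} (hy : y ∉ annSpan τ l σ) :
    ∃ T ∈ equivariantHom σ τ, l (T y) ≠ 0 ∧ ∀ y' ∈ annSpan τ l σ, l (T y') = 0 := by
  obtain ⟨m, hm, hmy⟩ := Submodule.exists_le_ker_of_notMem hy
  obtain ⟨T, hT, hTm⟩ := exists_intertwiner_of_functional hτ ha hLo hl hl0 hσ (m := m)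
    (fun α hα y' => hmy (Submodule.subset_span ⟨α, hα, y', rfl⟩))
  exact ⟨T, hT, by rwa [hTm], fun y' hy' => by rw [hTm]; exact hmy hy'⟩

include hLo hl hl0 in
/-- If `Hom_N(σ, τ)` is at most one-dimensional, then so is the quotient by `annSpan τ l σ`. -/
theorem exists_spanning_vector (hτ : τ.IsIrreducible) (ha : IsAdmissible τ)
    {Y : Type*} [AddCommGroup Y] [Module ℂ Y] {σ : Representation ℂ N Y} (hσ : IsSmooth σ)
    (hrank : ∀ T ∈ equivariantHom σ τ, T ≠ 0 → ∀ T' ∈ equivariantHom σ τ, ∃ z : ℂ, T' = z • T) :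
    ∃ x₀, ∀ x, ∃ z : ℂ, x - z • x₀ ∈ annSpan τ l σ := by
  by_cases htop : ∀ x, x ∈ annSpan τ l σ
  · exact ⟨0, fun x => ⟨0, htop _⟩⟩
  push Not at htop
  obtain ⟨x₀, hx₀⟩ := htop
  obtain ⟨T, hT, hTx, -⟩ := exists_equivariantHom_of_notMem hLo hl hl0 hτ ha hσ hx₀
  refine ⟨x₀, fun x => ⟨l (T x) / l (T x₀), ?_⟩⟩
  by_contra hx
  obtain ⟨T', hT', hTx', -⟩ := exists_equivariantHom_of_notMem hLo hl hl0 hτ ha hσ hx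
  obtain ⟨z, rfl⟩ := hrank T hT (fun h0 => hTx (by simp [h0])) T' hT'
  apply hTx'
  simp only [LinearMap.smul_apply, map_sub, map_smul, smul_eq_mul]
  field_simp
  ring

include hl0 in
/-- For an `N`-equivariant map `F` to an irreducible admissible representation, local vanishing can
be tested after composition with one functional. -/
theorem locallyZero_of_functional (hι : Continuous ι)
    (hc : ∀ g n, (ι (c g n) : G) = g * ι n * g⁻¹) (hτ : τ.IsIrreducible) (ha : IsAdmissible τ)
    {F : cIndSpace ρ →ₗ[ℂ] X} (hF : F ∈ equivariantHom (cIndRestrict ρ ι) τ) {g : G}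
    (h : ∀ f, LocallyZero (l ∘ₗ F) f g) (f : cIndSpace ρ) : LocallyZero F f g := by
  obtain ⟨K, ho, hK, -, hfix⟩ := (isSmooth_cIndRestrict (ρ := ρ) hι).exists_fixing {f}
    Filter.univ_mem
  have := ha.finite_fixedBy ho hK
  obtain ⟨t, ht⟩ := exists_finset_separating
    (fun n : N => l ∘ₗ τ n ∘ₗ (fixedBy τ K).subtype) (fun x hx => by
      by_contra h0
      obtain ⟨n, hn⟩ := exists_functional_orbit_ne_zero hτ hl0
        (fun e => h0 (Subtype.ext e) : (x : X) ≠ 0)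
      exact hn (hx n))
  choose W hW hgW hz using fun n => h (cIndRestrict ρ ι n f)
  refine ⟨⋂ n ∈ t, W n, IsCell.biInter t fun n _ => hW n, by simp [hgW], fun W' hW' hsub => ?_⟩
  have hfix' : F (cut ρ W' f) ∈ fixedBy τ K := fun k hk => by
    rw [← hF, ← cut_cIndRestrict hc hW', hfix f (by simp) k hk]
  have := ht ⟨_, hfix'⟩ fun n hn => by
    have h1 := hz n W' hW' (hsub.trans (Set.biInter_subset_of_mem hn))
    rw [cut_cIndRestrict hc hW', LinearMap.comp_apply, hF] at h1
    exact h1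
  exact congrArg Subtype.val this

include hLo hl hl0 in
theorem locallyZero_of_equivariantHom_eq_bot (hρ : IsSmooth ρ) (hι : Continuous ι)
    (hc : ∀ g n, (ι (c g n) : G) = g * ι n * g⁻¹) (hτ : τ.IsIrreducible) (ha : IsAdmissible τ)
    {F : cIndSpace ρ →ₗ[ℂ] X} (hF : F ∈ equivariantHom (cIndRestrict ρ ι) τ) {g : G}
    (hg : equivariantHom (fiberRep ρ ι c g) τ = ⊥) (f : cIndSpace ρ) :
    LocallyZero (l ∘ₗ F) f g := by
  refine locallyZero_of_mem_annSpan hρ hc hF ?_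
  by_contra h
  obtain ⟨T, hT, hTx, -⟩ := exists_equivariantHom_of_notMem hLo hl hl0 hτ ha
    (isSmooth_fiberRep hρ hι hc g) h
  rw [hg, Submodule.mem_bot] at hT
  simp [hT] at hTx

/-- If `τ` is a quotient of `cInd ρ` over `N`, then it is a quotient of one of its fibres. -/
theorem exists_fiberRep_hom (hρ : IsSmooth ρ) (hι : Continuous ι)
    (hc : ∀ g n, (ι (c g n) : G) = g * ι n * g⁻¹) (hτ : τ.IsIrreducible) (ha : IsAdmissible τ)
    {F : cIndSpace ρ →ₗ[ℂ] X} (hF : F ∈ equivariantHom (cIndRestrict ρ ι) τ) (hF0 : F ≠ 0) :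
    ∃ g, equivariantHom (fiberRep ρ ι c g) τ ≠ ⊥ := by
  by_contra! h
  have := nontrivial_of_isIrreducible hτ
  obtain ⟨L, hLo, -, l, hl0, hl⟩ := ha.1.exists_functional
  refine hF0 (LinearMap.ext fun f => eq_zero_of_locallyZero fun g => ?_)
  exact locallyZero_of_functional hl0 hι hc hτ ha hF
    (fun f => locallyZero_of_equivariantHom_eq_bot hLo hl hl0 hρ hι hc hτ ha hF (h g) f) f

end Fibers


/-! ### Comparison of spaces of homomorphisms out of a compactly induced representation -/

section Comparison

variable {G : Type*} [Group G] {Γ : Subgroup G}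

theorem finite_range_dcoset {K₀ L : Subgroup G} (h : (L.subgroupOf K₀).FiniteIndex) :
    (Set.range fun k : K₀ => dcoset Γ k L).Finite := by
  refine (Set.finite_range fun q : K₀ ⧸ L.subgroupOf K₀ => dcoset Γ (q.out : G) L).subset ?_
  rintro _ ⟨k, rfl⟩
  obtain ⟨n, hn⟩ := QuotientGroup.mk_out_eq_mul (L.subgroupOf K₀) k
  refine ⟨k, dcoset_eq_of_mem ⟨1, Γ.one_mem, n, Subgroup.mem_subgroupOf.1 n.2, ?_⟩⟩
  rw [hn]; simp

variable [TopologicalSpace G] [LocallyProfinite G]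
  {V : Type*} [AddCommGroup V] [Module ℂ V] {ρ : Representation ℂ Γ V}

/-- An open subgroup `K` contains an open subgroup that is normalized by the compact open subgroup
`K₀` and has finite index in it. -/
theorem exists_normal_open_subgroup {K₀ K : Subgroup G} (h₀ : IsOpen (K₀ : Set G))
    (hc : IsCompact (K₀ : Set G)) (hK : IsOpen (K : Set G)) :
    ∃ L : Subgroup G, IsOpen (L : Set G) ∧ L ≤ K ∧ L ≤ K₀ ∧
      (∀ s ∈ K₀, ∀ k ∈ L, s * k * s⁻¹ ∈ L) ∧ (L.subgroupOf K₀).FiniteIndex := by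
  have hfi : (K.subgroupOf K₀).FiniteIndex := finiteIndex_subgroupOf hK hc
  have ho : IsOpen ((K.subgroupOf K₀ : Subgroup K₀) : Set K₀) := hK.preimage continuous_subtype_val
  have hcl : IsClosed (((K.subgroupOf K₀).normalCore : Subgroup K₀) : Set K₀) :=
    Subgroup.normalCore_isClosed _ ((K.subgroupOf K₀).isClosed_of_isOpen ho)
  have ho' : IsOpen (((K.subgroupOf K₀).normalCore : Subgroup K₀) : Set K₀) :=
    Subgroup.isOpen_of_isClosed_of_finiteIndex _ hcl
  have hL : IsOpen (((K.subgroupOf K₀).normalCore.map K₀.subtype : Subgroup G) : Set G) := by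
    rw [Subgroup.coe_map]
    exact h₀.isOpenMap_subtype_val _ ho'
  refine ⟨(K.subgroupOf K₀).normalCore.map K₀.subtype, hL, ?_, ?_, ?_,
    finiteIndex_subgroupOf hL hc⟩
  · rintro _ ⟨k, hk, rfl⟩
    exact Subgroup.mem_subgroupOf.1 (Subgroup.normalCore_le _ hk)
  · rintro _ ⟨k, -, rfl⟩
    exact k.2
  · rintro s hs _ ⟨k, hk, rfl⟩
    exact ⟨⟨s, hs⟩ * k * ⟨s, hs⟩⁻¹,
      (Subgroup.normalCore_normal (K.subgroupOf K₀)).conj_mem k hk ⟨s, hs⟩, rfl⟩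

open Classical in
/-- A function supported in `Γ K₀` is the sum of its restrictions to the double cosets `Γ k L`. -/
theorem cut_eq_sum_cut_dcoset {K₀ L : Subgroup G} (hL : IsOpen (L : Set G))
    {ψ : cIndSpace ρ} (hψ : ∀ y, ψ.1 y ≠ 0 → y ∈ dcoset Γ 1 K₀)
    {D : Finset (Set G)} (hD : ∀ U, U ∈ D ↔ ∃ k ∈ K₀, U = dcoset Γ k L)
    {W : Set G} (hW : IsCell Γ W) (hWL : ∀ k ∈ L, ∀ x, x * k ∈ W ↔ x ∈ W) :
    cut ρ W ψ = ∑ U ∈ D with U ⊆ W, cut ρ U ψ := by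
  classical
  ext y
  have hcell : ∀ U ∈ D, IsCell Γ U := fun U hU => by
    obtain ⟨k, -, rfl⟩ := (hD U).1 hU
    exact isCell_dcoset k hL
  rw [cut_apply hW, Submodule.coe_sum, Finset.sum_apply]
  have hsum : ∀ U ∈ D.filter (· ⊆ W), (cut ρ U ψ).1 y = if y ∈ U then ψ.1 y else 0 :=
    fun U hU => cut_apply (hcell U (Finset.mem_filter.1 hU).1) ψ y
  rw [Finset.sum_congr rfl hsum]
  by_cases h0 : ψ.1 y = 0
  · simp [h0]
  obtain ⟨h, hh, k, hk, e⟩ := hψ y h0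
  have hy : y ∈ dcoset Γ k L := ⟨h, hh, 1, L.one_mem, by rw [e]; group⟩
  have hin : ∀ y' ∈ dcoset Γ y L, y' ∈ W ↔ y ∈ W := by
    rintro _ ⟨a, ha, b, hb, rfl⟩
    rw [hWL b hb, hW.1 a ha]
  rw [← dcoset_eq_of_mem hy] at hy
  by_cases hyW : y ∈ W
  · rw [if_pos hyW, Finset.sum_eq_single (dcoset Γ y L), if_pos hy]
    · intro U hU hne
      refine if_neg fun hyU => hne ?_
      obtain ⟨k', -, rfl⟩ := (hD U).1 (Finset.mem_filter.1 hU).1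
      exact (dcoset_eq_of_mem hyU).symm
    · intro hnot
      refine absurd (Finset.mem_filter.2 ⟨(hD _).2 ⟨k, hk, ?_⟩, fun y' hy' => ?_⟩) hnot
      · exact dcoset_eq_of_mem ⟨h, hh, 1, L.one_mem, by rw [e]; group⟩
      · exact (hin y' hy').2 hyW
  · rw [if_neg hyW, Finset.sum_eq_zero]
    intro U hU
    exact if_neg fun hyU => hyW ((Finset.mem_filter.1 hU).2 hyU)

variable {N : Type*} [Group N] {ι : N →* Γ} {c : G →* MulAut N}
  {X : Type*} [AddCommGroup X] [Module ℂ X] {τ : Representation ℂ N X}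
  [TopologicalSpace N] [LocallyProfinite N] {L : Subgroup N} {l : X →ₗ[ℂ] ℂ}

/-- Let `ψ` be a right `K₀`-invariant function supported in `Γ K₀` whose value at `1` spans the
fibre modulo the part that `l ∘ F` ignores, and suppose that `l ∘ F` is invariant under enough
elements of `K₀`. If `l ∘ F` kills `ψ`, then it is locally zero at `1`: the pieces of `ψ` on the
double cosets `Γ k L` that matter are translates of each other, so that each contributes the same
amount to `l (F ψ) = 0`. -/
theorem locallyZero_one_of_apply_eq_zero (hLo : IsOpen (L : Set N))
    (hl : ∀ k ∈ L, ∀ x, l (τ k x) = l x) (hl0 : l ≠ 0) (hρ : IsSmooth ρ) (hι : Continuous ι)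
    (hc : ∀ g n, (ι (c g n) : G) = g * ι n * g⁻¹) (hτ : τ.IsIrreducible) (ha : IsAdmissible τ)
    {F : cIndSpace ρ →ₗ[ℂ] X} (hF : F ∈ equivariantHom (cIndRestrict ρ ι) τ)
    {K₀ : Subgroup G} (hKo : IsOpen (K₀ : Set G)) (hKc : IsCompact (K₀ : Set G)) {ψ : cIndSpace ρ}
    (hψ1 : ∀ x, ∃ z : ℂ, x - z • ψ.1 1 ∈ annSpan τ l (fiberRep ρ ι c 1))
    (hψK : ∀ y, ∀ k ∈ K₀, ψ.1 (y * k) = ψ.1 y) (hψ : ∀ y, ψ.1 y ≠ 0 → y ∈ dcoset Γ 1 K₀)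
    (hinv : ∀ k ∈ K₀, equivariantHom (fiberRep ρ ι c k) τ ≠ ⊥ →
      ∃ h : Γ, (h : G) * k ∈ K₀ ∧ ∀ f, l (F (cInd ρ (h * k) f)) = l (F f))
    (h0 : l (F ψ) = 0) (f : cIndSpace ρ) : LocallyZero (l ∘ₗ F) f 1 := by
  classical
  have key : ∀ W, IsCell Γ W → l (F (cut ρ W ψ)) = 0 := by
    intro W hW
    obtain ⟨K, hK, hWK⟩ := hW.2
    obtain ⟨M, hM, hMK, hMK₀, hnorm, hfi⟩ := exists_normal_open_subgroup hKo hKc hK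
    set D := (finite_range_dcoset (Γ := Γ) hfi).toFinset with hDdef
    have hD : ∀ U, U ∈ D ↔ ∃ k ∈ K₀, U = dcoset Γ k M := fun U => by
      simp [hDdef, eq_comm]
    -- double cosets whose fibres do not map to `τ` do not contribute
    have hno : ∀ U ∈ D, (∀ g ∈ U, equivariantHom (fiberRep ρ ι c g) τ = ⊥) →
        l (F (cut ρ U ψ)) = 0 := by
      intro U hU hbot
      obtain ⟨k, -, rfl⟩ := (hD U).1 hU
      have hcell := isCell_dcoset (Γ := Γ) k hM
      refine eq_zero_of_locallyZero (F := l ∘ₗ F) fun g => ?_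
      by_cases hg : g ∈ dcoset Γ k M
      · exact locallyZero_of_equivariantHom_eq_bot hLo hl hl0 hρ hι hc hτ ha hF (hbot g hg) _
      · refine ⟨_, hcell.compl, hg, fun W' hW' hsub => ?_⟩
        rw [cut_congr hW' (f' := 0), map_zero, map_zero]
        intro y hy
        rw [cut_apply hcell, if_neg (hsub hy)]
        rfl
    -- the other ones contribute the same amount as `Γ M`
    have hyes : ∀ U ∈ D, (∃ g ∈ U, equivariantHom (fiberRep ρ ι c g) τ ≠ ⊥) →
        l (F (cut ρ U ψ)) = l (F (cut ρ (dcoset Γ 1 M) ψ)) := by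
      rintro U hU ⟨g, hg, hne⟩
      obtain ⟨k, hk, rfl⟩ := (hD U).1 hU
      obtain ⟨a, ha', b, hb, rfl⟩ := hg
      obtain ⟨h, hs, hsinv⟩ := hinv (k * b) (K₀.mul_mem hk (hMK₀ hb))
        (equivariantHom_fiberRep_mul hc ⟨a, ha'⟩ (k * b) (by rwa [mul_assoc] at hne))
      set s : G := h * (k * b) with hsdef
      have hmem : s ∈ dcoset Γ k M := ⟨(h : G), h.2, b, hb, by rw [hsdef, mul_assoc]⟩
      have hUs : dcoset Γ k M = dcoset Γ s M := (dcoset_eq_of_mem hmem).symm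
      have hset : {y | y * s ∈ dcoset Γ s M} = dcoset Γ 1 M := by
        ext y
        constructor
        · rintro ⟨a, ha, b, hb, e⟩
          refine ⟨a, ha, s * b * s⁻¹, hnorm s hs b hb, ?_⟩
          have : y = y * s * s⁻¹ := by group
          rw [this, e]; group
        · rintro ⟨a, ha, b, hb, rfl⟩
          refine ⟨a, ha, s⁻¹ * b * s, ?_, by group⟩
          simpa using hnorm s⁻¹ (K₀.inv_mem hs) b hb
      have hψs : cInd ρ s⁻¹ ψ = ψ := Subtype.ext (funext fun y => hψK y _ (K₀.inv_mem hs))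
      have e := cut_translate (ρ := ρ) (isCell_dcoset (Γ := Γ) s hM) s ψ
      rw [hψs, hset] at e
      rw [hUs, e, ← hsinv, Representation.self_inv_apply]
    -- Hence `l (F ψ) = 0` is a positive multiple of this amount, unless nothing contributes.
    have hone : l (F (cut ρ Set.univ ψ)) = 0 := by rwa [cut_univ]
    have hzero : ∀ U ∈ D, l (F (cut ρ U ψ)) = 0 := by
      have hsum := cut_eq_sum_cut_dcoset (ρ := ρ) hM hψ hD isCell_univ (fun _ _ _ => Iff.rfl)
      rw [hsum, map_sum, map_sum, Finset.filter_true_of_mem (fun _ _ => Set.subset_univ _)] at hone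
      by_contra! hex
      obtain ⟨U₀, hU₀, hne₀⟩ := hex
      have hval : ∀ U ∈ D, l (F (cut ρ U ψ)) = if l (F (cut ρ U ψ)) ≠ 0 then
          l (F (cut ρ (dcoset Γ 1 M) ψ)) else 0 := fun U hU => by
        split_ifs with hne
        · refine hyes U hU ?_
          by_contra! hbot
          exact hne (hno U hU hbot)
        · simpa using hne
      rw [Finset.sum_congr rfl hval, ← Finset.sum_filter, Finset.sum_const, smul_eq_zero] at hone
      rcases hone with hcard | hone
      · rw [Finset.card_eq_zero] at hcard
        exact absurd (hcard ▸ Finset.mem_filter.2 ⟨hU₀, hne₀⟩) (Finset.notMem_empty _)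
      · have := hval U₀ hU₀
        rw [if_pos hne₀, hone] at this
        exact hne₀ this
    rw [cut_eq_sum_cut_dcoset (ρ := ρ) hM hψ hD hW (fun k hk => hWK k (hMK hk)), map_sum,
      map_sum]
    exact Finset.sum_eq_zero fun U hU => hzero U (Finset.mem_filter.1 hU).1
  obtain ⟨z, hz⟩ := hψ1 (f.1 1)
  have h1 : LocallyZero (l ∘ₗ F) (f - z • ψ) 1 := locallyZero_of_mem_annSpan hρ hc hF hz
  have h2 : LocallyZero (l ∘ₗ F) ψ 1 := ⟨_, isCell_univ, trivial, fun W hW _ => key W hW⟩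
  have := h1.add (h2.smul z)
  rwa [sub_add_cancel] at this

/-- A bilinear family `Φ` of `N`-equivariant maps `cInd ρ → τ` yields a dimension inequality: under
the symmetry assumptions `h2` and `h3`, evaluating `l ∘ Φ a b` at one function supported near
`1` already determines `b`. -/
theorem finrank_le_finrank_of_bilinear (hLo : IsOpen (L : Set N))
    (hl : ∀ k ∈ L, ∀ x, l (τ k x) = l x) (hl0 : l ≠ 0) (hρ : IsSmooth ρ) (hι : Continuous ι)
    (hc : ∀ g n, (ι (c g n) : G) = g * ι n * g⁻¹) (hτ : τ.IsIrreducible) (ha : IsAdmissible τ)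
    (hrank : ∀ T ∈ equivariantHom (fiberRep ρ ι c 1) τ, T ≠ 0 →
      ∀ T' ∈ equivariantHom (fiberRep ρ ι c 1) τ, ∃ z : ℂ, T' = z • T)
    {A B : Type*} [AddCommGroup A] [Module ℂ A] [AddCommGroup B] [Module ℂ B] [Module.Finite ℂ A]
    (Φ : A →ₗ[ℂ] B →ₗ[ℂ] (cIndSpace ρ →ₗ[ℂ] X))
    (hΦ : ∀ a b, Φ a b ∈ equivariantHom (cIndRestrict ρ ι) τ)
    (h1 : ∀ b, (∀ a, Φ a b = 0) → b = 0)
    (h2 : ∀ g, equivariantHom (fiberRep ρ ι c g) τ ≠ ⊥ → ∃ h : Γ, ∃ T : X →ₗ[ℂ] X,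
      ∀ a, ∃ a', ∀ b f, Φ a b (cInd ρ (h * g)⁻¹ f) = T (Φ a' b f))
    (h3 : ∀ O ∈ nhds (1 : G), ∃ K₀ : Subgroup G, IsOpen (K₀ : Set G) ∧ IsCompact (K₀ : Set G) ∧
      (K₀ : Set G) ⊆ O ∧ ∀ k ∈ K₀, equivariantHom (fiberRep ρ ι c k) τ ≠ ⊥ →
        ∃ h : Γ, (h : G) * k ∈ K₀ ∧ ∀ a b f, l (Φ a b (cInd ρ (h * k) f)) = l (Φ a b f)) :
    Module.Finite ℂ B ∧ Module.finrank ℂ B ≤ Module.finrank ℂ A := by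
  obtain ⟨x₀, hx₀⟩ := exists_spanning_vector hLo hl hl0 hτ ha (isSmooth_fiberRep hρ hι hc 1) hrank
  obtain ⟨O, hO, hO'⟩ := isOpen_induced_iff.1 (hρ x₀)
  have hmemO : ∀ h : Γ, (h : G) ∈ O ↔ ρ h x₀ = x₀ := fun h => Set.ext_iff.1 hO' h
  obtain ⟨K₀, hKo, hKc, hKO, hinv⟩ := h3 O (hO.mem_nhds ((hmemO 1).2 (by simp)))
  obtain ⟨ψ, rfl, hψK, hψ⟩ := exists_bump (ρ := ρ) (g := 1) hKo hKc (x := x₀)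
    (fun h hh => (hmemO h).1 (hKO (by simpa using hh)))
  let θ : B →ₗ[ℂ] Module.Dual ℂ A :=
    (LinearMap.mk₂ ℂ (fun a b => l (Φ a b ψ)) (by simp) (by simp) (by simp) (by simp)).flip
  have hθ : Function.Injective θ := by
    rw [← LinearMap.ker_eq_bot, LinearMap.ker_eq_bot']
    intro b hb
    have hloc : ∀ a f, LocallyZero (Φ a b) f 1 := fun a => by
      refine locallyZero_of_functional hl0 hι hc hτ ha (hΦ a b) ?_
      exact locallyZero_one_of_apply_eq_zero hLo hl hl0 hρ hι hc hτ ha (hΦ a b) hKo hKc hx₀ hψK hψ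
        (fun k hk hne => by
          obtain ⟨h, hh, he⟩ := hinv k hk hne
          exact ⟨h, hh, he a b⟩)
        (LinearMap.congr_fun hb a)
    refine h1 b fun a => LinearMap.ext fun f => eq_zero_of_locallyZero fun g => ?_
    by_cases hg : equivariantHom (fiberRep ρ ι c g) τ = ⊥
    · exact locallyZero_of_functional hl0 hι hc hτ ha (hΦ a b)
        (locallyZero_of_equivariantHom_eq_bot hLo hl hl0 hρ hι hc hτ ha (hΦ a b) hg) f
    · obtain ⟨h, T, hT⟩ := h2 g hg
      obtain ⟨a', ha'⟩ := hT a
      set s : G := h * g with hs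
      obtain ⟨W, hW, h1W, hz⟩ := hloc a' (cInd ρ s f)
      refine ⟨_, hW.translate s⁻¹, ?_, fun W' hW' hsub => ?_⟩
      · rw [Set.mem_ofPred_eq, ← hW.1 h h.2, ← mul_assoc, ← hs, mul_inv_cancel]
        exact h1W
      · have e := cut_translate hW' s (cInd ρ s f)
        rw [Representation.inv_self_apply] at e
        rw [e, ha', hz _ (hW'.translate s), map_zero]
        intro y hy
        simpa using hsub hy
  have := Module.Finite.of_injective θ hθ
  exact ⟨this, (LinearMap.finrank_le_finrank_of_injective hθ).trans
    (Subspace.dual_finrank_eq).le⟩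

end Comparison


/-! ### Twisting by conjugation and the graph of an isomorphism of quotients -/

section Twist

/-- The representation `h ↦ τ (g h g⁻¹)` of a normal subgroup. -/
def twist {G : Type*} [Group G] {H : Subgroup G} [H.Normal] {X : Type*} [AddCommGroup X]
    [Module ℂ X] (τ : Representation ℂ H X) (g : G) : Representation ℂ H X :=
  τ.comp (MulAut.conjNormal (H := H) g).toMonoidHom

variable {G : Type*} [Group G] {H : Subgroup G} [H.Normal]
  {X : Type*} [AddCommGroup X] [Module ℂ X] {τ : Representation ℂ H X}

theorem twist_apply (g : G) (h : H) : twist τ g h = τ (MulAut.conjNormal g h) := rfl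

theorem twist_one : twist τ (1 : G) = τ := by
  ext h x
  rw [twist_apply, map_one, MulAut.one_apply]

theorem nonempty_equiv_twist {g : G} (e : Nonempty (Representation.Equiv (twist τ g⁻¹) τ)) :
    Nonempty (Representation.Equiv τ (twist τ g)) := by
  obtain ⟨e⟩ := e
  refine nonempty_equiv_of_bijective (T := e.toLinearEquiv.toLinearMap) (fun h x => ?_)
    e.toLinearEquiv.bijective
  have := Representation.IntertwiningMap.isIntertwining _ _ e.toIntertwiningMap
    (MulAut.conjNormal g h) x
  rw [twist_apply, ← MulAut.mul_apply, ← map_mul, inv_mul_cancel, map_one,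
    MulAut.one_apply] at this
  exact this

theorem isIrr_twist [TopologicalSpace G] [IsTopologicalGroup G] (h : IsIrr τ) (g : G) :
    IsIrr (twist τ g) := by
  refine ⟨h.1.comp ?_, isIrreducible_comp h.2 (MulAut.conjNormal (H := H) g).surjective⟩
  rw [continuous_induced_rng]
  have : (Subtype.val ∘ ⇑(MulAut.conjNormal (H := H) g).toMonoidHom : H → G)
      = fun h : H => g * h * g⁻¹ := funext fun h => conjNormal_coe g h
  rw [this]
  fun_prop

/-- The image of `a ∈ Hom_H(π, τ)` in `Hom_H(π, τ^{g⁻¹})`. -/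
theorem comp_mem_equivariantHom_twist {V : Type*} [AddCommGroup V] [Module ℂ V]
    {π : Representation ℂ G V} {a : V →ₗ[ℂ] X}
    (ha : a ∈ equivariantHom (π.comp H.subtype) τ) (g : G) :
    a ∘ₗ π g⁻¹ ∈ equivariantHom (π.comp H.subtype) (twist τ g⁻¹) := by
  intro h x
  have e : g⁻¹ * (h : G) = (MulAut.conjNormal g⁻¹ h : H) * g⁻¹ := by
    rw [conjNormal_coe]; group
  have := ha (MulAut.conjNormal g⁻¹ h) (π g⁻¹ x)
  change a (π g⁻¹ (π h x)) = _
  rw [← Module.End.mul_apply, ← map_mul, e, map_mul]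
  exact this

theorem equivariantHom_twist_ne_bot {V : Type*} [AddCommGroup V] [Module ℂ V]
    {π : Representation ℂ G V} (h0 : equivariantHom (π.comp H.subtype) τ ≠ ⊥) (g : G) :
    equivariantHom (π.comp H.subtype) (twist τ g⁻¹) ≠ ⊥ := by
  obtain ⟨a, ha, ha0⟩ := Submodule.exists_mem_ne_zero_of_ne_bot h0
  refine (Submodule.ne_bot_iff _).2 ⟨_, comp_mem_equivariantHom_twist ha g, fun h => ha0 ?_⟩
  refine LinearMap.ext fun x => ?_
  have := LinearMap.congr_fun h (π g x)
  rwa [LinearMap.comp_apply, Representation.inv_self_apply] at this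

theorem equivariantHom_ne_bot_of_equiv {V Y : Type*} [AddCommGroup V] [Module ℂ V]
    [AddCommGroup Y] [Module ℂ Y] {σ : Representation ℂ G V} {π : Representation ℂ G X}
    {π' : Representation ℂ G Y} (e : Nonempty (Representation.Equiv π π'))
    (h0 : equivariantHom σ π ≠ ⊥) : equivariantHom σ π' ≠ ⊥ := by
  obtain ⟨e⟩ := e
  obtain ⟨a, ha, ha0⟩ := Submodule.exists_mem_ne_zero_of_ne_bot h0
  refine (Submodule.ne_bot_iff _).2 ⟨e.toLinearEquiv.toLinearMap ∘ₗ a, fun g x => ?_, fun h => ?_⟩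
  · have := Representation.IntertwiningMap.isIntertwining _ _ e.toIntertwiningMap g (a x)
    rw [LinearMap.comp_apply, ha]
    exact this
  · exact ha0 (LinearMap.ext fun x => e.toLinearEquiv.injective
      ((LinearMap.congr_fun h x).trans (map_zero _).symm))

theorem exists_smul_of_rank_le_one {V : Type*} [AddCommGroup V] [Module ℂ V]
    {σ : Representation ℂ G V} {π : Representation ℂ G X}
    (h : Module.rank ℂ (Representation.IntertwiningMap σ π) ≤ 1) {T : V →ₗ[ℂ] X}
    (hT : T ∈ equivariantHom σ π) (hT0 : T ≠ 0) {T' : V →ₗ[ℂ] X}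
    (hT' : T' ∈ equivariantHom σ π) : ∃ z : ℂ, T' = z • T := by
  obtain ⟨S, hS⟩ := rank_le_one_iff.1 h
  obtain ⟨r, hr⟩ := hS ⟨T, fun g => LinearMap.ext (hT g)⟩
  obtain ⟨r', hr'⟩ := hS ⟨T', fun g => LinearMap.ext (hT' g)⟩
  have e : r • S.toLinearMap = T := congrArg Representation.IntertwiningMap.toLinearMap hr
  have e' : r' • S.toLinearMap = T' := congrArg Representation.IntertwiningMap.toLinearMap hr'
  have hr0 : r ≠ 0 := by
    rintro rfl
    exact hT0 (by rw [← e, zero_smul])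
  exact ⟨r' / r, by rw [← e, ← e', smul_smul, div_mul_cancel₀ _ hr0]⟩

end Twist

section Graph

variable {G₁ : Type u₁} {G₂ : Type u₂} [Group G₁] [Group G₂]
  {H₁ : Subgroup G₁} {H₂ : Subgroup G₂}

section Irr

variable [TopologicalSpace G₁] [LocallyProfinite G₁] [TopologicalSpace G₂] [LocallyProfinite G₂]
  {X₁ X₂ : Type*} [AddCommGroup X₁] [Module ℂ X₁] [AddCommGroup X₂] [Module ℂ X₂]
  {τ₁ : Representation ℂ H₁ X₁} {τ₂ : Representation ℂ H₂ X₂}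

theorem isIrr_extTensor (h₁ : IsIrr τ₁) (ha : IsAdmissible τ₁) (h₂ : IsIrr τ₂)
    (hH₁ : IsClosed (H₁ : Set G₁)) (hH₂ : IsClosed (H₂ : Set G₂)) :
    IsIrr (extTensor τ₁ τ₂) := by
  have := locallyProfinite_of_isClosed hH₁
  have := locallyProfinite_of_isClosed hH₂
  exact ⟨isSmooth_extTensor h₁.1 h₂.1,
    isIrreducible_extTensor h₁.2 (hasScalarEnd_of_isAdmissible h₁.2 ha) h₂.2⟩

end Irr

variable [H₁.Normal] [H₂.Normal]

/-- The action of `G₁ × G₂` on `H₁ × H₂` by conjugation. -/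
def conjProd (H₁ : Subgroup G₁) (H₂ : Subgroup G₂) [H₁.Normal] [H₂.Normal] :
    G₁ × G₂ →* MulAut (H₁ × H₂) where
  toFun g := MulEquiv.prodCongr (MulAut.conjNormal g.1) (MulAut.conjNormal g.2)
  map_one' := by
    refine MulEquiv.ext fun n => Prod.ext ?_ ?_ <;> simp [MulEquiv.prodCongr]
  map_mul' a b := by
    refine MulEquiv.ext fun n => Prod.ext ?_ ?_ <;> simp [MulEquiv.prodCongr]

variable [TopologicalSpace G₁] [TopologicalSpace G₂] {γ : (G₁ ⧸ H₁) ≃ₜ* (G₂ ⧸ H₂)}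

theorem prodToGraph_conjProd (g : G₁ × G₂) (n : H₁ × H₂) :
    (prodToGraph γ (conjProd H₁ H₂ g n) : G₁ × G₂) = g * prodToGraph γ n * g⁻¹ :=
  Prod.ext (conjNormal_coe _ _) (conjNormal_coe _ _)

theorem continuous_prodToGraph : Continuous (prodToGraph γ) := by
  rw [continuous_induced_rng]
  change Continuous fun h : H₁ × H₂ => ((h.1 : G₁), (h.2 : G₂))
  fun_prop

theorem exists_mul_eq_fst (γ : (G₁ ⧸ H₁) ≃ₜ* (G₂ ⧸ H₂)) (g : G₁ × G₂) :
    ∃ h : graphSubgroup γ, ∃ s : G₁, (h : G₁ × G₂) * g = (s, 1) := by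
  obtain ⟨a, ha⟩ := QuotientGroup.mk_surjective (γ.symm (g.2 : G₂ ⧸ H₂))
  have h : γ (a : G₁ ⧸ H₁) = (g.2 : G₂ ⧸ H₂) := by rw [ha, ContinuousMulEquiv.apply_symm_apply]
  exact ⟨⟨(a, g.2)⁻¹, (graphSubgroup γ).inv_mem h⟩, a⁻¹ * g.1, by ext <;> simp⟩

theorem exists_mul_eq_snd (γ : (G₁ ⧸ H₁) ≃ₜ* (G₂ ⧸ H₂)) (g : G₁ × G₂) :
    ∃ h : graphSubgroup γ, ∃ s : G₂, (h : G₁ × G₂) * g = (1, s) := by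
  obtain ⟨a, ha⟩ := QuotientGroup.mk_surjective (γ (g.1 : G₁ ⧸ H₁))
  exact ⟨⟨(g.1, a)⁻¹, (graphSubgroup γ).inv_mem ha.symm⟩, a⁻¹ * g.2, by ext <;> simp⟩

variable {V : Type v} [AddCommGroup V] [Module ℂ V]
  {ρ : Representation ℂ (graphSubgroup γ) V}

theorem fiberRep_one : fiberRep ρ (prodToGraph γ) (conjProd H₁ H₂) 1
    = ρ.comp (prodToGraph γ) := by
  ext n x
  rw [fiberRep_apply, map_one, MulAut.one_apply]
  rfl

variable {X₁ X₂ : Type*} [AddCommGroup X₁] [Module ℂ X₁] [AddCommGroup X₂] [Module ℂ X₂]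
  {τ₁ : Representation ℂ H₁ X₁} {τ₂ : Representation ℂ H₂ X₂}

/-- A map from the fibre at `g` to `τ₁ ⊗ τ₂` is a map from the fibre at `1` to the twist. -/
theorem equivariantHom_twist_of_fiberRep {g : G₁ × G₂}
    (h : equivariantHom (fiberRep ρ (prodToGraph γ) (conjProd H₁ H₂) g) (extTensor τ₁ τ₂) ≠ ⊥) :
    equivariantHom (ρ.comp (prodToGraph γ)) (extTensor (twist τ₁ g.1⁻¹) (twist τ₂ g.2⁻¹)) ≠ ⊥ := by
  obtain ⟨T, hT, hT0⟩ := Submodule.exists_mem_ne_zero_of_ne_bot h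
  refine (Submodule.ne_bot_iff _).2 ⟨T, fun n x => ?_, hT0⟩
  have := hT (conjProd H₁ H₂ g⁻¹ n) x
  rw [fiberRep_apply, ← MulAut.mul_apply, ← map_mul, mul_inv_cancel, map_one,
    MulAut.one_apply] at this
  exact this

theorem isIrrQuotient_of_equivariantHom {G V W : Type*} [Group G] [TopologicalSpace G]
    [AddCommGroup V] [Module ℂ V] [AddCommGroup W] [Module ℂ W] {σ : Representation ℂ G V}
    {π : Representation ℂ G W} (h : IsIrr π) (h0 : equivariantHom σ π ≠ ⊥) :
    IsIrrQuotient σ π := by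
  obtain ⟨T, hT, hT0⟩ := Submodule.exists_mem_ne_zero_of_ne_bot h0
  exact ⟨h, ⟨T, fun g => LinearMap.ext (hT g)⟩,
    fun e => hT0 (congrArg Representation.IntertwiningMap.toLinearMap e)⟩

variable [LocallyProfinite G₁] [LocallyProfinite G₂]

/-- Given a small open subgroup `K₁` of `G₁`, there is a small compact open subgroup of `G₂` whose
image in `G₂ / H₂` is contained in that of `K₁`. -/
theorem exists_subgroup_image_le (γ : (G₁ ⧸ H₁) ≃ₜ* (G₂ ⧸ H₂)) {K₁ : Subgroup G₁}
    (h₁ : IsOpen (K₁ : Set G₁)) {O : Set G₂} (hO : O ∈ nhds (1 : G₂)) :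
    ∃ K₂ : Subgroup G₂, IsOpen (K₂ : Set G₂) ∧ IsCompact (K₂ : Set G₂) ∧ (K₂ : Set G₂) ⊆ O ∧
      ∀ k ∈ K₂, ∃ a ∈ K₁, γ (a : G₁ ⧸ H₁) = (k : G₂ ⧸ H₂) := by
  have ho : IsOpen ((QuotientGroup.mk : G₁ → G₁ ⧸ H₁) '' K₁) := QuotientGroup.isOpenMap_coe _ h₁
  have ho' : IsOpen ((fun k : G₂ => γ.symm (k : G₂ ⧸ H₂)) ⁻¹'
      ((QuotientGroup.mk : G₁ → G₁ ⧸ H₁) '' K₁)) :=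
    ho.preimage (γ.symm.continuous.comp QuotientGroup.continuous_mk)
  obtain ⟨K₂, o, c, h⟩ := LocallyProfinite.exists_compact_open_subgroup _
    (Filter.inter_mem hO (ho'.mem_nhds ⟨1, K₁.one_mem, by simp⟩))
  refine ⟨K₂, o, c, fun k hk => (h hk).1, fun k hk => ?_⟩
  obtain ⟨a, ha, e⟩ := (h hk).2
  exact ⟨a, ha, by rw [e]; exact γ.apply_symm_apply _⟩

end Graph


/-! ### Multiplicities of the constituents of the two factors -/

section TensorHom

variable {V₁ V₂ X₁ X₂ M : Type*} [AddCommGroup V₁] [Module ℂ V₁] [AddCommGroup V₂] [Module ℂ V₂]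
  [AddCommGroup X₁] [Module ℂ X₁] [AddCommGroup X₂] [Module ℂ X₂] [AddCommGroup M] [Module ℂ M]

/-- The bilinear map `(a, b) ↦ (a ⊗ b) ∘ F`. -/
def tensorComp (A : Submodule ℂ (V₁ →ₗ[ℂ] X₁)) (B : Submodule ℂ (V₂ →ₗ[ℂ] X₂))
    (F : M →ₗ[ℂ] V₁ ⊗[ℂ] V₂) : A →ₗ[ℂ] B →ₗ[ℂ] (M →ₗ[ℂ] X₁ ⊗[ℂ] X₂) :=
  LinearMap.mk₂ ℂ (fun a b => TensorProduct.map a.1 b.1 ∘ₗ F)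
    (fun a a' b => by
      rw [Submodule.coe_add, TensorProduct.map_add_left, LinearMap.add_comp])
    (fun z a b => by
      rw [Submodule.coe_smul, TensorProduct.map_smul_left, LinearMap.smul_comp])
    (fun a b b' => by
      rw [Submodule.coe_add, TensorProduct.map_add_right, LinearMap.add_comp])
    (fun z a b => by
      rw [Submodule.coe_smul, TensorProduct.map_smul_right, LinearMap.smul_comp])

variable {A : Submodule ℂ (V₁ →ₗ[ℂ] X₁)} {B : Submodule ℂ (V₂ →ₗ[ℂ] X₂)}
  {F : M →ₗ[ℂ] V₁ ⊗[ℂ] V₂}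

theorem tensorComp_apply (a : A) (b : B) (x : M) :
    tensorComp A B F a b x = TensorProduct.map a.1 b.1 (F x) := rfl

theorem map_comp_ne_zero (hF : Function.Surjective F) {a : V₁ →ₗ[ℂ] X₁} {b : V₂ →ₗ[ℂ] X₂}
    (ha : a ≠ 0) (hb : b ≠ 0) : TensorProduct.map a b ∘ₗ F ≠ 0 := by
  obtain ⟨x, hx⟩ := DFunLike.exists_ne ha
  obtain ⟨y, hy⟩ := DFunLike.exists_ne hb
  obtain ⟨m, hm⟩ := hF (x ⊗ₜ y)
  intro h
  have := LinearMap.congr_fun h m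
  rw [LinearMap.comp_apply, hm, TensorProduct.map_tmul] at this
  exact tmul_ne_zero hx hy this

/-- The functional `l₁ ⊗ l₂` on a tensor product. -/
def tensorFunctional (l₁ : X₁ →ₗ[ℂ] ℂ) (l₂ : X₂ →ₗ[ℂ] ℂ) : X₁ ⊗[ℂ] X₂ →ₗ[ℂ] ℂ :=
  (TensorProduct.lid ℂ ℂ).toLinearMap ∘ₗ TensorProduct.map l₁ l₂

theorem tensorFunctional_tmul (l₁ : X₁ →ₗ[ℂ] ℂ) (l₂ : X₂ →ₗ[ℂ] ℂ) (x : X₁) (y : X₂) :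
    tensorFunctional l₁ l₂ (x ⊗ₜ y) = l₁ x * l₂ y := by
  simp [tensorFunctional]

theorem tensorFunctional_ne_zero {l₁ : X₁ →ₗ[ℂ] ℂ} {l₂ : X₂ →ₗ[ℂ] ℂ} (h₁ : l₁ ≠ 0) (h₂ : l₂ ≠ 0) :
    tensorFunctional l₁ l₂ ≠ 0 := by
  obtain ⟨x, hx⟩ := DFunLike.exists_ne h₁
  obtain ⟨y, hy⟩ := DFunLike.exists_ne h₂
  intro h
  have := LinearMap.congr_fun h (x ⊗ₜ y)
  rw [tensorFunctional_tmul] at this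
  exact mul_ne_zero hx hy this

theorem tensorFunctional_map (l₁ : X₁ →ₗ[ℂ] ℂ) (l₂ : X₂ →ₗ[ℂ] ℂ) (a a' : V₁ →ₗ[ℂ] X₁)
    (b b' : V₂ →ₗ[ℂ] X₂) (ha : ∀ x, l₁ (a x) = l₁ (a' x)) (hb : ∀ y, l₂ (b y) = l₂ (b' y))
    (z : V₁ ⊗[ℂ] V₂) :
    tensorFunctional l₁ l₂ (TensorProduct.map a b z)
      = tensorFunctional l₁ l₂ (TensorProduct.map a' b' z) := by
  have : tensorFunctional l₁ l₂ ∘ₗ TensorProduct.map a b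
      = tensorFunctional l₁ l₂ ∘ₗ TensorProduct.map a' b' :=
    TensorProduct.ext' fun x y => by
      rw [LinearMap.comp_apply, LinearMap.comp_apply, TensorProduct.map_tmul,
        TensorProduct.map_tmul, tensorFunctional_tmul, tensorFunctional_tmul, ha, hb]
  exact LinearMap.congr_fun this z

theorem map_map {U₁ U₂ : Type*} [AddCommGroup U₁] [Module ℂ U₁] [AddCommGroup U₂] [Module ℂ U₂]
    (a : V₁ →ₗ[ℂ] X₁) (b : V₂ →ₗ[ℂ] X₂) (c : U₁ →ₗ[ℂ] V₁) (d : U₂ →ₗ[ℂ] V₂)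
    (z : U₁ ⊗[ℂ] U₂) : TensorProduct.map a b (TensorProduct.map c d z)
      = TensorProduct.map (a ∘ₗ c) (b ∘ₗ d) z := by
  rw [TensorProduct.map_comp]; rfl

end TensorHom

section Translate

/-- If `τ` is isomorphic to its twist by `s`, then `Hom_H(π, τ)` is stable under translation by `s`
up to an automorphism of the space of `τ`. -/
theorem exists_translate {G : Type*} [Group G] {H : Subgroup G} [H.Normal]
    {X V : Type*} [AddCommGroup X] [Module ℂ X] [AddCommGroup V] [Module ℂ V]
    {τ : Representation ℂ H X} (π : Representation ℂ G V) {s : G}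
    (e : Nonempty (Representation.Equiv τ (twist τ s))) :
    ∃ T : X →ₗ[ℂ] X, ∀ a ∈ equivariantHom (π.comp H.subtype) τ,
      ∃ a' ∈ equivariantHom (π.comp H.subtype) τ, a ∘ₗ π s⁻¹ = T ∘ₗ a' := by
  obtain ⟨e⟩ := e
  refine ⟨e.toLinearEquiv.symm.toLinearMap, fun a ha =>
    ⟨e.toLinearEquiv.toLinearMap ∘ₗ a ∘ₗ π s⁻¹, fun h x => ?_,
      LinearMap.ext fun x => (e.toLinearEquiv.symm_apply_apply _).symm⟩⟩
  have h1 := comp_mem_equivariantHom_twist ha s h x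
  have h2 := Representation.IntertwiningMap.isIntertwining _ _ e.toIntertwiningMap
    (MulAut.conjNormal s⁻¹ h) (a (π s⁻¹ x))
  rw [twist_apply, ← MulAut.mul_apply, ← map_mul, mul_inv_cancel, map_one,
    MulAut.one_apply] at h2
  rw [LinearMap.comp_apply, h1]
  exact h2

end Translate

section Multiplicity

variable {G₁ : Type u₁} {G₂ : Type u₂} [Group G₁] [TopologicalSpace G₁] [LocallyProfinite G₁]
  [Group G₂] [TopologicalSpace G₂] [LocallyProfinite G₂]
  {H₁ : Subgroup G₁} {H₂ : Subgroup G₂} [H₁.Normal] [H₂.Normal]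
  (hH₁ : IsClosed (H₁ : Set G₁)) (hH₂ : IsClosed (H₂ : Set G₂))
  {γ : (G₁ ⧸ H₁) ≃ₜ* (G₂ ⧸ H₂)}
  (hA₁ : AllIrrAdmissible.{u₁, w} H₁) (hA₂ : AllIrrAdmissible.{u₂, w} H₂)
  {V : Type v} [AddCommGroup V] [Module ℂ V] {ρ : Representation ℂ (graphSubgroup γ) V}
  (hθ : IsThetaRep.{u₁, u₂, v, w} (ρ.comp (prodToGraph γ)))
  {X₁ X₂ : Type w} [AddCommGroup X₁] [Module ℂ X₁] [AddCommGroup X₂] [Module ℂ X₂]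
  {τ₁ : Representation ℂ H₁ X₁} {τ₂ : Representation ℂ H₂ X₂} (h₁ : IsIrr τ₁) (h₂ : IsIrr τ₂)
  (hq : equivariantHom (ρ.comp (prodToGraph γ)) (extTensor τ₁ τ₂) ≠ ⊥)

/-- Homomorphisms `π₁ → τ₁` and `π₂ → τ₂` turn a `G₁ × G₂`-map `cInd ρ → π₁ ⊗ π₂` into an
`H₁ × H₂`-map `cInd ρ → τ₁ ⊗ τ₂`. -/
theorem map_comp_mem_equivariantHom {V₁ V₂ : Type*} [AddCommGroup V₁] [Module ℂ V₁]
    [AddCommGroup V₂] [Module ℂ V₂] {π₁ : Representation ℂ G₁ V₁} {π₂ : Representation ℂ G₂ V₂}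
    {F : cIndSpace ρ →ₗ[ℂ] V₁ ⊗[ℂ] V₂} (hF : F ∈ equivariantHom (cInd ρ) (extTensor π₁ π₂))
    {a : V₁ →ₗ[ℂ] X₁} (ha : a ∈ equivariantHom (π₁.comp H₁.subtype) τ₁)
    {b : V₂ →ₗ[ℂ] X₂} (hb : b ∈ equivariantHom (π₂.comp H₂.subtype) τ₂) :
    TensorProduct.map a b ∘ₗ F
      ∈ equivariantHom (cIndRestrict ρ (prodToGraph γ)) (extTensor τ₁ τ₂) := by
  intro n f
  change TensorProduct.map a b (F (cInd ρ (n.1, n.2) f)) = _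
  rw [hF, extTensor_apply, map_map]
  change _ = TensorProduct.map (τ₁ n.1) (τ₂ n.2) (TensorProduct.map a b (F f))
  have e₁ : a ∘ₗ π₁ n.1 = τ₁ n.1 ∘ₗ a := LinearMap.ext (ha n.1)
  have e₂ : b ∘ₗ π₂ n.2 = τ₂ n.2 ∘ₗ b := LinearMap.ext (hb n.2)
  rw [map_map, e₁, e₂]

include hH₁ hH₂ hA₁ hθ h₁ h₂ hq

/-- If the fibre at `(s, 1)` has a map to `τ₁ ⊗ τ₂`, then `τ₁` and its twist by `s` are both partners
of `τ₂` in the quotients of `ρ`, so that they are isomorphic by the theta property. -/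
theorem nonempty_equiv_twist_fst {s : G₁}
    (hs : equivariantHom (fiberRep ρ (prodToGraph γ) (conjProd H₁ H₂) (s, 1))
      (extTensor τ₁ τ₂) ≠ ⊥) : Nonempty (Representation.Equiv τ₁ (twist τ₁ s)) := by
  have hs' := equivariantHom_twist_of_fiberRep hs
  rw [inv_one, twist_one] at hs'
  have ht := isIrr_twist h₁ s⁻¹
  have := nontrivial_of_isIrreducible h₂.2
  have e : Nonempty (Representation.Equiv (extTensor (twist τ₁ s⁻¹) τ₂) (extTensor τ₁ τ₂)) :=
    hθ.snd_injective _ _ _ _ _ τ₂ _ _ ht h₂ h₁ h₂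
      (isIrrQuotient_of_equivariantHom (isIrr_extTensor ht (hA₁ _ _ ht) h₂ hH₁ hH₂) hs')
      (isIrrQuotient_of_equivariantHom (isIrr_extTensor h₁ (hA₁ _ _ h₁) h₂ hH₁ hH₂) hq)
      ⟨Representation.Equiv.refl _⟩
  exact nonempty_equiv_twist (nonempty_equiv_fst ht.2 h₁.2 e)

/-- If the fibre at `(1, s)` has a map to `τ₁ ⊗ τ₂`, then `τ₂` and its twist by `s` are both partners
of `τ₁` in the quotients of `ρ`, so that they are isomorphic by the theta property. -/
theorem nonempty_equiv_twist_snd {s : G₂}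
    (hs : equivariantHom (fiberRep ρ (prodToGraph γ) (conjProd H₁ H₂) (1, s))
      (extTensor τ₁ τ₂) ≠ ⊥) : Nonempty (Representation.Equiv τ₂ (twist τ₂ s)) := by
  have hs' := equivariantHom_twist_of_fiberRep hs
  rw [inv_one, twist_one] at hs'
  have ht := isIrr_twist h₂ s⁻¹
  have := nontrivial_of_isIrreducible h₁.2
  have e : Nonempty (Representation.Equiv (extTensor τ₁ (twist τ₂ s⁻¹)) (extTensor τ₁ τ₂)) :=
    hθ.fst_injective _ _ _ _ τ₁ _ _ _ h₁ ht h₁ h₂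
      (isIrrQuotient_of_equivariantHom (isIrr_extTensor h₁ (hA₁ _ _ h₁) ht hH₁ hH₂) hs')
      (isIrrQuotient_of_equivariantHom (isIrr_extTensor h₁ (hA₁ _ _ h₁) h₂ hH₁ hH₂) hq)
      ⟨Representation.Equiv.refl _⟩
  exact nonempty_equiv_twist (nonempty_equiv_snd ht.2 h₂.2 e)

variable (hρ : IsSmooth ρ) {V₁ V₂ : Type w} [AddCommGroup V₁] [Module ℂ V₁] [AddCommGroup V₂]
  [Module ℂ V₂] {π₁ : Representation ℂ G₁ V₁} {π₂ : Representation ℂ G₂ V₂}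
  {F : cIndSpace ρ →ₗ[ℂ] V₁ ⊗[ℂ] V₂} (hF : F ∈ equivariantHom (cInd ρ) (extTensor π₁ π₂))
  (hFs : Function.Surjective F)

include hA₂ hρ hF hFs

/-- If `π₁ ⊗ π₂` is a quotient of `cInd ρ`, where `π₁` is irreducible, then the multiplicity of
`τ₂` in `π₂` is at most that of `τ₁` in `π₁`. -/
theorem finrank_snd_le_finrank_fst (hc : CompactSpace (G₁ ⧸ H₁)) (hπ₁ : IsIrr π₁)
    (hne : equivariantHom (π₁.comp H₁.subtype) τ₁ ≠ ⊥) :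
    Module.Finite ℂ (equivariantHom (π₂.comp H₂.subtype) τ₂) ∧
      Module.finrank ℂ (equivariantHom (π₂.comp H₂.subtype) τ₂)
        ≤ Module.finrank ℂ (equivariantHom (π₁.comp H₁.subtype) τ₁) := by
  have := locallyProfinite_of_isClosed hH₁
  have := locallyProfinite_of_isClosed hH₂
  have ha₁ := hA₁ _ _ h₁
  have ha₂ := hA₂ _ _ h₂
  have hτ := isIrr_extTensor h₁ ha₁ h₂ hH₁ hH₂
  have := nontrivial_of_isIrreducible h₁.2
  have := nontrivial_of_isIrreducible h₂.2
  obtain ⟨L₁, o₁, -, l₁, hl₁, i₁⟩ := h₁.1.exists_functional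
  obtain ⟨L₂, o₂, -, l₂, hl₂, i₂⟩ := h₂.1.exists_functional
  have hfin := finite_equivariantHom hH₁ hc hπ₁ ha₁
  have hstab := fun s => nonempty_equiv_twist_fst (s := s) hH₁ hH₂ hA₁ hθ h₁ h₂ hq
  refine finrank_le_finrank_of_bilinear (c := conjProd H₁ H₂) (ι := prodToGraph γ)
    (isOpen_prod o₁ o₂) (l := tensorFunctional l₁ l₂) (τ := extTensor τ₁ τ₂) (fun k hk z => ?_)
    (tensorFunctional_ne_zero hl₁ hl₂) hρ continuous_prodToGraph prodToGraph_conjProd hτ.2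
    (isAdmissible_extTensor ha₁ ha₂) (fun T hT hT0 T' hT' => ?_)
    (tensorComp _ _ F) (fun a b => map_comp_mem_equivariantHom hF a.2 b.2)
    (fun b hb => ?_) (fun g hg => ?_) (fun O hO => ?_)
  · have := tensorFunctional_map l₁ l₂ (τ₁ k.1) LinearMap.id (τ₂ k.2) LinearMap.id
      (i₁ _ hk.1) (i₂ _ hk.2) z
    rwa [TensorProduct.map_id] at this
  · rw [fiberRep_one] at hT hT'
    exact exists_smul_of_rank_le_one (hθ.multiplicity_le_one _ _ hτ) hT hT0 hT'
  · obtain ⟨a, ha, ha0⟩ := Submodule.exists_mem_ne_zero_of_ne_bot hne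
    by_contra hb0
    exact map_comp_ne_zero hFs ha0 (fun h => hb0 (Subtype.ext h)) (hb ⟨a, ha⟩)
  -- Every fibre with a map to `τ₁ ⊗ τ₂` is a translate of the one at `1` by some `(s, 1)` for which
  -- `τ₁` is isomorphic to its twist by `s`.
  · obtain ⟨h, s, hs⟩ := exists_mul_eq_fst γ g
    obtain ⟨T, hT⟩ := exists_translate π₁ (hstab s (by
      rw [← hs]
      refine equivariantHom_fiberRep_mul prodToGraph_conjProd h⁻¹ _ ?_
      rwa [Subgroup.coe_inv, inv_mul_cancel_left]))
    refine ⟨h, TensorProduct.map T LinearMap.id, fun a => ?_⟩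
    obtain ⟨a', ha', e⟩ := hT a.1 a.2
    refine ⟨⟨a', ha'⟩, fun b f => ?_⟩
    rw [hs, tensorComp_apply, tensorComp_apply, hF, extTensor_apply, map_map]
    change TensorProduct.map (a.1 ∘ₗ π₁ s⁻¹) (b.1 ∘ₗ π₂ (1⁻¹)) _ = _
    rw [e, inv_one, map_one, map_map]
    rfl
  · obtain ⟨O₁, hO₁, O₂, hO₂, hO⟩ := mem_nhds_prod_iff.1 hO
    obtain ⟨K₁, oK₁, cK₁, hK₁, hinv⟩ := exists_subgroup_functional_invariant hH₁ hπ₁.1 h₁.2 ha₁ hfin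
      o₁ i₁ hl₁ hO₁
    obtain ⟨K₂, oK₂, cK₂, hK₂, him⟩ := exists_subgroup_image_le γ oK₁ hO₂
    refine ⟨K₁.prod K₂, isOpen_prod oK₁ oK₂, isCompact_prod cK₁ cK₂,
      fun k hk => hO ⟨hK₁ hk.1, hK₂ hk.2⟩, fun k hk hne => ?_⟩
    -- By the choice of `K₂` an element of `Γ ∩ (K₁ × K₂)` moves `k` into `K₁ × 1`.
    obtain ⟨a₁, ha₁K, e⟩ := him k.2 hk.2
    let h : graphSubgroup γ := ⟨(a₁, k.2)⁻¹, (graphSubgroup γ).inv_mem e⟩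
    have hhk : (h : G₁ × G₂) * k = (a₁⁻¹ * k.1, 1) := Prod.ext rfl (inv_mul_cancel _)
    have hsK : a₁⁻¹ * k.1 ∈ K₁ := K₁.mul_mem (K₁.inv_mem ha₁K) hk.1
    have hs := hstab (a₁⁻¹ * k.1) (by
      rw [← hhk]
      refine equivariantHom_fiberRep_mul prodToGraph_conjProd h⁻¹ _ ?_
      rwa [Subgroup.coe_inv, inv_mul_cancel_left])
    refine ⟨h, ?_, fun a b f => ?_⟩
    · rw [hhk]
      exact ⟨hsK, K₂.one_mem⟩
    · rw [hhk, tensorComp_apply, tensorComp_apply, hF, extTensor_apply, map_map]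
      refine tensorFunctional_map l₁ l₂ _ _ _ _ (fun x => hinv _ hsK hs a.1 a.2 x) (fun y => ?_) _
      rw [map_one]
      rfl

/-- If `π₁ ⊗ π₂` is a quotient of `cInd ρ`, where `π₂` is irreducible, then the multiplicity of
`τ₁` in `π₁` is at most that of `τ₂` in `π₂`. -/
theorem finrank_fst_le_finrank_snd (hc : CompactSpace (G₂ ⧸ H₂)) (hπ₂ : IsIrr π₂)
    (hne : equivariantHom (π₂.comp H₂.subtype) τ₂ ≠ ⊥) :
    Module.Finite ℂ (equivariantHom (π₁.comp H₁.subtype) τ₁) ∧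
      Module.finrank ℂ (equivariantHom (π₁.comp H₁.subtype) τ₁)
        ≤ Module.finrank ℂ (equivariantHom (π₂.comp H₂.subtype) τ₂) := by
  have := locallyProfinite_of_isClosed hH₁
  have := locallyProfinite_of_isClosed hH₂
  have ha₁ := hA₁ _ _ h₁
  have ha₂ := hA₂ _ _ h₂
  have hτ := isIrr_extTensor h₁ ha₁ h₂ hH₁ hH₂
  have := nontrivial_of_isIrreducible h₁.2
  have := nontrivial_of_isIrreducible h₂.2
  obtain ⟨L₁, o₁, -, l₁, hl₁, i₁⟩ := h₁.1.exists_functional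
  obtain ⟨L₂, o₂, -, l₂, hl₂, i₂⟩ := h₂.1.exists_functional
  have hfin := finite_equivariantHom hH₂ hc hπ₂ ha₂
  have hstab := fun s => nonempty_equiv_twist_snd (s := s) hH₁ hH₂ hA₁ hθ h₁ h₂ hq
  refine finrank_le_finrank_of_bilinear (c := conjProd H₁ H₂) (ι := prodToGraph γ)
    (isOpen_prod o₁ o₂) (l := tensorFunctional l₁ l₂) (τ := extTensor τ₁ τ₂) (fun k hk z => ?_)
    (tensorFunctional_ne_zero hl₁ hl₂) hρ continuous_prodToGraph prodToGraph_conjProd hτ.2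
    (isAdmissible_extTensor ha₁ ha₂) (fun T hT hT0 T' hT' => ?_)
    (tensorComp _ _ F).flip (fun b a => map_comp_mem_equivariantHom hF a.2 b.2)
    (fun a ha => ?_) (fun g hg => ?_) (fun O hO => ?_)
  · have := tensorFunctional_map l₁ l₂ (τ₁ k.1) LinearMap.id (τ₂ k.2) LinearMap.id
      (i₁ _ hk.1) (i₂ _ hk.2) z
    rwa [TensorProduct.map_id] at this
  · rw [fiberRep_one] at hT hT'
    exact exists_smul_of_rank_le_one (hθ.multiplicity_le_one _ _ hτ) hT hT0 hT'
  · obtain ⟨b, hb, hb0⟩ := Submodule.exists_mem_ne_zero_of_ne_bot hne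
    by_contra ha0
    exact map_comp_ne_zero hFs (fun h => ha0 (Subtype.ext h)) hb0 (ha ⟨b, hb⟩)
  -- Every fibre with a map to `τ₁ ⊗ τ₂` is a translate of the one at `1` by some `(1, s)` for which
  -- `τ₂` is isomorphic to its twist by `s`.
  · obtain ⟨h, s, hs⟩ := exists_mul_eq_snd γ g
    obtain ⟨T, hT⟩ := exists_translate π₂ (hstab s (by
      rw [← hs]
      refine equivariantHom_fiberRep_mul prodToGraph_conjProd h⁻¹ _ ?_
      rwa [Subgroup.coe_inv, inv_mul_cancel_left]))
    refine ⟨h, TensorProduct.map LinearMap.id T, fun b => ?_⟩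
    obtain ⟨b', hb', e⟩ := hT b.1 b.2
    refine ⟨⟨b', hb'⟩, fun a f => ?_⟩
    rw [hs, LinearMap.flip_apply, LinearMap.flip_apply, tensorComp_apply, tensorComp_apply, hF,
      extTensor_apply, map_map]
    change TensorProduct.map (a.1 ∘ₗ π₁ (1⁻¹)) (b.1 ∘ₗ π₂ s⁻¹) _ = _
    rw [e, inv_one, map_one, map_map]
    rfl
  · obtain ⟨O₁, hO₁, O₂, hO₂, hO⟩ := mem_nhds_prod_iff.1 hO
    obtain ⟨K₂, oK₂, cK₂, hK₂, hinv⟩ := exists_subgroup_functional_invariant hH₂ hπ₂.1 h₂.2 ha₂ hfin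
      o₂ i₂ hl₂ hO₂
    obtain ⟨K₁, oK₁, cK₁, hK₁, him⟩ := exists_subgroup_image_le γ.symm oK₂ hO₁
    refine ⟨K₁.prod K₂, isOpen_prod oK₁ oK₂, isCompact_prod cK₁ cK₂,
      fun k hk => hO ⟨hK₁ hk.1, hK₂ hk.2⟩, fun k hk hne => ?_⟩
    -- By the choice of `K₁` an element of `Γ ∩ (K₁ × K₂)` moves `k` into `1 × K₂`.
    obtain ⟨a₂, ha₂K, e⟩ := him k.1 hk.1
    let h : graphSubgroup γ := ⟨(k.1, a₂)⁻¹, (graphSubgroup γ).inv_mem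
      (show γ (k.1 : G₁ ⧸ H₁) = (a₂ : G₂ ⧸ H₂) by rw [← e, ContinuousMulEquiv.apply_symm_apply])⟩
    have hhk : (h : G₁ × G₂) * k = (1, a₂⁻¹ * k.2) := Prod.ext (inv_mul_cancel _) rfl
    have hsK : a₂⁻¹ * k.2 ∈ K₂ := K₂.mul_mem (K₂.inv_mem ha₂K) hk.2
    have hs := hstab (a₂⁻¹ * k.2) (by
      rw [← hhk]
      refine equivariantHom_fiberRep_mul prodToGraph_conjProd h⁻¹ _ ?_
      rwa [Subgroup.coe_inv, inv_mul_cancel_left])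
    refine ⟨h, ?_, fun b a f => ?_⟩
    · rw [hhk]
      exact ⟨K₁.one_mem, hsK⟩
    · rw [hhk, LinearMap.flip_apply, tensorComp_apply, tensorComp_apply, hF, extTensor_apply,
        map_map]
      refine tensorFunctional_map l₁ l₂ _ _ _ _ (fun x => ?_) (fun y => hinv _ hsK hs b.1 b.2 y) _
      rw [map_one]
      rfl

end Multiplicity


/-! ### Uniqueness of irreducible quotients with a given factor -/

section Generic

variable {G : Type*} [Group G] {M V W : Type*} [AddCommGroup M] [Module ℂ M] [AddCommGroup V]
  [Module ℂ V] [AddCommGroup W] [Module ℂ W] {σ : Representation ℂ G M} {π : Representation ℂ G V}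
  {π' : Representation ℂ G W}

theorem exists_factor {F : M →ₗ[ℂ] V} (hF : F ∈ equivariantHom σ π) (hs : Function.Surjective F)
    {F' : M →ₗ[ℂ] W} (hF' : F' ∈ equivariantHom σ π') (h : ∀ x, F x = 0 → F' x = 0) :
    ∃ T ∈ equivariantHom π π', F' = T ∘ₗ F := by
  obtain ⟨S, hS⟩ := F.exists_rightInverse_of_surjective (LinearMap.range_eq_top.2 hs)
  have e : F' = (F' ∘ₗ S) ∘ₗ F := LinearMap.ext fun x => by
    have h1 : F (x - S (F x)) = 0 := by
      rw [map_sub, ← LinearMap.comp_apply F S, hS, LinearMap.id_apply, sub_self]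
    have h2 := h _ h1
    rwa [map_sub, sub_eq_zero] at h2
  refine ⟨F' ∘ₗ S, fun g y => ?_, e⟩
  obtain ⟨x, rfl⟩ := hs y
  have hx : ∀ x, (F' ∘ₗ S) (F x) = F' x := fun x => (LinearMap.congr_fun e x).symm
  rw [← hF, hx, hx, hF']

/-- Two quotient maps, the second one to an irreducible representation and not vanishing on the
kernel of the first one, are jointly surjective. -/
theorem surjective_prod {F : M →ₗ[ℂ] V} (hF : F ∈ equivariantHom σ π)
    (hs : Function.Surjective F) {F' : M →ₗ[ℂ] W} (hF' : F' ∈ equivariantHom σ π')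
    (h : π'.IsIrreducible) {x : M} (hx : F x = 0) (hx' : F' x ≠ 0) :
    Function.Surjective (F.prod F') := by
  have htop : (LinearMap.ker F).map F' = ⊤ := by
    refine ((isIrreducible_iff.1 h).2 _ ?_).resolve_left fun hbot => hx' ?_
    · rintro g _ ⟨y, hy, rfl⟩
      refine ⟨σ g y, ?_, hF' g y⟩
      rw [SetLike.mem_coe, LinearMap.mem_ker] at hy ⊢
      rw [hF, hy, map_zero]
    · have : F' x ∈ (LinearMap.ker F).map F' := ⟨x, hx, rfl⟩
      rwa [hbot, Submodule.mem_bot] at this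
  rintro ⟨y, z⟩
  obtain ⟨a, rfl⟩ := hs y
  have : z - F' a ∈ (LinearMap.ker F).map F' := htop ▸ Submodule.mem_top
  obtain ⟨b, hb, e⟩ := this
  refine ⟨a + b, Prod.ext ?_ ?_⟩
  · change F (a + b) = F a
    rw [map_add, show F b = 0 from hb, add_zero]
  · change F' (a + b) = z
    rw [map_add, e, add_sub_cancel]

variable {H : Subgroup G} {X : Type*} [AddCommGroup X] [Module ℂ X] {τ : Representation ℂ H X}

theorem finrank_add_le_finrank_prod
    [Module.Finite ℂ (equivariantHom ((π.prod π').comp H.subtype) τ)]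
    [Module.Finite ℂ (equivariantHom (π.comp H.subtype) τ)]
    [Module.Finite ℂ (equivariantHom (π'.comp H.subtype) τ)] :
    Module.finrank ℂ (equivariantHom (π.comp H.subtype) τ)
        + Module.finrank ℂ (equivariantHom (π'.comp H.subtype) τ)
      ≤ Module.finrank ℂ (equivariantHom ((π.prod π').comp H.subtype) τ) := by
  rw [← Module.finrank_prod]
  let C : (equivariantHom (π.comp H.subtype) τ × equivariantHom (π'.comp H.subtype) τ) →ₗ[ℂ]
      equivariantHom ((π.prod π').comp H.subtype) τ :=
    { toFun := fun b => ⟨b.1.1.coprod b.2.1, fun h x => by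
        change b.1.1 (π h x.1) + b.2.1 (π' h x.2) = τ h (b.1.1 x.1 + b.2.1 x.2)
        rw [map_add]
        exact congrArg₂ _ (b.1.2 h x.1) (b.2.2 h x.2)⟩
      map_add' := fun b b' => by
        ext x <;> simp
      map_smul' := fun z b => by
        ext x <;> simp }
  refine LinearMap.finrank_le_finrank_of_injective (f := C) ?_
  rw [← LinearMap.ker_eq_bot, LinearMap.ker_eq_bot']
  rintro ⟨b, b'⟩ hb
  have hb : b.1.coprod b'.1 = 0 := congrArg Subtype.val hb
  refine Prod.ext (Subtype.ext (LinearMap.ext fun x => ?_))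
    (Subtype.ext (LinearMap.ext fun x => ?_))
  · simpa using LinearMap.congr_fun hb (x, 0)
  · simpa using LinearMap.congr_fun hb (0, x)

theorem finrank_pos_of_ne_bot {S : Submodule ℂ V} [Module.Finite ℂ S] (h : S ≠ ⊥) :
    0 < Module.finrank ℂ S := by
  have := Submodule.nontrivial_iff_ne_bot.2 h
  exact Module.finrank_pos

end Generic

section TensorProd

variable {G₁ G₂ : Type*} [Group G₁] [Group G₂] {V₁ V₂ V₁' V₂' : Type*} [AddCommGroup V₁]
  [Module ℂ V₁] [AddCommGroup V₂] [Module ℂ V₂] [AddCommGroup V₁'] [Module ℂ V₁']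
  [AddCommGroup V₂'] [Module ℂ V₂'] {π₁ : Representation ℂ G₁ V₁} {π₂ : Representation ℂ G₂ V₂}
  {π₁' : Representation ℂ G₁ V₁'} {π₂' : Representation ℂ G₂ V₂'}
  {M : Type*} [AddCommGroup M] [Module ℂ M] {σ : Representation ℂ (G₁ × G₂) M}

theorem prodRight_symm_mem {F : M →ₗ[ℂ] V₁ ⊗[ℂ] V₂} (hF : F ∈ equivariantHom σ (extTensor π₁ π₂))
    {F' : M →ₗ[ℂ] V₁ ⊗[ℂ] V₂'} (hF' : F' ∈ equivariantHom σ (extTensor π₁ π₂')) :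
    (TensorProduct.prodRight ℂ ℂ V₁ V₂ V₂').symm.toLinearMap ∘ₗ F.prod F'
      ∈ equivariantHom σ (extTensor π₁ (π₂.prod π₂')) := by
  intro g x
  have key : ∀ z, TensorProduct.prodRight ℂ ℂ V₁ V₂ V₂' (extTensor π₁ (π₂.prod π₂') g z)
      = (extTensor π₁ π₂ g (TensorProduct.prodRight ℂ ℂ V₁ V₂ V₂' z).1,
        extTensor π₁ π₂' g (TensorProduct.prodRight ℂ ℂ V₁ V₂ V₂' z).2) := by
    intro z
    induction z using TensorProduct.induction_on with
    | zero => simp only [map_zero]; rfl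
    | add a b ha hb => simp only [map_add, ha, hb, Prod.fst_add, Prod.snd_add, Prod.mk_add_mk]
    | tmul y z => rfl
  rw [LinearMap.comp_apply, LinearEquiv.coe_coe, LinearEquiv.symm_apply_eq, key]
  simp [hF g x, hF' g x]

theorem prodLeft_symm_mem {F : M →ₗ[ℂ] V₁ ⊗[ℂ] V₂} (hF : F ∈ equivariantHom σ (extTensor π₁ π₂))
    {F' : M →ₗ[ℂ] V₁' ⊗[ℂ] V₂} (hF' : F' ∈ equivariantHom σ (extTensor π₁' π₂)) :
    (TensorProduct.prodLeft ℂ ℂ V₁ V₁' V₂).symm.toLinearMap ∘ₗ F.prod F'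
      ∈ equivariantHom σ (extTensor (π₁.prod π₁') π₂) := by
  intro g x
  have key : ∀ z, TensorProduct.prodLeft ℂ ℂ V₁ V₁' V₂ (extTensor (π₁.prod π₁') π₂ g z)
      = (extTensor π₁ π₂ g (TensorProduct.prodLeft ℂ ℂ V₁ V₁' V₂ z).1,
        extTensor π₁' π₂ g (TensorProduct.prodLeft ℂ ℂ V₁ V₁' V₂ z).2) := by
    intro z
    induction z using TensorProduct.induction_on with
    | zero => simp only [map_zero]; rfl
    | add a b ha hb => simp only [map_add, ha, hb, Prod.fst_add, Prod.snd_add, Prod.mk_add_mk]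
    | tmul y z => rfl
  rw [LinearMap.comp_apply, LinearEquiv.coe_coe, LinearEquiv.symm_apply_eq, key]
  simp [hF g x, hF' g x]

end TensorProd

section Uniqueness

variable {G₁ : Type u₁} {G₂ : Type u₂} [Group G₁] [TopologicalSpace G₁] [LocallyProfinite G₁]
  [Group G₂] [TopologicalSpace G₂] [LocallyProfinite G₂]
  {H₁ : Subgroup G₁} {H₂ : Subgroup G₂} [H₁.Normal] [H₂.Normal]
  (hH₁ : IsClosed (H₁ : Set G₁)) (hH₂ : IsClosed (H₂ : Set G₂))
  {γ : (G₁ ⧸ H₁) ≃ₜ* (G₂ ⧸ H₂)} (hc₁ : CompactSpace (G₁ ⧸ H₁)) (hc₂ : CompactSpace (G₂ ⧸ H₂))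
  (hA₁ : AllIrrAdmissible.{u₁, w} H₁) (hA₂ : AllIrrAdmissible.{u₂, w} H₂)
  {V : Type v} [AddCommGroup V] [Module ℂ V] {ρ : Representation ℂ (graphSubgroup γ) V}
  (hρ : IsSmooth ρ)

include hH₁ hH₂ hA₁ hA₂ hρ

section Constituents

variable {V₁ V₂ : Type w} [AddCommGroup V₁] [Module ℂ V₁] [AddCommGroup V₂]
  [Module ℂ V₂] {π₁ : Representation ℂ G₁ V₁} {π₂ : Representation ℂ G₂ V₂}
  {F : cIndSpace ρ →ₗ[ℂ] V₁ ⊗[ℂ] V₂} (hF : F ∈ equivariantHom (cInd ρ) (extTensor π₁ π₂))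
  (hFs : Function.Surjective F)

include hF hFs

include hc₂ in
/-- Every irreducible quotient `τ₁` of `π₁` over `H₁` has a partner `τ₂`, a quotient of `π₂` over
`H₂`, such that `τ₁ ⊗ τ₂` is a quotient of `ρ`. -/
theorem exists_partner_snd (hπ₂ : IsIrr π₂) {X₁ : Type w} [AddCommGroup X₁] [Module ℂ X₁]
    {τ₁ : Representation ℂ H₁ X₁} (h₁ : IsIrr τ₁)
    (hne : equivariantHom (π₁.comp H₁.subtype) τ₁ ≠ ⊥) :
    ∃ (X₂ : Type w) (_ : AddCommGroup X₂) (_ : Module ℂ X₂) (τ₂ : Representation ℂ H₂ X₂),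
      IsIrr τ₂ ∧ equivariantHom (π₂.comp H₂.subtype) τ₂ ≠ ⊥ ∧
        equivariantHom (ρ.comp (prodToGraph γ)) (extTensor τ₁ τ₂) ≠ ⊥ := by
  have := locallyProfinite_of_isClosed hH₁
  have := locallyProfinite_of_isClosed hH₂
  obtain ⟨X₂, _, _, τ₂, h₂, b, hb, hb0⟩ := exists_irreducible_quotient hc₂ hπ₂
  obtain ⟨a, ha, ha0⟩ := Submodule.exists_mem_ne_zero_of_ne_bot hne
  obtain ⟨g, hg⟩ := exists_fiberRep_hom (c := conjProd H₁ H₂) hρ continuous_prodToGraph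
    prodToGraph_conjProd (isIrr_extTensor h₁ (hA₁ _ _ h₁) h₂ hH₁ hH₂).2
    (isAdmissible_extTensor (hA₁ _ _ h₁) (hA₂ _ _ h₂)) (map_comp_mem_equivariantHom hF ha hb)
    (map_comp_ne_zero hFs ha0 hb0)
  obtain ⟨h, s, hs⟩ := exists_mul_eq_snd γ g
  have hg' : equivariantHom (fiberRep ρ (prodToGraph γ) (conjProd H₁ H₂) (1, s))
      (extTensor τ₁ τ₂) ≠ ⊥ := by
    rw [← hs]
    refine equivariantHom_fiberRep_mul prodToGraph_conjProd h⁻¹ _ ?_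
    rwa [Subgroup.coe_inv, inv_mul_cancel_left]
  have hq := equivariantHom_twist_of_fiberRep hg'
  rw [inv_one, twist_one] at hq
  exact ⟨X₂, _, _, _, isIrr_twist h₂ s⁻¹,
    equivariantHom_twist_ne_bot ((Submodule.ne_bot_iff _).2 ⟨b, hb, hb0⟩) s, hq⟩

include hc₁ in
/-- Every irreducible quotient `τ₂` of `π₂` over `H₂` has a partner `τ₁`, a quotient of `π₁` over
`H₁`, such that `τ₁ ⊗ τ₂` is a quotient of `ρ`. -/
theorem exists_partner_fst (hπ₁ : IsIrr π₁) {X₂ : Type w} [AddCommGroup X₂] [Module ℂ X₂]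
    {τ₂ : Representation ℂ H₂ X₂} (h₂ : IsIrr τ₂)
    (hne : equivariantHom (π₂.comp H₂.subtype) τ₂ ≠ ⊥) :
    ∃ (X₁ : Type w) (_ : AddCommGroup X₁) (_ : Module ℂ X₁) (τ₁ : Representation ℂ H₁ X₁),
      IsIrr τ₁ ∧ equivariantHom (π₁.comp H₁.subtype) τ₁ ≠ ⊥ ∧
        equivariantHom (ρ.comp (prodToGraph γ)) (extTensor τ₁ τ₂) ≠ ⊥ := by
  have := locallyProfinite_of_isClosed hH₁
  have := locallyProfinite_of_isClosed hH₂
  obtain ⟨X₁, _, _, τ₁, h₁, a, ha, ha0⟩ := exists_irreducible_quotient hc₁ hπ₁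
  obtain ⟨b, hb, hb0⟩ := Submodule.exists_mem_ne_zero_of_ne_bot hne
  obtain ⟨g, hg⟩ := exists_fiberRep_hom (c := conjProd H₁ H₂) hρ continuous_prodToGraph
    prodToGraph_conjProd (isIrr_extTensor h₁ (hA₁ _ _ h₁) h₂ hH₁ hH₂).2
    (isAdmissible_extTensor (hA₁ _ _ h₁) (hA₂ _ _ h₂)) (map_comp_mem_equivariantHom hF ha hb)
    (map_comp_ne_zero hFs ha0 hb0)
  obtain ⟨h, s, hs⟩ := exists_mul_eq_fst γ g
  have hg' : equivariantHom (fiberRep ρ (prodToGraph γ) (conjProd H₁ H₂) (s, 1))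
      (extTensor τ₁ τ₂) ≠ ⊥ := by
    rw [← hs]
    refine equivariantHom_fiberRep_mul prodToGraph_conjProd h⁻¹ _ ?_
    rwa [Subgroup.coe_inv, inv_mul_cancel_left]
  have hq := equivariantHom_twist_of_fiberRep hg'
  rw [inv_one, twist_one] at hq
  exact ⟨X₁, _, _, _, isIrr_twist h₁ s⁻¹,
    equivariantHom_twist_ne_bot ((Submodule.ne_bot_iff _).2 ⟨a, ha, ha0⟩) s, hq⟩

end Constituents

variable (hθ : IsThetaRep.{u₁, u₂, v, w} (ρ.comp (prodToGraph γ)))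
  {V₁ V₂ V₁' V₂' : Type w} [AddCommGroup V₁] [Module ℂ V₁] [AddCommGroup V₂] [Module ℂ V₂]
  [AddCommGroup V₁'] [Module ℂ V₁'] [AddCommGroup V₂'] [Module ℂ V₂']
  {π₁ : Representation ℂ G₁ V₁} {π₂ : Representation ℂ G₂ V₂}
  {π₁' : Representation ℂ G₁ V₁'} {π₂' : Representation ℂ G₂ V₂'}
  {F : cIndSpace ρ →ₗ[ℂ] V₁ ⊗[ℂ] V₂} (hF : F ∈ equivariantHom (cInd ρ) (extTensor π₁ π₂))
  (hF0 : F ≠ 0) (hπ : (extTensor π₁ π₂).IsIrreducible)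

include hc₁ hc₂ hθ hF hF0 hπ

/-- If `π₁ ⊗ π₂` and `π₁ ⊗ π₂'` are irreducible quotients of `cInd ρ`, then the second quotient map
factors over the first one. Otherwise `π₁ ⊗ (π₂ ⊕ π₂')` would be a quotient; but the multiplicity
of `τ₂` in `π₂ ⊕ π₂'` is greater than the one in `π₂`, and both are equal to the multiplicity of
`τ₁` in `π₁`. -/
theorem exists_factor_of_fst (h₁ : IsIrr π₁) (h₂ : IsIrr π₂) (h₂' : IsIrr π₂')
    {F' : cIndSpace ρ →ₗ[ℂ] V₁ ⊗[ℂ] V₂'} (hF' : F' ∈ equivariantHom (cInd ρ) (extTensor π₁ π₂'))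
    (hF0' : F' ≠ 0) (hπ' : (extTensor π₁ π₂').IsIrreducible) :
    ∃ T ∈ equivariantHom (extTensor π₁ π₂) (extTensor π₁ π₂'), F' = T ∘ₗ F := by
  have hs := surjective_of_ne_zero hπ hF hF0
  have hs' := surjective_of_ne_zero hπ' hF' hF0'
  refine exists_factor hF hs hF' ?_
  by_contra! hex
  obtain ⟨x, hx, hx'⟩ := hex
  obtain ⟨X₁, _, _, τ₁, t₁, a, ha, ha0⟩ := exists_irreducible_quotient hc₁ h₁
  have hn₁ := (Submodule.ne_bot_iff _).2 ⟨a, ha, ha0⟩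
  obtain ⟨X₂, _, _, τ₂, t₂, hn₂, hq⟩ :=
    exists_partner_snd hH₁ hH₂ hc₂ hA₁ hA₂ hρ hF hs h₂ t₁ hn₁
  obtain ⟨X₂', _, _, τ₂', t₂', hn₂', hq'⟩ :=
    exists_partner_snd hH₁ hH₂ hc₂ hA₁ hA₂ hρ hF' hs' h₂' t₁ hn₁
  have e : Nonempty (Representation.Equiv (extTensor τ₁ τ₂') (extTensor τ₁ τ₂)) :=
    hθ.fst_injective _ _ _ _ _ _ _ _ t₁ t₂' t₁ t₂
      (isIrrQuotient_of_equivariantHom (isIrr_extTensor t₁ (hA₁ _ _ t₁) t₂' hH₁ hH₂) hq')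
      (isIrrQuotient_of_equivariantHom (isIrr_extTensor t₁ (hA₁ _ _ t₁) t₂ hH₁ hH₂) hq)
      ⟨Representation.Equiv.refl _⟩
  have := nontrivial_of_isIrreducible t₁.2
  have hn₂'' := equivariantHom_ne_bot_of_equiv (nonempty_equiv_snd t₂'.2 t₂.2 e) hn₂'
  have hsum := surjective_prod hF hs hF' hπ' hx hx'
  obtain ⟨hfin, hle⟩ := finrank_snd_le_finrank_fst hH₁ hH₂ hA₁ hA₂ hθ t₁ t₂ hq hρ
    (prodRight_symm_mem hF hF')
    ((TensorProduct.prodRight ℂ ℂ V₁ V₂ V₂').symm.surjective.comp hsum) hc₁ h₁ hn₁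
  obtain ⟨-, hle'⟩ := finrank_fst_le_finrank_snd hH₁ hH₂ hA₁ hA₂ hθ t₁ t₂ hq hρ hF hs hc₂ h₂ hn₂
  have := finite_equivariantHom hH₂ hc₂ h₂ (hA₂ _ _ t₂)
  have := finite_equivariantHom hH₂ hc₂ h₂' (hA₂ _ _ t₂)
  have hadd := finrank_add_le_finrank_prod (π := π₂) (π' := π₂') (τ := τ₂)
  have hpos := finrank_pos_of_ne_bot hn₂''
  omega

/-- The analogue of `exists_factor_of_fst` for quotients with the same second factor. -/
theorem exists_factor_of_snd (h₁ : IsIrr π₁) (h₂ : IsIrr π₂) (h₁' : IsIrr π₁')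
    {F' : cIndSpace ρ →ₗ[ℂ] V₁' ⊗[ℂ] V₂} (hF' : F' ∈ equivariantHom (cInd ρ) (extTensor π₁' π₂))
    (hF0' : F' ≠ 0) (hπ' : (extTensor π₁' π₂).IsIrreducible) :
    ∃ T ∈ equivariantHom (extTensor π₁ π₂) (extTensor π₁' π₂), F' = T ∘ₗ F := by
  have hs := surjective_of_ne_zero hπ hF hF0
  have hs' := surjective_of_ne_zero hπ' hF' hF0'
  refine exists_factor hF hs hF' ?_
  by_contra! hex
  obtain ⟨x, hx, hx'⟩ := hex
  obtain ⟨X₂, _, _, τ₂, t₂, b, hb, hb0⟩ := exists_irreducible_quotient hc₂ h₂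
  have hn₂ := (Submodule.ne_bot_iff _).2 ⟨b, hb, hb0⟩
  obtain ⟨X₁, _, _, τ₁, t₁, hn₁, hq⟩ :=
    exists_partner_fst hH₁ hH₂ hc₁ hA₁ hA₂ hρ hF hs h₁ t₂ hn₂
  obtain ⟨X₁', _, _, τ₁', t₁', hn₁', hq'⟩ :=
    exists_partner_fst hH₁ hH₂ hc₁ hA₁ hA₂ hρ hF' hs' h₁' t₂ hn₂
  have e : Nonempty (Representation.Equiv (extTensor τ₁' τ₂) (extTensor τ₁ τ₂)) :=
    hθ.snd_injective _ _ _ _ _ _ _ _ t₁' t₂ t₁ t₂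
      (isIrrQuotient_of_equivariantHom (isIrr_extTensor t₁' (hA₁ _ _ t₁') t₂ hH₁ hH₂) hq')
      (isIrrQuotient_of_equivariantHom (isIrr_extTensor t₁ (hA₁ _ _ t₁) t₂ hH₁ hH₂) hq)
      ⟨Representation.Equiv.refl _⟩
  have := nontrivial_of_isIrreducible t₂.2
  have hn₁'' := equivariantHom_ne_bot_of_equiv (nonempty_equiv_fst t₁'.2 t₁.2 e) hn₁'
  have hsum := surjective_prod hF hs hF' hπ' hx hx'
  obtain ⟨hfin, hle⟩ := finrank_fst_le_finrank_snd hH₁ hH₂ hA₁ hA₂ hθ t₁ t₂ hq hρ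
    (prodLeft_symm_mem hF hF')
    ((TensorProduct.prodLeft ℂ ℂ V₁ V₁' V₂).symm.surjective.comp hsum) hc₂ h₂ hn₂
  obtain ⟨-, hle'⟩ := finrank_snd_le_finrank_fst hH₁ hH₂ hA₁ hA₂ hθ t₁ t₂ hq hρ hF hs hc₁ h₁ hn₁
  have := finite_equivariantHom hH₁ hc₁ h₁ (hA₁ _ _ t₁)
  have := finite_equivariantHom hH₁ hc₁ h₁' (hA₁ _ _ t₁)
  have hadd := finrank_add_le_finrank_prod (π := π₁) (π' := π₁') (τ := τ₁)
  have hpos := finrank_pos_of_ne_bot hn₁''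
  omega

end Uniqueness


/-! ### The theta property of the induced representation -/

section Theta

theorem nonempty_equiv_of_exists_factor {G : Type*} [Group G] {M V W : Type*} [AddCommGroup M]
    [Module ℂ M] [AddCommGroup V] [Module ℂ V] [AddCommGroup W] [Module ℂ W]
    {π : Representation ℂ G V} {π' : Representation ℂ G W} (h : π.IsIrreducible)
    (h' : π'.IsIrreducible) {F : M →ₗ[ℂ] V} {F' : M →ₗ[ℂ] W} (h0 : F' ≠ 0)
    (hT : ∃ T ∈ equivariantHom π π', F' = T ∘ₗ F) : Nonempty (Representation.Equiv π π') := by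
  obtain ⟨T, hT, rfl⟩ := hT
  have hT0 : T ≠ 0 := by
    rintro rfl
    exact h0 (LinearMap.zero_comp _)
  exact nonempty_equiv_of_bijective hT
    ⟨injective_of_ne_zero h hT hT0, surjective_of_ne_zero h' hT hT0⟩

theorem IsIrrQuotient.exists_mem {G : Type*} [Group G] [TopologicalSpace G] {M V : Type*}
    [AddCommGroup M] [Module ℂ M] [AddCommGroup V] [Module ℂ V] {σ : Representation ℂ G M}
    {π : Representation ℂ G V} (h : IsIrrQuotient σ π) : ∃ F ∈ equivariantHom σ π, F ≠ 0 := by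
  obtain ⟨-, f, hf⟩ := h
  exact ⟨f.toLinearMap, Representation.IntertwiningMap.isIntertwining _ _ f,
    fun e => hf (Representation.IntertwiningMap.toLinearMap_injective _ _ e)⟩

theorem comp_equiv_mem {G : Type*} [Group G] {M V W : Type*} [AddCommGroup M]
    [Module ℂ M] [AddCommGroup V] [Module ℂ V] [AddCommGroup W] [Module ℂ W]
    {σ : Representation ℂ G M} {π : Representation ℂ G V} {π' : Representation ℂ G W}
    (e : Representation.Equiv π π') {F : M →ₗ[ℂ] V} (hF : F ∈ equivariantHom σ π) :
    e.toLinearEquiv.toLinearMap ∘ₗ F ∈ equivariantHom σ π' := fun g x => by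
  have := Representation.IntertwiningMap.isIntertwining _ _ e.toIntertwiningMap g (F x)
  rw [LinearMap.comp_apply, hF]
  exact this

theorem comp_equiv_ne_zero {G : Type*} [Group G] {M V W : Type*} [AddCommGroup M]
    [Module ℂ M] [AddCommGroup V] [Module ℂ V] [AddCommGroup W] [Module ℂ W]
    {π : Representation ℂ G V} {π' : Representation ℂ G W}
    (e : Representation.Equiv π π') {F : M →ₗ[ℂ] V} (hF : F ≠ 0) :
    e.toLinearEquiv.toLinearMap ∘ₗ F ≠ 0 := fun h => hF (LinearMap.ext fun x =>
  e.toLinearEquiv.injective ((LinearMap.congr_fun h x).trans (map_zero _).symm))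

variable {G₁ : Type u₁} {G₂ : Type u₂} [Group G₁] [TopologicalSpace G₁] [LocallyProfinite G₁]
  [Group G₂] [TopologicalSpace G₂] [LocallyProfinite G₂]
  {H₁ : Subgroup G₁} {H₂ : Subgroup G₂} [H₁.Normal] [H₂.Normal]

theorem isThetaRep_cInd (hH₁ : IsClosed (H₁ : Set G₁)) (hH₂ : IsClosed (H₂ : Set G₂))
    {γ : (G₁ ⧸ H₁) ≃ₜ* (G₂ ⧸ H₂)} (hc₁ : CompactSpace (G₁ ⧸ H₁)) (hc₂ : CompactSpace (G₂ ⧸ H₂))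
    (hG₁ : AllIrrAdmissible.{u₁, w} G₁) (hG : AllIrrAdmissible.{max u₁ u₂, w} (G₁ × G₂))
    (hA₁ : AllIrrAdmissible.{u₁, w} H₁) (hA₂ : AllIrrAdmissible.{u₂, w} H₂)
    {V : Type v} [AddCommGroup V] [Module ℂ V] {ρ : Representation ℂ (graphSubgroup γ) V}
    (hρ : IsSmooth ρ) (hθ : IsThetaRep.{u₁, u₂, v, w} (ρ.comp (prodToGraph γ))) :
    IsThetaRep.{u₁, u₂, max u₁ u₂ v, w} (cInd ρ) where
  smooth := isSmooth_cInd
  multiplicity_le_one W _ _ P hP := by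
    have haP := hG _ _ hP
    obtain ⟨V₁, V₂, _, _, _, _, π₁, π₂, h₁, h₂, ⟨e⟩⟩ := exists_extTensor_equiv hG₁ hP.2 haP
    have hirr : (extTensor π₁ π₂).IsIrreducible :=
      isIrreducible_extTensor h₁.2 (hasScalarEnd_of_isAdmissible h₁.2 (hG₁ _ _ h₁)) h₂.2
    have hscal := hasScalarEnd_of_isAdmissible hirr (hG _ _ ⟨isSmooth_extTensor h₁.1 h₂.1, hirr⟩)
    rw [rank_le_one_iff]
    by_cases hzero : ∀ S : Representation.IntertwiningMap (cInd ρ) P, S = 0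
    · exact ⟨0, fun S => ⟨0, by rw [hzero S, zero_smul]⟩⟩
    push Not at hzero
    obtain ⟨S, hS⟩ := hzero
    have hlin : ∀ S' : Representation.IntertwiningMap (cInd ρ) P, S' ≠ 0 → S'.toLinearMap ≠ 0 :=
      fun S' h h' => h (Representation.IntertwiningMap.toLinearMap_injective _ _ h')
    refine ⟨S, fun S' => ?_⟩
    by_cases hS' : S' = 0
    · exact ⟨0, by rw [hS', zero_smul]⟩
    obtain ⟨T, hT, hTS⟩ := exists_factor_of_fst hH₁ hH₂ hc₁ hc₂ hA₁ hA₂ hρ hθ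
      (comp_equiv_mem e.symm (Representation.IntertwiningMap.isIntertwining _ _ S))
      (comp_equiv_ne_zero e.symm (hlin S hS)) hirr h₁ h₂ h₂
      (comp_equiv_mem e.symm (Representation.IntertwiningMap.isIntertwining _ _ S'))
      (comp_equiv_ne_zero e.symm (hlin S' hS')) hirr
    obtain ⟨z, hz⟩ := hscal T hT
    refine ⟨z, Representation.IntertwiningMap.toLinearMap_injective _ _ (LinearMap.ext fun x => ?_)⟩
    have h1 := LinearMap.congr_fun hTS x
    rw [LinearMap.comp_apply T, hz] at h1
    refine e.symm.toLinearEquiv.injective (Eq.trans ?_ h1.symm)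
    exact map_smul e.symm.toLinearEquiv z (S x)
  fst_injective V₁ V₂ V₁' V₂' _ _ _ _ _ _ _ _ π₁ π₂ π₁' π₂' h₁ h₂ h₁' h₂' hQ hQ' e := by
    obtain ⟨e⟩ := e
    obtain ⟨F, hF, hF0⟩ := hQ.exists_mem
    obtain ⟨F', hF', hF0'⟩ := hQ'.exists_mem
    obtain ⟨i⟩ := nonempty_equiv_extTensor (π₁ := π₁') (π₂ := π₂') ⟨e.symm⟩
      ⟨Representation.Equiv.refl _⟩
    have hirr : (extTensor π₁ π₂').IsIrreducible :=
      isIrreducible_extTensor h₁.2 (hasScalarEnd_of_isAdmissible h₁.2 (hG₁ _ _ h₁)) h₂'.2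
    obtain ⟨j⟩ := nonempty_equiv_of_exists_factor hQ.1.2 hirr (comp_equiv_ne_zero i hF0')
      (exists_factor_of_fst hH₁ hH₂ hc₁ hc₂ hA₁ hA₂ hρ hθ hF hF0 hQ.1.2 h₁ h₂ h₂'
        (comp_equiv_mem i hF') (comp_equiv_ne_zero i hF0') hirr)
    exact ⟨j.trans i.symm⟩
  snd_injective V₁ V₂ V₁' V₂' _ _ _ _ _ _ _ _ π₁ π₂ π₁' π₂' h₁ h₂ h₁' h₂' hQ hQ' e := by
    obtain ⟨e⟩ := e
    obtain ⟨F, hF, hF0⟩ := hQ.exists_mem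
    obtain ⟨F', hF', hF0'⟩ := hQ'.exists_mem
    obtain ⟨i⟩ := nonempty_equiv_extTensor (π₁ := π₁') (π₂ := π₂') ⟨Representation.Equiv.refl _⟩
      ⟨e.symm⟩
    have hirr : (extTensor π₁' π₂).IsIrreducible :=
      isIrreducible_extTensor h₁'.2 (hasScalarEnd_of_isAdmissible h₁'.2 (hG₁ _ _ h₁')) h₂.2
    obtain ⟨j⟩ := nonempty_equiv_of_exists_factor hQ.1.2 hirr (comp_equiv_ne_zero i hF0')
      (exists_factor_of_snd hH₁ hH₂ hc₁ hc₂ hA₁ hA₂ hρ hθ hF hF0 hQ.1.2 h₁ h₂ h₁'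
        (comp_equiv_mem i hF') (comp_equiv_ne_zero i hF0') hirr)
    exact ⟨j.trans i.symm⟩

end Theta

end LocalTheta

end

theorem theorem10p5
    {G₁ : Type u₁} [Group G₁] [TopologicalSpace G₁]
    [LocalTheta.LocallyProfinite G₁] [SigmaCompactSpace G₁]
    {G₂ : Type u₂} [Group G₂] [TopologicalSpace G₂]
    [LocalTheta.LocallyProfinite G₂] [SigmaCompactSpace G₂]
    (H₁ : Subgroup G₁) [H₁.Normal] (hH₁ : IsClosed (H₁ : Set G₁))
    (H₂ : Subgroup G₂) [H₂.Normal] (hH₂ : IsClosed (H₂ : Set G₂))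
    (γ : (G₁ ⧸ H₁) ≃ₜ* (G₂ ⧸ H₂)) (hc : CompactSpace (G₁ ⧸ H₁))
    (hG₁ : LocalTheta.AllIrrAdmissible.{u₁, w} G₁)
    (hG₂ : LocalTheta.AllIrrAdmissible.{u₂, w} G₂)
    (hG : LocalTheta.AllIrrAdmissible.{max u₁ u₂, w} (G₁ × G₂))
    (hA₁ : LocalTheta.AllIrrAdmissible.{u₁, w} H₁)
    (hA₂ : LocalTheta.AllIrrAdmissible.{u₂, w} H₂)
    {V : Type v} [AddCommGroup V] [Module ℂ V]
    (ρ : Representation ℂ (LocalTheta.graphSubgroup γ) V) (hρ : LocalTheta.IsSmooth ρ)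
    (hθ : LocalTheta.IsThetaRep.{u₁, u₂, v, w} (ρ.comp (LocalTheta.prodToGraph γ))) :
    LocalTheta.IsThetaRep.{u₁, u₂, max u₁ u₂ v, w} (LocalTheta.cInd ρ) := by
  have hc₂ : CompactSpace (G₂ ⧸ H₂) := γ.toHomeomorph.compactSpace
  exact LocalTheta.isThetaRep_cInd hH₁ hH₂ hc hc₂ hG₁ hG hA₁ hA₂ hρ hθ
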